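/- Let $0<T<\infty$ and $Q=(0,T)\times(0,\infty)$. Let $g:\mathbb R\to\mathbb R$ be continuous and nondecreasing with $g(0)=0$ and $\int_1^\infty (g(s)-g(-s))\,s^{-3}\,ds<\infty$. Let $\mathbb X$ be the set of functions $\zeta$ of class $C^{1,2}$ (i.e. $\zeta,\zeta_t,\zeta_x,\zeta_{xx}$ continuous) with compact support in $[0,T)\times[0,\infty)$ such that $\zeta_x(t,0)=0$ for all $t\in[0,T)$. For bounded (signed) Borel measures $\nu$ on $(0,\infty)$ and $\mu$ on $[0,T)$, a weak solution of $$u_t-u_{xx}=0\ \text{ in } Q,\qquad -u_x(\cdot,0)+g(u(\cdot,0))=\mu\ \text{ on }[0,T),\qquad u(0,\cdot)=\nu\ \text{ on }(0,\infty)$$ is a function $u$ on $\overline Q$ with $u\in L^1_{loc}(\overline Q)$, $u(\cdot,0)\in L^1(0,T)$ and $g(u(\cdot,0))\in L^1(0,T)$, whose boundary values $u(\cdot,0)$ are its lateral trace in the sense that $$\lim_{\varepsilon\to0^+}\frac1\varepsilon\int_0^T\!\!\int_0^\varepsilon|u(t,x)-u(t,0)|\,dx\,dt=0,$$ and such that for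 every $\zeta\in\mathbb X$ $$-\int_0^T\!\!\int_0^\infty(\zeta_t+\zeta_{xx})\,u\,dx\,dt+\int_0^T g(u(t,0))\,\zeta(t,0)\,dt=\int_{(0,\infty)}\zeta(0,x)\,d\nu(x)+\int_{[0,T)}\zeta(t,0)\,d\mu(t).$$ Then for all bounded Borel measures $\nu$ on $(0,\infty)$ and $\mu$ on $[0,T)$ there exists a weak solution $u=u_{\nu,\mu}\in L^1(Q)$, and it is unique: any two weak solutions in $L^1(Q)$ for the same data coincide a.e. in $Q$ and have the same boundary values $u(t,0)$ for a.e. $t\in(0,T)$. Furthermore the mapping $(\nu,\mu)\mapsto u_{\nu,\mu}$ is nondecreasing: if $\nu\le\nu'$ and $\mu\le\mu'$, then $u_{\nu,\mu}\le u_{\nu',\mu'}$ a.e. in $Q$, and $u_{\nu,\mu}(t,0)\le u_{\nu',\mu'}(t,0)$ for a.e. $t\in(0,T)$. -/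

import Mathlib

open MeasureTheory Set Filter Topology

/-- The open parabolic cylinder `(0,T) × (0,∞)`; points are written `(t, x)`, time first. -/
def openCylinder (T : ℝ) : Set (ℝ × ℝ) := Ioo 0 T ×ˢ Ioi 0

/-- The half-open cylinder `[0,T) × [0,∞)`, on which test functions live. -/
def testCylinder (T : ℝ) : Set (ℝ × ℝ) := Ico 0 T ×ˢ Ici 0

/-- The closed cylinder `[0,T] × [0,∞)`. -/
def closedCylinder (T : ℝ) : Set (ℝ × ℝ) := Icc 0 T ×ˢ Ici 0

/-- Test functions: the functions `ζ` of class `C^{1,2}` with compact support in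
`[0,T) × [0,∞)` such that `ζ_x(t,0) = 0`. The fields `dt`, `dx`, `dxx` are the derivatives
`ζ_t`, `ζ_x`, `ζ_xx` (one-sided at `t = 0` and at `x = 0`). Only the values on
`[0,T) × [0,∞)` matter. -/
structure NeumannTestFunction (T : ℝ) where
  /-- the function `ζ` -/
  val : ℝ × ℝ → ℝ
  /-- the derivative `ζ_t` -/
  dt : ℝ × ℝ → ℝ
  /-- the derivative `ζ_x` -/
  dx : ℝ × ℝ → ℝ
  /-- the derivative `ζ_xx` -/
  dxx : ℝ × ℝ → ℝ
  hasDeriv_t : ∀ t ∈ Ico (0 : ℝ) T, ∀ x ∈ Ici (0 : ℝ),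
    HasDerivWithinAt (fun s => val (s, x)) (dt (t, x)) (Ico 0 T) t
  hasDeriv_x : ∀ t ∈ Ico (0 : ℝ) T, ∀ x ∈ Ici (0 : ℝ),
    HasDerivWithinAt (fun y => val (t, y)) (dx (t, x)) (Ici 0) x
  hasDeriv_xx : ∀ t ∈ Ico (0 : ℝ) T, ∀ x ∈ Ici (0 : ℝ),
    HasDerivWithinAt (fun y => dx (t, y)) (dxx (t, x)) (Ici 0) x
  continuousOn_val : ContinuousOn val (testCylinder T)
  continuousOn_dt : ContinuousOn dt (testCylinder T)
  continuousOn_dx : ContinuousOn dx (testCylinder T)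
  continuousOn_dxx : ContinuousOn dxx (testCylinder T)
  compactSupport : ∃ K : Set (ℝ × ℝ), IsCompact K ∧ K ⊆ testCylinder T ∧
    ∀ p ∈ testCylinder T \ K, val p = 0
  neumann : ∀ t ∈ Ico (0 : ℝ) T, dx (t, 0) = 0

/-- The values `u(t,0)` on the lateral boundary are the trace of `u`:
`(1/ε) ∫₀ᵀ ∫₀^ε |u(t,x) - u(t,0)| dx dt → 0` as `ε → 0⁺`. -/
def HasLateralTrace (T : ℝ) (u : ℝ × ℝ → ℝ) : Prop :=
  Tendsto (fun ε : ℝ => ε⁻¹ * ∫ p in Ioo 0 T ×ˢ Ioo 0 ε, |u p - u (p.1, 0)|)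
    (𝓝[>] 0) (𝓝 0)

/-- Weak solutions `u` of `u_t - u_xx = 0` in `(0,T) × (0,∞)`,
`-u_x(·,0) + g(u(·,0)) = μ` on `[0,T)`, `u(0,·) = ν` on `(0,∞)`. Bounded (signed) Borel
measures are Mathlib's `SignedMeasure`s, and `∫ᵛ x, f x ∂<•ν` is the integral of `f` against
the signed measure `ν`. -/
structure IsWeakSolution (T : ℝ) (g : ℝ → ℝ) (ν : SignedMeasure (Ioi (0 : ℝ)))
    (μ : SignedMeasure (Ico (0 : ℝ) T)) (u : ℝ × ℝ → ℝ) : Prop where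
  locallyIntegrable : LocallyIntegrableOn u (closedCylinder T) volume
  integrable_boundary : IntegrableOn (fun t => u (t, 0)) (Ioo 0 T) volume
  integrable_flux : IntegrableOn (fun t => g (u (t, 0))) (Ioo 0 T) volume
  trace : HasLateralTrace T u
  weak_eq : ∀ ζ : NeumannTestFunction T,
    -(∫ p in openCylinder T, (ζ.dt p + ζ.dxx p) * u p)
        + ∫ t in Ioo 0 T, g (u (t, 0)) * ζ.val (t, 0)
      = (∫ᵛ x, ζ.val (0, (x : ℝ)) ∂<•ν) + ∫ᵛ t, ζ.val ((t : ℝ), 0) ∂<•μ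

/-- Weak solutions that belong to `L¹((0,T) × (0,∞))`. -/
def IsL1WeakSolution (T : ℝ) (g : ℝ → ℝ) (ν : SignedMeasure (Ioi (0 : ℝ)))
    (μ : SignedMeasure (Ico (0 : ℝ) T)) (u : ℝ × ℝ → ℝ) : Prop :=
  IsWeakSolution T g ν μ u ∧ IntegrableOn u (openCylinder T) volume

/-! The problem reduces to a nonlinear Abel equation for the boundary values. Let `k(t) =
(πt)^{-1/2}`, which is `heatKer t 0`, and let `P_M` be the potential of a finite measure `M` on the
parabolic boundary for the Neumann heat kernel. Green's formula shows that `P_M` solves the linear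
problem with data `M` (`NeumannTestFunction.integral_heat_mul_heatPotential`), and dominated
convergence together with Fubini gives its lateral trace (`hasLateralTrace_heatPotential`). An `L¹`
function orthogonal to every `ζ_t + ζ_xx` vanishes (`ae_eq_zero_of_forall_testFunction`): test
functions `η(t) cos(ξx)`, truncated in `x`, with `η` solving a backward ODE, annihilate all Fourier
coefficients of the even reflection. Hence a weak solution is the linear solution with lateral data
`μ - g(u(·,0))`, and its boundary values `h` satisfy `h = f - k * g(h)`, where `f` is the boundary
value of the potential of `(ν, μ)`. Conversely every solution `h` of this equation produces a weak
solution.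

Comparison for the Abel equation (`abel_comparison`) replaces an energy or Kato argument. If `d =
-P_M(·,0) - k * G` with `G ≥ 0` wherever `d > 0`, apply the truncated half derivative `d ↦ k(ε) d -
κ_ε * d` with `κ_ε(t) = -k'(t+ε)`. It is nonnegative on `P_M(·,0)`, and it turns `k` into an
explicit approximate identity. Since `κ_ε` has mass at most `k(ε) - k(T+ε)` on `(0,T)`, integrating
over `{d > 0}` leaves `k(T+ε) ∫ d⁺ ≤ -∫_{d>0} (δ_ε * G)`, whose right side tends to `-∫_{d>0} G ≤
0`. So `d⁺ = 0`. The order then passes from the boundary to the interior by first passage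
(`interior_comparison`): convolving the boundary values with the hitting density of `x = 0` gives a
lower bound for the difference of two ordered solutions. Uniqueness is comparison used in both
directions.

For existence (`exists_abelSolution`), a Lipschitz `g` is handled by a contraction in an
exponentially weighted `L¹`. A general `g` is reached by inf-convolution, regularising the positive
and negative sides in two nested limits, each monotone by comparison. Comparison with the linear
problem bounds `|h|` by the potential of the total variation of the data, which lies in weak `L²`
because `k` does. The growth condition on `g` is exactly what sends weak `L²` into `L¹`, and this
supplies the dominating function for the limits. -/

/-! ### The heat kernel: derivatives, mass, boundary values -/

/-- The heat kernel of the half line with Neumann condition and pole on the boundary,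
`(π t)^{-1/2} e^{-x²/(4t)}` for `t > 0`, and `0` for `t ≤ 0`. -/
noncomputable def heatKer (t x : ℝ) : ℝ := (√(Real.pi * t))⁻¹ * Real.exp (-x ^ 2 / (4 * t))

lemma heatKer_nonneg (t x : ℝ) : 0 ≤ heatKer t x := by unfold heatKer; positivity

/-- The real square root of a nonpositive number is `0`, and so is its inverse. Causality is thereby
built into the kernel, and convolutions in time can be taken over the whole line. -/
lemma heatKer_of_nonpos {t : ℝ} (ht : t ≤ 0) (x : ℝ) : heatKer t x = 0 := by
  have : Real.pi * t ≤ 0 := mul_nonpos_of_nonneg_of_nonpos Real.pi_pos.le ht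
  simp [heatKer, Real.sqrt_eq_zero_of_nonpos this]

lemma heatKer_neg (t x : ℝ) : heatKer t (-x) = heatKer t x := by simp [heatKer]

lemma heatKer_zero_right (t : ℝ) : heatKer t 0 = (√(Real.pi * t))⁻¹ := by simp [heatKer]

lemma heatKer_eq_mul (t x : ℝ) : heatKer t x = heatKer t 0 * Real.exp (-x ^ 2 / (4 * t)) := by
  simp [heatKer]

lemma heatKer_zero_pos {t : ℝ} (ht : 0 < t) : 0 < heatKer t 0 := by
  rw [heatKer_zero_right]; positivity

lemma heatKer_anti {x y : ℝ} (t : ℝ) (h : x ^ 2 ≤ y ^ 2) : heatKer t y ≤ heatKer t x := by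
  rcases le_or_gt t 0 with ht | ht
  · simp [heatKer_of_nonpos ht]
  · unfold heatKer
    gcongr

lemma heatKer_le (t x : ℝ) : heatKer t x ≤ heatKer t 0 := heatKer_anti t (by simpa using sq_nonneg x)

lemma heatKer_zero_anti {s t : ℝ} (hs : 0 < s) (h : s ≤ t) : heatKer t 0 ≤ heatKer s 0 := by
  rw [heatKer_zero_right, heatKer_zero_right]
  gcongr

lemma measurable_heatKer : Measurable (fun p : ℝ × ℝ => heatKer p.1 p.2) := by
  unfold heatKer; fun_prop

@[fun_prop]
lemma Measurable.heatKer {α : Type*} [MeasurableSpace α] {f g : α → ℝ} (hf : Measurable f)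
    (hg : Measurable g) : Measurable (fun a => heatKer (f a) (g a)) :=
  measurable_heatKer.comp (hf.prodMk hg)

lemma continuous_heatKer_right (t : ℝ) : Continuous (heatKer t) := by
  unfold heatKer; fun_prop

lemma continuousOn_heatKer : ContinuousOn (fun p : ℝ × ℝ => heatKer p.1 p.2) {p | 0 < p.1} := by
  unfold heatKer
  have h1 : ∀ p : ℝ × ℝ, p ∈ {p : ℝ × ℝ | 0 < p.1} → √(Real.pi * p.1) ≠ 0 := fun p hp => by
    have : 0 < p.1 := hp
    positivity
  have h2 : ∀ p : ℝ × ℝ, p ∈ {p : ℝ × ℝ | 0 < p.1} → 4 * p.1 ≠ 0 := fun p hp => by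
    have : 0 < p.1 := hp
    positivity
  refine ContinuousOn.mul (ContinuousOn.inv₀ (by fun_prop) h1) ?_
  exact Real.continuous_exp.comp_continuousOn (ContinuousOn.div (by fun_prop) (by fun_prop) h2)

lemma hasDerivAt_heatKer_right (t x : ℝ) :
    HasDerivAt (heatKer t) (-(x / (2 * t)) * heatKer t x) x := by
  have h : HasDerivAt (fun x : ℝ => -x ^ 2 / (4 * t)) (-(2 * x) / (4 * t)) x := by
    simpa using ((hasDerivAt_pow 2 x).neg).div_const (4 * t)
  refine (h.exp.const_mul (√(Real.pi * t))⁻¹).congr_deriv ?_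
  rw [show -(2 * x) / (4 * t) = -(x / (2 * t)) by
    rw [show (4 : ℝ) * t = 2 * (2 * t) by ring, neg_div, mul_div_mul_left _ _ two_ne_zero]]
  unfold heatKer; ring

lemma hasDerivAt_heatKer_right_right (t x : ℝ) :
    HasDerivAt (fun x => -(x / (2 * t)) * heatKer t x)
      ((x ^ 2 / (4 * t ^ 2) - 1 / (2 * t)) * heatKer t x) x := by
  have h1 : HasDerivAt (fun x : ℝ => -(x / (2 * t))) (-(1 / (2 * t))) x :=
    ((hasDerivAt_id x).div_const (2 * t)).neg
  refine (h1.mul (hasDerivAt_heatKer_right t x)).congr_deriv ?_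
  rcases eq_or_ne t 0 with rfl | ht
  · simp
  · field_simp; ring

lemma hasDerivAt_heatKer_left {t : ℝ} (ht : 0 < t) (x : ℝ) :
    HasDerivAt (fun t => heatKer t x) ((x ^ 2 / (4 * t ^ 2) - 1 / (2 * t)) * heatKer t x) t := by
  have hp : 0 < Real.pi * t := by positivity
  have h1 : HasDerivAt (fun t : ℝ => √(Real.pi * t)) (Real.pi / (2 * √(Real.pi * t))) t := by
    simpa using ((hasDerivAt_id t).const_mul Real.pi).sqrt hp.ne'
  have h2 := h1.fun_inv (by positivity)
  have h3 : HasDerivAt (fun t : ℝ => -x ^ 2 / (4 * t)) (x ^ 2 / (4 * t ^ 2)) t := by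
    have h := (((hasDerivAt_id t).const_mul 4).fun_inv (by simpa using ht.ne')).const_mul (-x ^ 2)
    refine (h.congr_deriv ?_)
    simp only [id]; field_simp
  have h4 := h2.mul h3.exp
  refine h4.congr_deriv ?_
  have h5 : √(Real.pi * t) ^ 2 = Real.pi * t := Real.sq_sqrt hp.le
  unfold heatKer
  rw [h5]
  field_simp
  ring

lemma integrable_heatKer_right {t : ℝ} (ht : 0 < t) : Integrable (heatKer t) := by
  unfold heatKer
  refine Integrable.const_mul ?_ _
  have := integrable_exp_neg_mul_sq (b := (4 * t)⁻¹) (by positivity)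
  refine this.congr (ae_of_all _ fun x => ?_)
  simp only; congr 1; field_simp

lemma integral_heatKer_right {t : ℝ} (ht : 0 < t) : ∫ x, heatKer t x = 2 := by
  unfold heatKer
  rw [integral_const_mul]
  have h := integral_gaussian (4 * t)⁻¹
  have h2 : ∫ x : ℝ, Real.exp (-x ^ 2 / (4 * t)) = √(Real.pi / (4 * t)⁻¹) := by
    rw [← h]; congr 1; ext x; congr 1; field_simp
  rw [h2, div_inv_eq_mul, show Real.pi * (4 * t) = 2 ^ 2 * (Real.pi * t) by ring,
    Real.sqrt_mul (x := 2 ^ 2) (by positivity), Real.sqrt_sq (by norm_num)]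
  field_simp

lemma heatKer_zero_eq_rpow {t : ℝ} (ht : 0 < t) :
    heatKer t 0 = (√Real.pi)⁻¹ * t ^ (-(1 / 2) : ℝ) := by
  rw [heatKer_zero_right, Real.sqrt_mul Real.pi_pos.le, mul_inv, Real.rpow_neg ht.le,
    ← Real.sqrt_eq_rpow]

lemma integrableOn_heatKer_zero (a : ℝ) : IntegrableOn (fun t => heatKer t 0) (Iic a) := by
  rcases le_or_gt a 0 with ha | ha
  · exact (integrableOn_zero).congr_fun (fun t ht => (heatKer_of_nonpos (le_trans ht ha) 0).symm)
      measurableSet_Iic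
  rw [← Iic_union_Ioc_eq_Iic ha.le]
  refine IntegrableOn.union ?_ ?_
  · exact (integrableOn_zero).congr_fun (fun t ht => (heatKer_of_nonpos ht 0).symm)
      measurableSet_Iic
  · have h := (intervalIntegral.intervalIntegrable_rpow' (a := 0) (b := a)
      (r := (-(1 / 2) : ℝ)) (by norm_num)).const_mul ((√Real.pi)⁻¹)
    rw [intervalIntegrable_iff_integrableOn_Ioc_of_le ha.le] at h
    exact h.congr_fun (fun t ht => (heatKer_zero_eq_rpow ht.1).symm) measurableSet_Ioc

lemma integral_heatKer_zero {a : ℝ} (ha : 0 ≤ a) :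
    ∫ t in Iic a, heatKer t 0 = 2 * (√Real.pi)⁻¹ * √a := by
  have h0 : ∫ t in Iic (0 : ℝ), heatKer t 0 = 0 :=
    setIntegral_eq_zero_of_forall_eq_zero fun t ht => heatKer_of_nonpos ht 0
  rw [← Iic_union_Ioc_eq_Iic ha, setIntegral_union (Iic_disjoint_Ioc le_rfl) measurableSet_Ioc
    ((integrableOn_heatKer_zero a).mono_set (Iic_subset_Iic.2 ha))
    ((integrableOn_heatKer_zero a).mono_set Ioc_subset_Iic_self), h0, zero_add,
    setIntegral_congr_fun measurableSet_Ioc (fun t ht => heatKer_zero_eq_rpow ht.1),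
    integral_const_mul, ← intervalIntegral.integral_of_le ha, integral_rpow (by norm_num),
    Real.sqrt_eq_rpow a]
  norm_num
  ring

/-! ### Support and bounds of test functions -/

namespace NeumannTestFunction

variable {T : ℝ} (ζ : NeumannTestFunction T)

/-- A test function and its derivatives vanish outside some `[0,T₁] × [0,R]` with `T₁ < T`. -/
lemma exists_support (hT : 0 < T) : ∃ T₁ R : ℝ, 0 ≤ T₁ ∧ T₁ < T ∧ 0 ≤ R ∧
    ∀ t ∈ Ico (0 : ℝ) T, ∀ x ∈ Ici (0 : ℝ), (T₁ < t ∨ R < x) →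
      ζ.val (t, x) = 0 ∧ ζ.dt (t, x) = 0 ∧ ζ.dx (t, x) = 0 ∧ ζ.dxx (t, x) = 0 := by
  obtain ⟨K, hK, hKs, hK0⟩ := ζ.compactSupport
  obtain ⟨T₁, hT0, hT1, hT2⟩ : ∃ T₁, 0 ≤ T₁ ∧ T₁ < T ∧ ∀ p ∈ K, p.1 ≤ T₁ := by
    rcases K.eq_empty_or_nonempty with rfl | hne
    · exact ⟨0, le_rfl, hT, by simp⟩
    · obtain ⟨p, hp, hm⟩ := hK.exists_isMaxOn hne continuous_fst.continuousOn
      exact ⟨p.1, (hKs hp).1.1, (hKs hp).1.2, fun q hq => hm hq⟩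
  obtain ⟨R, hR0, hR⟩ : ∃ R, 0 ≤ R ∧ ∀ p ∈ K, p.2 ≤ R := by
    rcases K.eq_empty_or_nonempty with rfl | hne
    · exact ⟨0, le_rfl, by simp⟩
    · obtain ⟨p, hp, hm⟩ := hK.exists_isMaxOn hne continuous_snd.continuousOn
      exact ⟨p.2, (hKs hp).2, fun q hq => hm hq⟩
  have hv : ∀ t ∈ Ico (0 : ℝ) T, ∀ x ∈ Ici (0 : ℝ), (T₁ < t ∨ R < x) → ζ.val (t, x) = 0 := by
    intro t ht x hx h
    refine hK0 _ ⟨⟨ht, hx⟩, fun hm => ?_⟩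
    rcases h with h | h
    · exact absurd (hT2 _ hm) (not_le.2 h)
    · exact absurd (hR _ hm) (not_le.2 h)
  have hux : ∀ x ∈ Ici (0 : ℝ), UniqueDiffWithinAt ℝ (Ici (0 : ℝ)) x := uniqueDiffOn_Ici 0
  have hut : ∀ t ∈ Ico (0 : ℝ) T, UniqueDiffWithinAt ℝ (Ico (0 : ℝ) T) t := uniqueDiffOn_Ico 0 T
  have hnx : ∀ x : ℝ, R < x → ∀ᶠ y in 𝓝[Ici 0] x, y ∈ Ici (0 : ℝ) ∧ R < y := fun x hx =>
    eventually_mem_nhdsWithin.and (mem_nhdsWithin_of_mem_nhds (Ioi_mem_nhds hx))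
  have hnt : ∀ t : ℝ, T₁ < t → ∀ᶠ y in 𝓝[Ico 0 T] t, y ∈ Ico (0 : ℝ) T ∧ T₁ < y := fun x hx =>
    eventually_mem_nhdsWithin.and (mem_nhdsWithin_of_mem_nhds (Ioi_mem_nhds hx))
  have hdx : ∀ t ∈ Ico (0 : ℝ) T, ∀ x ∈ Ici (0 : ℝ), (T₁ < t ∨ R < x) → ζ.dx (t, x) = 0 := by
    intro t ht x hx h
    refine (hux x hx).eq_deriv _ (ζ.hasDeriv_x t ht x hx) ?_
    refine (hasDerivWithinAt_const x _ (0 : ℝ)).congr_of_eventuallyEq ?_ (hv t ht x hx h)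
    rcases h with h | h
    · filter_upwards [eventually_mem_nhdsWithin] with y hy using hv t ht y hy (Or.inl h)
    · filter_upwards [hnx x h] with y hy using hv t ht y hy.1 (Or.inr hy.2)
  refine ⟨T₁, R, hT0, hT1, hR0, fun t ht x hx h => ⟨hv t ht x hx h, ?_, hdx t ht x hx h, ?_⟩⟩
  · refine (hut t ht).eq_deriv _ (ζ.hasDeriv_t t ht x hx) ?_
    refine (hasDerivWithinAt_const t _ (0 : ℝ)).congr_of_eventuallyEq ?_ (hv t ht x hx h)
    rcases h with h | h
    · filter_upwards [hnt t h] with y hy using hv y hy.1 x hx (Or.inl hy.2)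
    · filter_upwards [eventually_mem_nhdsWithin] with y hy using hv y hy x hx (Or.inr h)
  · refine (hux x hx).eq_deriv _ (ζ.hasDeriv_xx t ht x hx) ?_
    refine (hasDerivWithinAt_const x _ (0 : ℝ)).congr_of_eventuallyEq ?_ (hdx t ht x hx h)
    rcases h with h | h
    · filter_upwards [eventually_mem_nhdsWithin] with y hy using hdx t ht y hy (Or.inl h)
    · filter_upwards [hnx x h] with y hy using hdx t ht y hy.1 (Or.inr hy.2)

lemma exists_bound (hT : 0 < T) : ∃ C : ℝ, 0 ≤ C ∧ ∀ p ∈ testCylinder T,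
    |ζ.val p| ≤ C ∧ |ζ.dt p + ζ.dxx p| ≤ C := by
  obtain ⟨T₁, R, hT0, hT1, hR, h⟩ := ζ.exists_support hT
  have hK : IsCompact (Icc 0 T₁ ×ˢ Icc 0 R) := isCompact_Icc.prod isCompact_Icc
  have hsub : Icc 0 T₁ ×ˢ Icc 0 R ⊆ testCylinder T := fun p hp =>
    ⟨⟨hp.1.1, hp.1.2.trans_lt hT1⟩, hp.2.1⟩
  obtain ⟨C₁, h1⟩ := hK.exists_bound_of_continuousOn (ζ.continuousOn_val.mono hsub)
  obtain ⟨C₂, h2⟩ := hK.exists_bound_of_continuousOn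
    ((ζ.continuousOn_dt.add ζ.continuousOn_dxx).mono hsub)
  refine ⟨max 0 (max C₁ C₂), le_max_left _ _, fun p hp => ?_⟩
  by_cases hm : p ∈ Icc 0 T₁ ×ˢ Icc 0 R
  · exact ⟨(h1 p hm).trans (by simp), (h2 p hm).trans (by simp)⟩
  · have : T₁ < p.1 ∨ R < p.2 := by
      by_contra! hc
      exact hm ⟨⟨hp.1.1, hc.1⟩, ⟨hp.2, hc.2⟩⟩
    obtain ⟨e1, e2, -, e3⟩ := h p.1 hp.1 p.2 hp.2 this
    simp only [Prod.mk.eta] at e1 e2 e3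
    simp [e1, e2, e3]

end NeumannTestFunction

lemma measurableSet_testCylinder (T : ℝ) : MeasurableSet (testCylinder T) :=
  measurableSet_Ico.prod measurableSet_Ici

lemma measurableSet_openCylinder (T : ℝ) : MeasurableSet (openCylinder T) :=
  measurableSet_Ioo.prod measurableSet_Ioi

lemma openCylinder_subset_testCylinder (T : ℝ) : openCylinder T ⊆ testCylinder T :=
  prod_mono Ioo_subset_Ico_self Ioi_subset_Ici_self

/-! ### The Neumann heat kernel with arbitrary pole -/

/-- The heat kernel of the half line with Neumann condition and pole `z = (s, y)`. -/
noncomputable def neumannKer (p z : ℝ × ℝ) : ℝ :=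
  (heatKer (p.1 - z.1) (p.2 - z.2) + heatKer (p.1 - z.1) (p.2 + z.2)) / 2

lemma neumannKer_nonneg (p z : ℝ × ℝ) : 0 ≤ neumannKer p z := by
  have := heatKer_nonneg (p.1 - z.1) (p.2 - z.2)
  have := heatKer_nonneg (p.1 - z.1) (p.2 + z.2)
  unfold neumannKer; positivity

lemma neumannKer_le (p z : ℝ × ℝ) : neumannKer p z ≤ heatKer (p.1 - z.1) 0 := by
  have := heatKer_le (p.1 - z.1) (p.2 - z.2)
  have := heatKer_le (p.1 - z.1) (p.2 + z.2)
  unfold neumannKer; linarith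

lemma neumannKer_zero (t : ℝ) (z : ℝ × ℝ) : neumannKer (t, 0) z = heatKer (t - z.1) z.2 := by
  simp [neumannKer, heatKer_neg]

lemma neumannKer_of_le {p z : ℝ × ℝ} (h : p.1 ≤ z.1) : neumannKer p z = 0 := by
  simp [neumannKer, heatKer_of_nonpos (sub_nonpos.2 h)]

@[fun_prop]
lemma Measurable.neumannKer {α : Type*} [MeasurableSpace α] {f g : α → ℝ × ℝ} (hf : Measurable f)
    (hg : Measurable g) : Measurable (fun a => neumannKer (f a) (g a)) := by
  unfold _root_.neumannKer; fun_prop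

lemma integrable_neumannKer_right {t : ℝ} {z : ℝ × ℝ} (h : z.1 < t) :
    Integrable (fun x => neumannKer (t, x) z) := by
  have hi := integrable_heatKer_right (sub_pos.2 h)
  exact ((hi.comp_sub_right z.2).add (hi.comp_add_right z.2)).div_const 2

lemma integral_neumannKer_right {t : ℝ} {z : ℝ × ℝ} (h : z.1 < t) :
    ∫ x, neumannKer (t, x) z = 2 := by
  have hi := integrable_heatKer_right (sub_pos.2 h)
  simp only [neumannKer]
  rw [integral_div, integral_add (hi.comp_sub_right z.2) (hi.comp_add_right z.2),
    integral_sub_right_eq_self (fun x => heatKer (t - z.1) x),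
    integral_add_right_eq_self (fun x => heatKer (t - z.1) x),
    integral_heatKer_right (sub_pos.2 h)]
  norm_num

/-- At each time the space integral is enlarged to the whole line, where it equals `2`. Only
uniformity in the pole matters, since that allows integration against any finite measure. -/
lemma lintegral_neumannKer_le (T : ℝ) (z : ℝ × ℝ) :
    ∫⁻ p in openCylinder T, ENNReal.ofReal (neumannKer p z) ≤ ENNReal.ofReal (2 * T) := by
  rw [openCylinder, Measure.volume_eq_prod, ← Measure.prod_restrict,
    lintegral_prod _ (by fun_prop)]
  have : ∀ t, ∫⁻ x in Ioi 0, ENNReal.ofReal (neumannKer (t, x) z) ≤ ENNReal.ofReal 2 := by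
    intro t
    refine (lintegral_mono' Measure.restrict_le_self le_rfl).trans ?_
    rcases le_or_gt t z.1 with h | h
    · simp [neumannKer_of_le (p := (t, _)) h]
    · rw [← ofReal_integral_eq_lintegral_ofReal (integrable_neumannKer_right h)
        (ae_of_all _ fun x => neumannKer_nonneg _ _), integral_neumannKer_right h]
  calc _ ≤ ∫⁻ t in Ioo 0 T, ENNReal.ofReal 2 := lintegral_mono fun t => this t
    _ = ENNReal.ofReal (2 * T) := by
      rw [setLIntegral_const, Real.volume_Ioo, ← ENNReal.ofReal_mul (by norm_num), sub_zero]

lemma integrableOn_neumannKer (T : ℝ) (z : ℝ × ℝ) :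
    IntegrableOn (fun p => neumannKer p z) (openCylinder T) := by
  refine ⟨by fun_prop, ?_⟩
  rw [hasFiniteIntegral_iff_ofReal (ae_of_all _ fun x => neumannKer_nonneg _ _)]
  exact (lintegral_neumannKer_le T z).trans_lt ENNReal.ofReal_lt_top

/-- The common value of `∂_t` and `∂_x²` of the heat kernel. -/
noncomputable def heatKerDeriv (t x : ℝ) : ℝ := (x ^ 2 / (4 * t ^ 2) - 1 / (2 * t)) * heatKer t x

lemma continuousOn_heatKerDeriv :
    ContinuousOn (fun p : ℝ × ℝ => heatKerDeriv p.1 p.2) {p | 0 < p.1} := by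
  unfold heatKerDeriv
  refine ContinuousOn.mul (ContinuousOn.sub ?_ ?_) continuousOn_heatKer
  · exact ContinuousOn.div (by fun_prop) (by fun_prop) fun p hp => by
      have : 0 < p.1 := hp
      positivity
  · exact ContinuousOn.div (by fun_prop) (by fun_prop) fun p hp => by
      have : 0 < p.1 := hp
      positivity

/-- The common value of `∂_t` and `∂_x²` of the Neumann heat kernel. -/
noncomputable def neumannKerDeriv (p z : ℝ × ℝ) : ℝ :=
  (heatKerDeriv (p.1 - z.1) (p.2 - z.2) + heatKerDeriv (p.1 - z.1) (p.2 + z.2)) / 2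

/-- The derivative `∂_x` of the Neumann heat kernel. -/
noncomputable def neumannKerDx (p z : ℝ × ℝ) : ℝ :=
  (-((p.2 - z.2) / (2 * (p.1 - z.1))) * heatKer (p.1 - z.1) (p.2 - z.2)
    + -((p.2 + z.2) / (2 * (p.1 - z.1))) * heatKer (p.1 - z.1) (p.2 + z.2)) / 2

lemma continuousOn_neumannKer (z : ℝ × ℝ) :
    ContinuousOn (fun p => neumannKer p z) {p | z.1 < p.1} := by
  unfold neumannKer
  refine ContinuousOn.div_const (ContinuousOn.add ?_ ?_) _
  · exact continuousOn_heatKer.comp (f := fun p : ℝ × ℝ => (p.1 - z.1, p.2 - z.2)) (by fun_prop)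
      fun p (hp : z.1 < p.1) => by simpa using hp
  · exact continuousOn_heatKer.comp (f := fun p : ℝ × ℝ => (p.1 - z.1, p.2 + z.2)) (by fun_prop)
      fun p (hp : z.1 < p.1) => by simpa using hp

lemma continuousOn_neumannKerDeriv (z : ℝ × ℝ) :
    ContinuousOn (fun p => neumannKerDeriv p z) {p | z.1 < p.1} := by
  unfold neumannKerDeriv
  refine ContinuousOn.div_const (ContinuousOn.add ?_ ?_) _
  · exact continuousOn_heatKerDeriv.comp (f := fun p : ℝ × ℝ => (p.1 - z.1, p.2 - z.2))
      (by fun_prop) fun p (hp : z.1 < p.1) => by simpa using hp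
  · exact continuousOn_heatKerDeriv.comp (f := fun p : ℝ × ℝ => (p.1 - z.1, p.2 + z.2))
      (by fun_prop) fun p (hp : z.1 < p.1) => by simpa using hp

lemma hasDerivAt_neumannKer_right (t x : ℝ) (z : ℝ × ℝ) :
    HasDerivAt (fun x => neumannKer (t, x) z) (neumannKerDx (t, x) z) x := by
  have h1 := (hasDerivAt_heatKer_right (t - z.1) (x - z.2)).comp_sub_const x z.2
  have h2 := (hasDerivAt_heatKer_right (t - z.1) (x + z.2)).comp_add_const x z.2
  exact (h1.add h2).div_const 2

lemma hasDerivAt_neumannKerDx (t x : ℝ) (z : ℝ × ℝ) :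
    HasDerivAt (fun x => neumannKerDx (t, x) z) (neumannKerDeriv (t, x) z) x := by
  have h1 := (hasDerivAt_heatKer_right_right (t - z.1) (x - z.2)).comp_sub_const x z.2
  have h2 := (hasDerivAt_heatKer_right_right (t - z.1) (x + z.2)).comp_add_const x z.2
  exact (h1.add h2).div_const 2

lemma hasDerivAt_neumannKer_left {t : ℝ} (x : ℝ) {z : ℝ × ℝ} (h : z.1 < t) :
    HasDerivAt (fun t => neumannKer (t, x) z) (neumannKerDeriv (t, x) z) t := by
  have h1 := (hasDerivAt_heatKer_left (sub_pos.2 h) (x - z.2)).comp_sub_const t z.1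
  have h2 := (hasDerivAt_heatKer_left (sub_pos.2 h) (x + z.2)).comp_sub_const t z.1
  exact (h1.add h2).div_const 2

lemma neumannKerDx_zero (t : ℝ) (z : ℝ × ℝ) : neumannKerDx (t, 0) z = 0 := by
  simp only [neumannKerDx, zero_sub, zero_add, heatKer_neg]
  ring

/-! ### Green's formula after the pole -/

namespace NeumannTestFunction

variable {T : ℝ} (ζ : NeumannTestFunction T)

/-- The integrand is the `x`-derivative of `ζ_x N - ζ N_x`. At `x = 0` both `ζ_x` and `N_x` vanish,
which is where the Neumann condition on test functions is used. -/
lemma integral_dxx_mul_sub {t R : ℝ} (ht : t ∈ Ico 0 T) (hR : 0 ≤ R) {z : ℝ × ℝ}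
    (hzt : z.1 < t) (h0 : ζ.val (t, R) = 0) (h1 : ζ.dx (t, R) = 0) :
    ∫ x in Icc 0 R, (ζ.dxx (t, x) * neumannKer (t, x) z
      - ζ.val (t, x) * neumannKerDeriv (t, x) z) = 0 := by
  have hN : Continuous fun x => neumannKer (t, x) z :=
    continuous_iff_continuousAt.2 fun x => (hasDerivAt_neumannKer_right t x z).continuousAt
  have hNx : Continuous fun x => neumannKerDx (t, x) z :=
    continuous_iff_continuousAt.2 fun x => (hasDerivAt_neumannKerDx t x z).continuousAt
  have hNxx : Continuous fun x => neumannKerDeriv (t, x) z := by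
    refine (continuousOn_neumannKerDeriv z).comp_continuous (by fun_prop) fun x => hzt
  have hs : ∀ {f : ℝ × ℝ → ℝ}, ContinuousOn f (testCylinder T) →
      ContinuousOn (fun x => f (t, x)) (Icc 0 R) := fun hf =>
    hf.comp (by fun_prop) fun x hx => ⟨ht, hx.1⟩
  have hsub : ∀ x ∈ Ioo 0 R, Ici (0 : ℝ) ∈ 𝓝 x := fun x hx => Ici_mem_nhds hx.1
  have hcont := ((hs ζ.continuousOn_dxx).mul hN.continuousOn).sub
    ((hs ζ.continuousOn_val).mul hNxx.continuousOn)
  rw [integral_Icc_eq_integral_Ioc, ← intervalIntegral.integral_of_le hR,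
    intervalIntegral.integral_eq_sub_of_hasDerivAt_of_le hR
      (f := fun x => ζ.dx (t, x) * neumannKer (t, x) z - ζ.val (t, x) * neumannKerDx (t, x) z)]
  · simp [h0, h1, ζ.neumann t ht, neumannKerDx_zero]
  · exact ((hs ζ.continuousOn_dx).mul hN.continuousOn).sub
      ((hs ζ.continuousOn_val).mul hNx.continuousOn)
  · intro x hx
    have a1 := (ζ.hasDeriv_x t ht x hx.1.le).hasDerivAt (hsub x hx)
    have a2 := (ζ.hasDeriv_xx t ht x hx.1.le).hasDerivAt (hsub x hx)
    refine ((a2.mul (hasDerivAt_neumannKer_right t x z)).sub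
      (a1.mul (hasDerivAt_neumannKerDx t x z))).congr_deriv ?_
    ring
  · rw [intervalIntegrable_iff_integrableOn_Icc_of_le hR]
    exact hcont.integrableOn_Icc

lemma integral_dt_mul_add {a b x : ℝ} (ha : 0 ≤ a) (hab : a ≤ b) (hb : b < T) (hx : 0 ≤ x)
    {z : ℝ × ℝ} (hza : z.1 < a) (h0 : ζ.val (b, x) = 0) :
    ∫ t in Icc a b, (ζ.dt (t, x) * neumannKer (t, x) z
      + ζ.val (t, x) * neumannKerDeriv (t, x) z) = -(ζ.val (a, x) * neumannKer (a, x) z) := by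
  have hN : ContinuousOn (fun t => neumannKer (t, x) z) (Icc a b) :=
    (continuousOn_neumannKer z).comp (by fun_prop) fun t ht => hza.trans_le ht.1
  have hNt : ContinuousOn (fun t => neumannKerDeriv (t, x) z) (Icc a b) :=
    (continuousOn_neumannKerDeriv z).comp (by fun_prop) fun t ht => hza.trans_le ht.1
  have hm : ∀ t ∈ Icc a b, t ∈ Ico 0 T := fun t ht => ⟨ha.trans ht.1, ht.2.trans_lt hb⟩
  have hs : ∀ {f : ℝ × ℝ → ℝ}, ContinuousOn f (testCylinder T) →
      ContinuousOn (fun t => f (t, x)) (Icc a b) := fun hf =>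
    hf.comp (by fun_prop) fun t ht => ⟨hm t ht, hx⟩
  rw [integral_Icc_eq_integral_Ioc, ← intervalIntegral.integral_of_le hab,
    intervalIntegral.integral_eq_sub_of_hasDerivAt_of_le hab
      (f := fun t => ζ.val (t, x) * neumannKer (t, x) z)]
  · simp [h0]
  · exact (hs ζ.continuousOn_val).mul hN
  · intro t ht
    have a1 := (ζ.hasDeriv_t t (hm t (Ioo_subset_Icc_self ht)) x hx).hasDerivAt
      (Ico_mem_nhds (ha.trans_lt ht.1) (ht.2.trans hb))
    exact (a1.mul (hasDerivAt_neumannKer_left x (hza.trans ht.1)))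
  · rw [intervalIntegrable_iff_integrableOn_Icc_of_le hab]
    exact (((hs ζ.continuousOn_dt).mul hN).add ((hs ζ.continuousOn_val).mul hNt)).integrableOn_Icc

/-- Green's formula for a test function and the Neumann heat kernel, after the pole. -/
lemma integral_heat_mul_neumannKer_after {a : ℝ} {z : ℝ × ℝ} (hz : 0 ≤ z.1) (hza : z.1 < a)
    (haT : a < T) :
    ∫ p in Ioo a T ×ˢ Ioi 0, (ζ.dt p + ζ.dxx p) * neumannKer p z
      = -∫ x in Ioi 0, ζ.val (a, x) * neumannKer (a, x) z := by
  obtain ⟨T₁, R₁, hT0, hT1, hR₁, h⟩ := ζ.exists_support ((hz.trans_lt hza).trans haT)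
  -- The upper limits `b` and `R = R₁ + 1` lie strictly beyond the support, because `exists_support`
  -- gives vanishing only for strict inequalities.
  obtain ⟨b, hb1, hbT⟩ := exists_between (max_lt hT1 haT)
  have hb : T₁ < b := (le_max_left _ _).trans_lt hb1
  have hab : a < b := (le_max_right _ _).trans_lt hb1
  have ha : 0 < a := hz.trans_lt hza
  set R := R₁ + 1 with hRdef
  have hR : 0 ≤ R := by positivity
  have hRR : R₁ < R := lt_add_one _
  have hsub : Icc a b ×ˢ Icc 0 R ⊆ testCylinder T := fun p hp =>
    ⟨⟨ha.le.trans hp.1.1, hp.1.2.trans_lt hbT⟩, hp.2.1⟩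
  have hN : ContinuousOn (fun p => neumannKer p z) (Icc a b ×ˢ Icc 0 R) :=
    (continuousOn_neumannKer z).mono fun p hp => hza.trans_le hp.1.1
  have hN' : ContinuousOn (fun p => neumannKerDeriv p z) (Icc a b ×ˢ Icc 0 R) :=
    (continuousOn_neumannKerDeriv z).mono fun p hp => hza.trans_le hp.1.1
  have hK : IsCompact (Icc a b ×ˢ Icc 0 R) := isCompact_Icc.prod isCompact_Icc
  have i1 : IntegrableOn (fun p => ζ.dxx p * neumannKer p z - ζ.val p * neumannKerDeriv p z)
      (Icc a b ×ˢ Icc 0 R) := (((ζ.continuousOn_dxx.mono hsub).mul hN).sub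
        ((ζ.continuousOn_val.mono hsub).mul hN')).integrableOn_compact hK
  have i2 : IntegrableOn (fun p => ζ.dt p * neumannKer p z + ζ.val p * neumannKerDeriv p z)
      (Icc a b ×ˢ Icc 0 R) := (((ζ.continuousOn_dt.mono hsub).mul hN).add
        ((ζ.continuousOn_val.mono hsub).mul hN')).integrableOn_compact hK
  have e1 : ∫ p in Icc a b ×ˢ Icc 0 R,
      (ζ.dxx p * neumannKer p z - ζ.val p * neumannKerDeriv p z) = 0 := by
    rw [Measure.volume_eq_prod] at i1 ⊢
    rw [setIntegral_prod _ i1]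
    refine setIntegral_eq_zero_of_forall_eq_zero fun t ht => ?_
    have htT : t ∈ Ico 0 T := ⟨ha.le.trans ht.1, ht.2.trans_lt hbT⟩
    have hh := h t htT R hR (Or.inr hRR)
    exact ζ.integral_dxx_mul_sub htT hR (hza.trans_le ht.1) hh.1 hh.2.2.1
  have e2 : ∫ p in Icc a b ×ˢ Icc 0 R,
      (ζ.dt p * neumannKer p z + ζ.val p * neumannKerDeriv p z)
      = -∫ x in Ioi 0, ζ.val (a, x) * neumannKer (a, x) z := by
    rw [Measure.volume_eq_prod] at i2 ⊢
    unfold IntegrableOn at i2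
    rw [← Measure.prod_restrict] at i2 ⊢
    rw [integral_prod_symm _ i2, ← integral_neg]
    have e3 : ∫ x in Ioi 0, -(ζ.val (a, x) * neumannKer (a, x) z)
        = ∫ x in Icc 0 R, -(ζ.val (a, x) * neumannKer (a, x) z) := by
      rw [integral_Icc_eq_integral_Ioc]
      refine setIntegral_eq_of_subset_of_forall_sdiff_eq_zero measurableSet_Ioi
        Ioc_subset_Ioi_self fun x hx => ?_
      have : R < x := not_le.1 fun hh => hx.2 ⟨hx.1, hh⟩
      rw [(h a ⟨ha.le, haT⟩ x (mem_Ioi.1 hx.1).le (Or.inr (hRR.trans this))).1]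
      simp
    rw [e3]
    refine setIntegral_congr_fun measurableSet_Icc fun x hx => ?_
    exact ζ.integral_dt_mul_add ha.le hab.le hbT hx.1 hza
      (h b ⟨(ha.trans hab).le, hbT⟩ x hx.1 (Or.inl hb)).1
  -- On adding the two identities the terms containing `neumannKerDeriv` cancel: it is both `N_t`
  -- and `N_xx`.
  have e4 : ∫ p in Icc a b ×ˢ Icc 0 R, (ζ.dt p + ζ.dxx p) * neumannKer p z
      = -∫ x in Ioi 0, ζ.val (a, x) * neumannKer (a, x) z := by
    have e6 := integral_add i1 i2
    rw [e1, zero_add, e2] at e6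
    rw [← e6]
    congr 1; ext p; ring
  rw [← e4]
  have e5 : ∫ p in Ico a T ×ˢ Ici 0, (ζ.dt p + ζ.dxx p) * neumannKer p z
      = ∫ p in Icc a b ×ˢ Icc 0 R, (ζ.dt p + ζ.dxx p) * neumannKer p z := by
    refine setIntegral_eq_of_subset_of_forall_sdiff_eq_zero
      (measurableSet_Ico.prod measurableSet_Ici)
      (fun p hp => ⟨⟨hp.1.1, hp.1.2.trans_lt hbT⟩, hp.2.1⟩) fun p hp => ?_
    have hh : b < p.1 ∨ R < p.2 := by
      by_contra! hc
      exact hp.2 ⟨⟨hp.1.1.1, hc.1⟩, ⟨hp.1.2, hc.2⟩⟩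
    obtain ⟨-, e, -, e'⟩ := h p.1 ⟨ha.le.trans hp.1.1.1, hp.1.1.2⟩ p.2 hp.1.2
      (hh.imp hb.trans hRR.trans)
    simp only [Prod.mk.eta] at e e'
    simp [e, e']
  rw [← e5]
  refine setIntegral_congr_set ?_
  rw [Measure.volume_eq_prod]
  exact Measure.set_prod_ae_eq Ioo_ae_eq_Ico Ioi_ae_eq_Ici

end NeumannTestFunction

/-! ### Behaviour at the pole: the Dirac mass -/

lemma heatKer_scale {δ : ℝ} (hδ : 0 < δ) (x : ℝ) :
    √δ * heatKer δ (√δ * x) = heatKer 1 x := by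
  unfold heatKer
  rw [mul_pow, Real.sq_sqrt hδ.le, Real.sqrt_mul Real.pi_pos.le, mul_one]
  have : 0 < √δ := Real.sqrt_pos.2 hδ
  rw [show -(δ * x ^ 2) / (4 * δ) = -x ^ 2 / (4 * 1) by field_simp]
  field_simp

/-- Even reflection of `f` turns the Neumann kernel into the whole-line kernel, and the change of
variable `x ↦ y + √(a-s) x` freezes the Gaussian at time `1`. The limit `a ↓ s` then falls only on
the argument of `f`. -/
lemma integral_mul_neumannKer {f : ℝ → ℝ} (hf : Continuous fun x => f |x|) {C : ℝ}
    (hC : ∀ x, 0 ≤ x → |f x| ≤ C) {a : ℝ} {z : ℝ × ℝ} (ha : z.1 < a) :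
    ∫ x in Ioi 0, f x * neumannKer (a, x) z
      = 2⁻¹ * ∫ x, f |z.2 + √(a - z.1) * x| * heatKer 1 x := by
  have hδ : 0 < a - z.1 := sub_pos.2 ha
  have hev : ∀ x, neumannKer (a, |x|) z = neumannKer (a, x) z := fun x => by
    rcases abs_choice x with h | h
    · rw [h]
    · rw [h]
      simp only [neumannKer]
      rw [← heatKer_neg _ (-x - z.2), ← heatKer_neg _ (-x + z.2), add_comm]
      congr 3 <;> ring
  have hb : ∀ x, ‖f |x|‖ ≤ C := fun x => hC _ (abs_nonneg x)
  have hi := integrable_heatKer_right hδ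
  have i1 : Integrable fun x => f |x| * heatKer (a - z.1) (x - z.2) :=
    (hi.comp_sub_right z.2).bdd_mul hf.aestronglyMeasurable (ae_of_all _ hb)
  have i2 : Integrable fun x => f |x| * heatKer (a - z.1) (x + z.2) :=
    (hi.comp_add_right z.2).bdd_mul hf.aestronglyMeasurable (ae_of_all _ hb)
  have e1 := integral_comp_abs (f := fun x => f x * neumannKer (a, x) z)
  simp only [hev] at e1
  have e2 : ∫ x, f |x| * heatKer (a - z.1) (x + z.2) = ∫ x, f |x| * heatKer (a - z.1) (x - z.2) := by
    rw [← integral_neg_eq_self]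
    congr 1; ext x
    rw [abs_neg, ← heatKer_neg]; congr 2; ring
  have e3 : ∫ x, f |x| * neumannKer (a, x) z = ∫ x, f |x| * heatKer (a - z.1) (x - z.2) := by
    have : ∀ x, f |x| * neumannKer (a, x) z = 2⁻¹ * (f |x| * heatKer (a - z.1) (x - z.2)
        + f |x| * heatKer (a - z.1) (x + z.2)) := fun x => by simp only [neumannKer]; ring
    simp only [this]
    rw [integral_const_mul, integral_add i1 i2, e2]; ring
  have e4 : ∫ x, f |x| * heatKer (a - z.1) (x - z.2)
      = ∫ x, f |z.2 + √(a - z.1) * x| * heatKer 1 x := by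
    rw [← integral_add_right_eq_self _ z.2]
    have h := Measure.integral_comp_mul_left
      (fun x => f |x + z.2| * heatKer (a - z.1) (x + z.2 - z.2)) (√(a - z.1))
    have hs : 0 < √(a - z.1) := Real.sqrt_pos.2 hδ
    rw [abs_of_pos (inv_pos.2 hs), smul_eq_mul, eq_inv_mul_iff_mul_eq₀ hs.ne',
      ← integral_const_mul] at h
    rw [← h]
    congr 1; ext x
    rw [add_sub_cancel_right, mul_left_comm, heatKer_scale hδ, add_comm z.2]
  rw [← e4, ← e3, e1]; ring

namespace NeumannTestFunction

variable {T : ℝ} (ζ : NeumannTestFunction T)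

/-- After rescaling, this is dominated convergence against a fixed Gaussian of mass `2`, compensated
by the factor `1/2`. The absolute value keeps the argument inside the half line, so a pole on the
boundary needs no separate treatment. -/
lemma tendsto_integral_val_mul_neumannKer {z : ℝ × ℝ} (hz : z ∈ testCylinder T) :
    Tendsto (fun a => ∫ x in Ioi 0, ζ.val (a, x) * neumannKer (a, x) z) (𝓝[>] z.1)
      (𝓝 (ζ.val z)) := by
  have hT : 0 < T := hz.1.1.trans_lt hz.1.2
  obtain ⟨C, hC0, hC⟩ := ζ.exists_bound hT
  have hmem : ∀ᶠ a in 𝓝[>] z.1, z.1 < a ∧ a < T :=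
    Ioo_mem_nhdsGT hz.1.2
  have hcont : ∀ a, z.1 < a → a < T → Continuous fun x => ζ.val (a, |x|) := fun a h1 h2 =>
    ζ.continuousOn_val.comp_continuous (by fun_prop) fun x =>
      ⟨⟨hz.1.1.trans h1.le, h2⟩, abs_nonneg x⟩
  have key : Tendsto (fun a => ∫ x, ζ.val (a, |z.2 + √(a - z.1) * x|) * heatKer 1 x) (𝓝[>] z.1)
      (𝓝 (∫ x, ζ.val z * heatKer 1 x)) := by
    refine tendsto_integral_filter_of_dominated_convergence (fun x => C * heatKer 1 x) ?_ ?_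
      ((integrable_heatKer_right one_pos).const_mul C) ?_
    · filter_upwards [hmem] with a ha
      exact (((hcont a ha.1 ha.2).comp (by fun_prop : Continuous
        fun x : ℝ => z.2 + √(a - z.1) * x)).mul (continuous_heatKer_right 1)).aestronglyMeasurable
    · filter_upwards [hmem] with a ha
      refine ae_of_all _ fun x => ?_
      rw [norm_mul, Real.norm_of_nonneg (heatKer_nonneg 1 x)]
      exact mul_le_mul_of_nonneg_right (hC _ ⟨⟨hz.1.1.trans ha.1.le, ha.2⟩, mem_Ici.2 (abs_nonneg _)⟩).1
        (heatKer_nonneg _ _)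
    · refine ae_of_all _ fun x => Tendsto.mul_const _ ?_
      have h1 : Tendsto (fun a => (a, |z.2 + √(a - z.1) * x|)) (𝓝[>] z.1) (𝓝[testCylinder T] z) := by
        refine tendsto_nhdsWithin_iff.2 ⟨?_, ?_⟩
        · have : Continuous fun a : ℝ => (a, |z.2 + √(a - z.1) * x|) := by fun_prop
          have h := this.tendsto z.1
          simp only [sub_self, Real.sqrt_zero, zero_mul, add_zero, abs_of_nonneg hz.2.out] at h
          exact h.mono_left nhdsWithin_le_nhds
        · filter_upwards [hmem] with a ha
          exact ⟨⟨hz.1.1.trans ha.1.le, ha.2⟩, mem_Ici.2 (abs_nonneg _)⟩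
      exact (ζ.continuousOn_val z hz).tendsto.comp h1
  rw [integral_const_mul, integral_heatKer_right one_pos] at key
  have k2 := key.const_mul 2⁻¹
  rw [show 2⁻¹ * (ζ.val z * 2) = ζ.val z by ring] at k2
  refine k2.congr' ?_
  filter_upwards [hmem] with a ha
  exact (integral_mul_neumannKer (f := fun x => ζ.val (a, x)) (hcont a ha.1 ha.2)
    (fun x hx => (hC (a, x) ⟨⟨hz.1.1.trans ha.1.le, ha.2⟩, hx⟩).1) ha.1).symm

lemma aestronglyMeasurable_heat :
    AEStronglyMeasurable (fun p => ζ.dt p + ζ.dxx p) (volume.restrict (openCylinder T)) :=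
  ((ζ.continuousOn_dt.add ζ.continuousOn_dxx).mono
    (openCylinder_subset_testCylinder T)).aestronglyMeasurable (measurableSet_openCylinder T)

lemma integrableOn_heat_mul (hT : 0 < T) {w : ℝ × ℝ → ℝ} (hw : IntegrableOn w (openCylinder T)) :
    IntegrableOn (fun p => (ζ.dt p + ζ.dxx p) * w p) (openCylinder T) := by
  obtain ⟨C, hC0, hC⟩ := ζ.exists_bound hT
  refine Integrable.bdd_mul (c := C) hw ζ.aestronglyMeasurable_heat ?_
  filter_upwards [ae_restrict_mem (measurableSet_openCylinder T)] with p hp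
  exact (hC p (openCylinder_subset_testCylinder T hp)).2

/-- The Neumann heat kernel solves the heat equation with a Dirac mass at the pole. -/
lemma integral_heat_mul_neumannKer {z : ℝ × ℝ} (hz : z ∈ testCylinder T) :
    ∫ p in openCylinder T, (ζ.dt p + ζ.dxx p) * neumannKer p z = -ζ.val z := by
  have hT : 0 < T := hz.1.1.trans_lt hz.1.2
  have hi := ζ.integrableOn_heat_mul hT (integrableOn_neumannKer T z)
  have hmem : ∀ᶠ a in 𝓝[>] z.1, z.1 < a ∧ a < T := Ioo_mem_nhdsGT hz.1.2
  -- Green's formula is available only on times after `a > s`. The kernel vanishes for times up to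
  -- `s`, so restricting to `t > a` and letting `a ↓ s` loses nothing.
  have h1 : Tendsto (fun a => ∫ p in openCylinder T,
      (Ioi a ×ˢ univ).indicator (fun p => (ζ.dt p + ζ.dxx p) * neumannKer p z) p) (𝓝[>] z.1)
      (𝓝 (∫ p in openCylinder T, (ζ.dt p + ζ.dxx p) * neumannKer p z)) := by
    refine tendsto_integral_filter_of_dominated_convergence
      (fun p => ‖(ζ.dt p + ζ.dxx p) * neumannKer p z‖) ?_ ?_ hi.norm ?_
    · exact Eventually.of_forall fun a => hi.aestronglyMeasurable.indicator
        (measurableSet_Ioi.prod MeasurableSet.univ)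
    · exact Eventually.of_forall fun a => ae_of_all _ fun p => norm_indicator_le_norm_self _ _
    · refine ae_of_all _ fun p => ?_
      rcases le_or_gt p.1 z.1 with hp | hp
      · simp [indicator_apply, neumannKer_of_le hp]
      · refine tendsto_const_nhds.congr' ?_
        filter_upwards [mem_nhdsWithin_of_mem_nhds (Iio_mem_nhds hp)] with a ha
        rw [indicator_of_mem]
        exact ⟨ha, mem_univ _⟩
  refine tendsto_nhds_unique h1 ((ζ.tendsto_integral_val_mul_neumannKer hz).neg.congr' ?_)
  filter_upwards [hmem] with a ha
  rw [← ζ.integral_heat_mul_neumannKer_after hz.1.1 ha.1 ha.2,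
    setIntegral_indicator (measurableSet_Ioi.prod MeasurableSet.univ)]
  congr 2
  ext p
  simp only [openCylinder, mem_inter_iff, mem_prod, mem_Ioo, mem_Ioi, mem_univ, and_true]
  have := hz.1.1
  constructor
  · rintro ⟨⟨h, h'⟩, h2⟩
    exact ⟨⟨⟨this.trans_lt (ha.1.trans h), h'⟩, h2⟩, h⟩
  · rintro ⟨⟨⟨h, h'⟩, h2⟩, h3⟩
    exact ⟨⟨h3, h'⟩, h2⟩

end NeumannTestFunction

/-! ### Heat potentials of finite measures -/

/-- The solution of the linear problem whose data (initial and lateral) are the measure `M`. -/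
noncomputable def heatPotential (M : Measure (ℝ × ℝ)) (p : ℝ × ℝ) : ℝ := ∫ z, neumannKer p z ∂M

section potential

variable {T : ℝ} {M N : Measure (ℝ × ℝ)}

lemma heatPotential_nonneg (M : Measure (ℝ × ℝ)) (p : ℝ × ℝ) : 0 ≤ heatPotential M p :=
  integral_nonneg fun z => neumannKer_nonneg p z

lemma integrable_neumannKer_prod [IsFiniteMeasure M] : Integrable
    (fun q : (ℝ × ℝ) × (ℝ × ℝ) => neumannKer q.1 q.2)
      ((volume.restrict (openCylinder T)).prod M) := by
  refine ⟨by fun_prop, ?_⟩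
  rw [hasFiniteIntegral_iff_ofReal (ae_of_all _ fun x => neumannKer_nonneg _ _),
    lintegral_prod_symm _ (by fun_prop)]
  calc _ ≤ ∫⁻ _, ENNReal.ofReal (2 * T) ∂M := lintegral_mono fun z => lintegral_neumannKer_le T z
    _ < ⊤ := by
      rw [lintegral_const]
      exact ENNReal.mul_lt_top ENNReal.ofReal_lt_top (measure_lt_top _ _)

lemma integrableOn_heatPotential [IsFiniteMeasure M] :
    IntegrableOn (heatPotential M) (openCylinder T) :=
  integrable_neumannKer_prod.integral_prod_left

@[fun_prop]
lemma measurable_heatPotential [SFinite M] : Measurable (heatPotential M) := by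
  have : StronglyMeasurable (fun q : (ℝ × ℝ) × (ℝ × ℝ) => neumannKer q.1 q.2) :=
    Measurable.stronglyMeasurable (by fun_prop)
  exact this.integral_prod_right'.measurable

lemma NeumannTestFunction.integrable_val [IsFiniteMeasure M] (ζ : NeumannTestFunction T)
    (hT : 0 < T) (hM : ∀ᵐ z ∂M, z ∈ testCylinder T) : Integrable ζ.val M := by
  obtain ⟨C, hC0, hC⟩ := ζ.exists_bound hT
  have h : AEStronglyMeasurable ζ.val M := by
    rw [← Measure.restrict_eq_self_of_ae_mem hM]
    exact ζ.continuousOn_val.aestronglyMeasurable (measurableSet_testCylinder T)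
  refine Integrable.of_bound h C ?_
  filter_upwards [hM] with p hp using (hC p hp).1

/-- The potential of `M` solves the linear problem with data `M`. -/
lemma NeumannTestFunction.integral_heat_mul_heatPotential [IsFiniteMeasure M]
    (ζ : NeumannTestFunction T) (hT : 0 < T) (hM : ∀ᵐ z ∂M, z ∈ testCylinder T) :
    ∫ p in openCylinder T, (ζ.dt p + ζ.dxx p) * heatPotential M p = -∫ z, ζ.val z ∂M := by
  obtain ⟨C, hC0, hC⟩ := ζ.exists_bound hT
  have hi : Integrable (fun q : (ℝ × ℝ) × (ℝ × ℝ) => (ζ.dt q.1 + ζ.dxx q.1) * neumannKer q.1 q.2)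
      ((volume.restrict (openCylinder T)).prod M) := by
    refine Integrable.bdd_mul (c := C) integrable_neumannKer_prod
      ζ.aestronglyMeasurable_heat.comp_fst ?_
    have h1 : ∀ᵐ p ∂(volume.restrict (openCylinder T)), ‖ζ.dt p + ζ.dxx p‖ ≤ C := by
      filter_upwards [ae_restrict_mem (measurableSet_openCylinder T)] with p hp
      exact (hC p (openCylinder_subset_testCylinder T hp)).2
    exact Measure.quasiMeasurePreserving_fst.ae h1
  simp only [heatPotential, ← integral_const_mul]
  rw [integral_integral_swap hi, ← integral_neg]
  refine integral_congr_ae ?_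
  filter_upwards [hM] with z hz using ζ.integral_heat_mul_neumannKer hz

lemma setLIntegral_heatKer_sub_le (s : ℝ) (y : ℝ) :
    ∫⁻ t in Ioo 0 T, ENNReal.ofReal (heatKer (t - s) y)
      ≤ ∫⁻ t in Iic (T - s), ENNReal.ofReal (heatKer t 0) := by
  rw [← lintegral_indicator measurableSet_Ioo, ← lintegral_indicator measurableSet_Iic,
    ← lintegral_sub_right_eq_self (indicator (Iic _) _) s]
  refine lintegral_mono fun t => ?_
  by_cases h : t ∈ Ioo 0 T
  · rw [indicator_of_mem h, indicator_of_mem (by simpa using h.2.le)]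
    exact ENNReal.ofReal_le_ofReal (heatKer_le _ _)
  · rw [indicator_of_notMem h]; exact zero_le

/-- The total mass of the boundary kernel on `(0, T)`. -/
noncomputable def heatKerMass (T : ℝ) : ℝ := 2 * (√Real.pi)⁻¹ * √T

lemma lintegral_heatKer_zero {a : ℝ} (ha : 0 ≤ a) :
    ∫⁻ t in Iic a, ENNReal.ofReal (heatKer t 0) = ENNReal.ofReal (heatKerMass a) := by
  rw [← ofReal_integral_eq_lintegral_ofReal (integrableOn_heatKer_zero a)
    (ae_of_all _ fun t => heatKer_nonneg t 0), integral_heatKer_zero ha, heatKerMass]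

lemma setLIntegral_heatKer_sub_le_mass (hT : 0 ≤ T) {s : ℝ} (hs : 0 ≤ s) (y : ℝ) :
    ∫⁻ t in Ioo 0 T, ENNReal.ofReal (heatKer (t - s) y) ≤ ENNReal.ofReal (heatKerMass T) := by
  rw [← lintegral_heatKer_zero hT]
  exact (setLIntegral_heatKer_sub_le s y).trans
    (lintegral_mono' (Measure.restrict_mono (Iic_subset_Iic.2 (by linarith)) le_rfl) le_rfl)

lemma integrable_heatKer_prod [IsFiniteMeasure M] (hT : 0 ≤ T)
    (hM : ∀ᵐ z ∂M, z ∈ testCylinder T) : Integrable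
    (fun q : ℝ × (ℝ × ℝ) => heatKer (q.1 - q.2.1) q.2.2) ((volume.restrict (Ioo 0 T)).prod M) := by
  refine ⟨Measurable.aestronglyMeasurable (by fun_prop), ?_⟩
  rw [hasFiniteIntegral_iff_ofReal (ae_of_all _ fun x => heatKer_nonneg _ _),
    lintegral_prod_symm _ (by fun_prop)]
  calc _ ≤ ∫⁻ _, ENNReal.ofReal (heatKerMass T) ∂M := by
        refine lintegral_mono_ae ?_
        filter_upwards [hM] with z hz using setLIntegral_heatKer_sub_le_mass hT hz.1.1 z.2
    _ < ⊤ := by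
      rw [lintegral_const]
      exact ENNReal.mul_lt_top ENNReal.ofReal_lt_top (measure_lt_top _ _)

lemma heatPotential_boundary (t : ℝ) :
    heatPotential M (t, 0) = ∫ z, heatKer (t - z.1) z.2 ∂M := by
  simp only [heatPotential, neumannKer_zero]

lemma integrableOn_heatPotential_boundary [IsFiniteMeasure M] (hT : 0 ≤ T)
    (hM : ∀ᵐ z ∂M, z ∈ testCylinder T) :
    IntegrableOn (fun t => heatPotential M (t, 0)) (Ioo 0 T) := by
  simp only [heatPotential_boundary]
  exact (integrable_heatKer_prod hT hM).integral_prod_left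

lemma ae_integrable_heatKer_boundary [IsFiniteMeasure M] (hT : 0 ≤ T)
    (hM : ∀ᵐ z ∂M, z ∈ testCylinder T) :
    ∀ᵐ t ∂(volume.restrict (Ioo 0 T)), Integrable (fun z => heatKer (t - z.1) z.2) M :=
  (integrable_heatKer_prod hT hM).prod_right_ae

lemma ae_integrable_neumannKer [IsFiniteMeasure M] :
    ∀ᵐ p ∂(volume.restrict (openCylinder T)), Integrable (fun z => neumannKer p z) M :=
  integrable_neumannKer_prod.prod_right_ae

/-! ### The lateral trace of a potential -/

/-- The `L¹(0,T)` distance between the kernel at height `x` and on the boundary. -/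
noncomputable def kerDist (T x : ℝ) (z : ℝ × ℝ) : ℝ :=
  ∫ t in Ioo 0 T, |neumannKer (t, x) z - heatKer (t - z.1) z.2|

lemma tendsto_neumannKer_boundary (t : ℝ) (z : ℝ × ℝ) :
    Tendsto (fun x => neumannKer (t, x) z) (𝓝 0) (𝓝 (heatKer (t - z.1) z.2)) := by
  rw [← neumannKer_zero]
  have : Continuous fun x => neumannKer (t, x) z :=
    continuous_iff_continuousAt.2 fun x => (hasDerivAt_neumannKer_right t x z).continuousAt
  exact this.tendsto 0

lemma abs_neumannKer_sub_le (t x : ℝ) (z : ℝ × ℝ) :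
    |neumannKer (t, x) z - heatKer (t - z.1) z.2| ≤ heatKer (t - z.1) 0 :=
  abs_sub_le_of_nonneg_of_le (neumannKer_nonneg _ _) (neumannKer_le _ _) (heatKer_nonneg _ _)
    (heatKer_le _ _)

lemma integrableOn_heatKer_sub (T : ℝ) (s : ℝ) :
    IntegrableOn (fun t => heatKer (t - s) 0) (Ioo 0 T) := by
  refine ⟨Measurable.aestronglyMeasurable (by fun_prop), ?_⟩
  rw [hasFiniteIntegral_iff_ofReal (ae_of_all _ fun x => heatKer_nonneg _ _)]
  refine (setLIntegral_heatKer_sub_le s 0).trans_lt ?_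
  have := (integrableOn_heatKer_zero (T - s)).2
  rwa [hasFiniteIntegral_iff_ofReal (ae_of_all _ fun x => heatKer_nonneg _ _)] at this

/-- The kernel is continuous in `x` up to the boundary and bounded by `heatKer (t - s) 0`, an
integrable function of `t` independent of `x`. -/
lemma tendsto_kerDist (T : ℝ) (z : ℝ × ℝ) : Tendsto (fun x => kerDist T x z) (𝓝 0) (𝓝 0) := by
  have h : Tendsto (fun x => kerDist T x z) (𝓝 0) (𝓝 (∫ t in Ioo 0 T, (0 : ℝ))) := by
    refine tendsto_integral_filter_of_dominated_convergence (fun t => heatKer (t - z.1) 0)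
      (Eventually.of_forall fun x => Measurable.aestronglyMeasurable (by fun_prop))
      (Eventually.of_forall fun x => ae_of_all _ fun t => ?_) (integrableOn_heatKer_sub T z.1)
      (ae_of_all _ fun t => ?_)
    · rw [Real.norm_eq_abs, abs_abs]; exact abs_neumannKer_sub_le t x z
    · have := ((tendsto_neumannKer_boundary t z).sub_const (heatKer (t - z.1) z.2)).abs
      simpa using this
  simpa using h

lemma kerDist_nonneg (T x : ℝ) (z : ℝ × ℝ) : 0 ≤ kerDist T x z :=
  integral_nonneg fun _ => abs_nonneg _

lemma kerDist_le (hT : 0 ≤ T) (x : ℝ) {z : ℝ × ℝ} (hz : 0 ≤ z.1) :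
    kerDist T x z ≤ heatKerMass T := by
  have h1 : kerDist T x z ≤ ∫ t in Ioo 0 T, heatKer (t - z.1) 0 := by
    refine integral_mono_of_nonneg (ae_of_all _ fun _ => abs_nonneg _)
      (integrableOn_heatKer_sub T z.1) (ae_of_all _ fun t => abs_neumannKer_sub_le t x z)
  refine h1.trans ?_
  rw [integral_eq_lintegral_of_nonneg_ae (ae_of_all _ fun _ => heatKer_nonneg _ _)
    (Measurable.aestronglyMeasurable (by fun_prop))]
  refine ENNReal.toReal_le_of_le_ofReal (by unfold heatKerMass; positivity) ?_
  exact setLIntegral_heatKer_sub_le_mass hT hz 0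

lemma measurable_kerDist (T : ℝ) : Measurable fun q : ℝ × (ℝ × ℝ) => kerDist T q.1 q.2 := by
  have : StronglyMeasurable (fun q : (ℝ × (ℝ × ℝ)) × ℝ =>
      |neumannKer (q.2, q.1.1) q.1.2 - heatKer (q.2 - q.1.2.1) q.1.2.2|) :=
    Measurable.stronglyMeasurable (by fun_prop)
  exact (this.integral_prod_right' (ν := volume.restrict (Ioo 0 T))).measurable

lemma tendsto_integral_kerDist [IsFiniteMeasure M] (hT : 0 ≤ T)
    (hM : ∀ᵐ z ∂M, z ∈ testCylinder T) :
    Tendsto (fun x => ∫ z, kerDist T x z ∂M) (𝓝 0) (𝓝 0) := by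
  have h : Tendsto (fun x => ∫ z, kerDist T x z ∂M) (𝓝 0) (𝓝 (∫ z, (0 : ℝ) ∂M)) := by
    refine tendsto_integral_filter_of_dominated_convergence (fun _ => heatKerMass T)
      (Eventually.of_forall fun x =>
        ((measurable_kerDist T).comp measurable_prodMk_left).aestronglyMeasurable)
      (Eventually.of_forall fun x => ?_) (integrable_const _)
      (ae_of_all _ fun z => tendsto_kerDist T z)
    filter_upwards [hM] with z hz
    rw [Real.norm_of_nonneg (kerDist_nonneg _ _ _)]
    exact kerDist_le hT x hz.1.1
  simpa using h

/-- Tonelli moves the modulus inside the integral over the pole. The trace of the potential thus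
reduces to the convergence of `kerDist`, whose uniform bound `heatKerMass T` makes it integrable
against `M`. -/
lemma setLIntegral_abs_heatPotential_sub_le [IsFiniteMeasure M] (hT : 0 ≤ T)
    (hM : ∀ᵐ z ∂M, z ∈ testCylinder T) (ε : ℝ) :
    ∫⁻ p in Ioo 0 T ×ˢ Ioo 0 ε, ENNReal.ofReal |heatPotential M p - heatPotential M (p.1, 0)|
      ≤ ∫⁻ x in Ioo 0 ε, ENNReal.ofReal (∫ z, kerDist T x z ∂M) := by
  have hsub : Ioo 0 T ×ˢ Ioo 0 ε ⊆ openCylinder T := prod_mono le_rfl Ioo_subset_Ioi_self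
  have hae : ∀ᵐ p ∂(volume.restrict (Ioo 0 T ×ˢ Ioo 0 ε)),
      Integrable (fun z => heatKer (p.1 - z.1) z.2) M := by
    rw [Measure.volume_eq_prod, ← Measure.prod_restrict]
    exact Measure.quasiMeasurePreserving_fst.ae (ae_integrable_heatKer_boundary hT hM)
  have h1 : ∫⁻ p in Ioo 0 T ×ˢ Ioo 0 ε,
      ENNReal.ofReal |heatPotential M p - heatPotential M (p.1, 0)|
      ≤ ∫⁻ p in Ioo 0 T ×ˢ Ioo 0 ε, ∫⁻ z,
        ENNReal.ofReal |neumannKer p z - heatKer (p.1 - z.1) z.2| ∂M := by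
    refine lintegral_mono_ae ?_
    filter_upwards [ae_restrict_of_ae_restrict_of_subset hsub (ae_integrable_neumannKer (M := M)),
      hae] with p hp1 hp2
    rw [heatPotential_boundary, heatPotential, ← integral_sub hp1 hp2]
    refine (ENNReal.ofReal_le_ofReal abs_integral_le_integral_abs).trans_eq ?_
    exact ofReal_integral_eq_lintegral_ofReal (hp1.sub hp2).abs (ae_of_all _ fun _ => abs_nonneg _)
  refine h1.trans ?_
  rw [Measure.volume_eq_prod, ← Measure.prod_restrict, lintegral_prod_symm _ ?_]
  swap
  · exact Measurable.aemeasurable (Measurable.lintegral_prod_right' (f := fun q : (ℝ × ℝ) × (ℝ × ℝ)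
      => ENNReal.ofReal |neumannKer q.1 q.2 - heatKer (q.1.1 - q.2.1) q.2.2|) (by fun_prop))
  refine lintegral_mono fun x => ?_
  rw [lintegral_lintegral_swap (Measurable.aemeasurable (by fun_prop)),
    ofReal_integral_eq_lintegral_ofReal ?_ (ae_of_all _ fun z => kerDist_nonneg T x z)]
  · refine lintegral_mono fun z => ?_
    rw [kerDist, ofReal_integral_eq_lintegral_ofReal _ (ae_of_all _ fun _ => abs_nonneg _)]
    exact (integrableOn_heatKer_sub T z.1).mono' (Measurable.aestronglyMeasurable (by fun_prop))
      (ae_of_all _ fun t => by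
        rw [Real.norm_eq_abs, abs_abs]; exact abs_neumannKer_sub_le t x z)
  · refine Integrable.of_bound
      ((measurable_kerDist T).comp measurable_prodMk_left).aestronglyMeasurable (heatKerMass T) ?_
    filter_upwards [hM] with z hz
    rw [Real.norm_of_nonneg (kerDist_nonneg _ _ _)]
    exact kerDist_le hT x hz.1.1

/-- The potential has the lateral trace given by its values on `x = 0`. -/
lemma hasLateralTrace_heatPotential [IsFiniteMeasure M] (hT : 0 ≤ T)
    (hM : ∀ᵐ z ∂M, z ∈ testCylinder T) : HasLateralTrace T (heatPotential M) := by
  rw [HasLateralTrace, Metric.tendsto_nhds]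
  intro η hη
  have h := (tendsto_integral_kerDist hT hM).eventually (gt_mem_nhds (half_pos hη))
  obtain ⟨r, hr, hball⟩ := Metric.eventually_nhds_iff.1 h
  filter_upwards [Ioo_mem_nhdsGT hr] with ε hε
  have h1 : ∫⁻ p in Ioo 0 T ×ˢ Ioo 0 ε,
      ENNReal.ofReal |heatPotential M p - heatPotential M (p.1, 0)|
      ≤ ENNReal.ofReal (η / 2 * ε) := by
    refine (setLIntegral_abs_heatPotential_sub_le hT hM ε).trans ?_
    calc _ ≤ ∫⁻ x in Ioo 0 ε, ENNReal.ofReal (η / 2) := by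
          refine setLIntegral_mono' measurableSet_Ioo fun x hx => ENNReal.ofReal_le_ofReal ?_
          refine (hball ?_).le
          rw [Real.dist_eq, sub_zero, abs_of_pos hx.1]; exact hx.2.trans hε.2
      _ = _ := by
        rw [setLIntegral_const, Real.volume_Ioo, ← ENNReal.ofReal_mul (by positivity), sub_zero]
  have h2 : ∫ p in Ioo 0 T ×ˢ Ioo 0 ε, |heatPotential M p - heatPotential M (p.1, 0)|
      ≤ η / 2 * ε := by
    rw [integral_eq_lintegral_of_nonneg_ae (ae_of_all _ fun _ => abs_nonneg _)
      (Measurable.aestronglyMeasurable (by fun_prop))]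
    exact ENNReal.toReal_le_of_le_ofReal (mul_nonneg (half_pos hη).le hε.1.le) h1
  have h3 : 0 ≤ ∫ p in Ioo 0 T ×ˢ Ioo 0 ε, |heatPotential M p - heatPotential M (p.1, 0)| :=
    integral_nonneg fun _ => abs_nonneg _
  rw [Real.dist_eq, sub_zero, abs_of_nonneg (mul_nonneg (inv_pos.2 hε.1).le h3)]
  calc _ ≤ ε⁻¹ * (η / 2 * ε) := mul_le_mul_of_nonneg_left h2 (inv_pos.2 hε.1).le
    _ = η / 2 := by have := hε.1.ne'; field_simp
    _ < η := half_lt_self hη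

end potential

/-! ### Signed densities as differences of finite measures -/

lemma integrable_withDensity_ofReal {α E : Type*} [MeasurableSpace α] [NormedAddCommGroup E]
    [NormedSpace ℝ E] {m : Measure α} {f : α → ℝ} (hf : AEMeasurable f m) {F : α → E}
    (hFm : AEStronglyMeasurable F m) (hF : Integrable (fun a => f a • F a) m) :
    Integrable F (m.withDensity fun a => ENNReal.ofReal (f a)) := by
  rw [integrable_withDensity_iff_integrable_smul₀' (by fun_prop) (by simp)]
  refine hF.mono (AEStronglyMeasurable.smul
    hf.ennreal_ofReal.ennreal_toReal.aestronglyMeasurable hFm) (ae_of_all _ fun a => ?_)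
  rw [norm_smul, norm_smul, ENNReal.toReal_ofReal', Real.norm_of_nonneg (le_max_right _ _)]
  exact mul_le_mul_of_nonneg_right (max_le (le_abs_self _) (abs_nonneg _)) (norm_nonneg _)

/-- This is `f = f⁺ - f⁻`, since `ENNReal.ofReal` truncates at zero. It serves both for
characteristic functions of an `L¹` function and for absolutely continuous lateral data. -/
lemma integral_withDensity_ofReal_sub {α E : Type*} [MeasurableSpace α] [NormedAddCommGroup E]
    [NormedSpace ℝ E] {m : Measure α} {f : α → ℝ} (hf : AEMeasurable f m) {F : α → E}
    (hFm : AEStronglyMeasurable F m) (hF : Integrable (fun a => f a • F a) m) :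
    ∫ a, F a ∂(m.withDensity fun a => ENNReal.ofReal (f a))
      - ∫ a, F a ∂(m.withDensity fun a => ENNReal.ofReal (-f a)) = ∫ a, f a • F a ∂m := by
  have h1 := integrable_withDensity_ofReal hf hFm hF
  have h2 := integrable_withDensity_ofReal (f := fun a => -f a) hf.neg hFm
    (hF.neg.congr (ae_of_all _ fun a => by simp))
  rw [integrable_withDensity_iff_integrable_smul₀' (by fun_prop) (by simp)] at h1 h2
  rw [integral_withDensity_eq_integral_toReal_smul₀ (by fun_prop) (by simp),
    integral_withDensity_eq_integral_toReal_smul₀ (by fun_prop) (by simp), ← integral_sub h1 h2]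
  congr 1; ext a
  rw [← sub_smul, ENNReal.toReal_ofReal', ENNReal.toReal_ofReal', max_zero_sub_max_neg_zero_eq_self]

lemma isFiniteMeasure_withDensity_ofReal_neg {α : Type*} [MeasurableSpace α] {m : Measure α}
    {f : α → ℝ} (hf : Integrable f m) :
    IsFiniteMeasure (m.withDensity fun a => ENNReal.ofReal (-f a)) :=
  isFiniteMeasure_withDensity_ofReal hf.neg.2

/-! ### Uniqueness for the linear problem by cosine test functions -/

/-- The test function `η(t) X(x)`. -/
noncomputable def NeumannTestFunction.separated (T : ℝ) {η η' X X' X'' : ℝ → ℝ}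
    (hη : ∀ t, HasDerivAt η (η' t) t) (hη' : Continuous η') (hX : ∀ x, HasDerivAt X (X' x) x)
    (hX' : ∀ x, HasDerivAt X' (X'' x) x) (hX'' : Continuous X'') (hX0 : X' 0 = 0) {T₁ R : ℝ}
    (hT₁ : T₁ < T) (hηT : ∀ t ∈ Ico T₁ T, η t = 0) (hXR : ∀ x, R ≤ x → X x = 0) :
    NeumannTestFunction T where
  val p := η p.1 * X p.2
  dt p := η' p.1 * X p.2
  dx p := η p.1 * X' p.2
  dxx p := η p.1 * X'' p.2
  hasDeriv_t t _ x _ := (HasDerivAt.mul_const (hη t) (X x)).hasDerivWithinAt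
  hasDeriv_x t _ x _ := (HasDerivAt.const_mul (η t) (hX x)).hasDerivWithinAt
  hasDeriv_xx t _ x _ := (HasDerivAt.const_mul (η t) (hX' x)).hasDerivWithinAt
  continuousOn_val := by
    have h1 : Continuous η := continuous_iff_continuousAt.2 fun t => (hη t).continuousAt
    have h2 : Continuous X := continuous_iff_continuousAt.2 fun t => (hX t).continuousAt
    fun_prop
  continuousOn_dt := by
    have h2 : Continuous X := continuous_iff_continuousAt.2 fun t => (hX t).continuousAt
    fun_prop
  continuousOn_dx := by
    have h1 : Continuous η := continuous_iff_continuousAt.2 fun t => (hη t).continuousAt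
    have h2 : Continuous X' := continuous_iff_continuousAt.2 fun t => (hX' t).continuousAt
    fun_prop
  continuousOn_dxx := by
    have h1 : Continuous η := continuous_iff_continuousAt.2 fun t => (hη t).continuousAt
    fun_prop
  compactSupport := by
    refine ⟨Icc 0 T₁ ×ˢ Icc 0 R, isCompact_Icc.prod isCompact_Icc,
      fun p hp => ⟨⟨hp.1.1, hp.1.2.trans_lt hT₁⟩, hp.2.1⟩, fun p hp => ?_⟩
    have : T₁ < p.1 ∨ R < p.2 := by
      by_contra! hc
      exact hp.2 ⟨⟨hp.1.1.1, hc.1⟩, ⟨hp.1.2, hc.2⟩⟩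
    rcases this with h | h
    · rw [hηT _ ⟨h.le, hp.1.1.2⟩, zero_mul]
    · rw [hXR _ h.le, mul_zero]
  neumann t _ := by rw [hX0, mul_zero]

/-- A continuous cutoff that vanishes for `t ≥ T - 1/n`. -/
noncomputable def timeCutoff (T : ℝ) (n : ℕ) (t : ℝ) : ℝ := min 1 (max 0 (n * (T - t) - 1))

lemma continuous_timeCutoff (T : ℝ) (n : ℕ) : Continuous (timeCutoff T n) := by
  unfold timeCutoff; fun_prop

lemma abs_timeCutoff_le (T : ℝ) (n : ℕ) (t : ℝ) : |timeCutoff T n t| ≤ 1 := by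
  have h : 0 ≤ timeCutoff T n t := le_min zero_le_one (le_max_left _ _)
  rw [abs_of_nonneg h]; exact min_le_left _ _

lemma timeCutoff_eq_zero {T : ℝ} {n : ℕ} (hn : 0 < n) {t : ℝ} (ht : T - (n : ℝ)⁻¹ ≤ t) :
    timeCutoff T n t = 0 := by
  have hn' : (0 : ℝ) < n := by exact_mod_cast hn
  have : n * (T - t) - 1 ≤ 0 := by
    have h : (n : ℝ) * (T - t) ≤ n * (n : ℝ)⁻¹ := by gcongr; linarith
    rw [mul_inv_cancel₀ hn'.ne'] at h; linarith
  simp [timeCutoff, max_eq_left this]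

lemma eventually_timeCutoff {T t : ℝ} (ht : t < T) : ∀ᶠ n : ℕ in atTop, timeCutoff T n t = 1 := by
  have h : Tendsto (fun n : ℕ => (n : ℝ) * (T - t)) atTop atTop :=
    tendsto_natCast_atTop_atTop.atTop_mul_const (sub_pos.2 ht)
  filter_upwards [h.eventually_ge_atTop 2] with n hn
  rw [timeCutoff, min_eq_left]
  exact le_max_of_le_right (by linarith)

/-- A smooth even cutoff on the line. -/
noncomputable def spaceBump : ContDiffBump (0 : ℝ) := ⟨1, 2, one_pos, one_lt_two⟩

lemma contDiff_spaceBump : ContDiff ℝ 2 spaceBump := spaceBump.contDiff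

lemma hasDerivAt_spaceBump (x : ℝ) : HasDerivAt spaceBump (deriv spaceBump x) x :=
  ((contDiff_spaceBump.differentiable (by norm_num)) x).hasDerivAt

lemma contDiff_deriv_spaceBump : ContDiff ℝ 1 (deriv spaceBump) := by
  have h : ContDiff ℝ (1 + 1) spaceBump := by
    have := contDiff_spaceBump; norm_num; exact this
  exact (contDiff_succ_iff_deriv.1 h).2.2

lemma hasDerivAt_deriv_spaceBump (x : ℝ) :
    HasDerivAt (deriv spaceBump) (deriv (deriv spaceBump) x) x :=
  ((contDiff_deriv_spaceBump.differentiable (by norm_num)) x).hasDerivAt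

lemma continuous_deriv_deriv_spaceBump : Continuous (deriv (deriv spaceBump)) :=
  contDiff_deriv_spaceBump.continuous_deriv (by norm_num)

lemma exists_bound_spaceBump : ∃ B : ℝ, 0 ≤ B ∧ ∀ x, |deriv spaceBump x| ≤ B ∧
    |deriv (deriv spaceBump) x| ≤ B := by
  have hc : HasCompactSupport spaceBump := spaceBump.hasCompactSupport
  obtain ⟨B₁, h1⟩ := hc.deriv.exists_bound_of_continuous contDiff_deriv_spaceBump.continuous
  obtain ⟨B₂, h2⟩ := hc.deriv.deriv.exists_bound_of_continuous continuous_deriv_deriv_spaceBump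
  exact ⟨max B₁ B₂, (abs_nonneg _).trans ((h1 0).trans (le_max_left _ _)),
    fun x => ⟨(h1 x).trans (le_max_left _ _), (h2 x).trans (le_max_right _ _)⟩⟩

lemma abs_spaceBump_le (x : ℝ) : |spaceBump x| ≤ 1 := by
  rw [abs_of_nonneg spaceBump.nonneg]; exact spaceBump.le_one

lemma spaceBump_eq_one {x : ℝ} (hx : |x| ≤ 1) : spaceBump x = 1 :=
  spaceBump.one_of_mem_closedBall (by
    rw [Metric.mem_closedBall, Real.dist_eq, sub_zero]; exact hx)

lemma spaceBump_eq_zero {x : ℝ} (hx : 2 ≤ |x|) : spaceBump x = 0 :=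
  spaceBump.zero_of_le_dist (by rw [Real.dist_eq, sub_zero]; exact hx)

lemma deriv_spaceBump_zero : deriv spaceBump 0 = 0 := by
  have : spaceBump =ᶠ[𝓝 0] fun _ => (1 : ℝ) := by
    filter_upwards [Metric.ball_mem_nhds (0 : ℝ) one_pos] with x hx
    exact spaceBump_eq_one (by simpa [Real.dist_eq] using (Metric.mem_ball.1 hx).le)
  rw [this.deriv_eq]; simp

/-- The solution of `η' = ξ² η + ψ`, `η(T) = 0`. -/
noncomputable def backwardODE (T ξ : ℝ) (ψ : ℝ → ℝ) (t : ℝ) : ℝ :=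
  Real.exp (ξ ^ 2 * t) * ∫ r in T..t, Real.exp (-(ξ ^ 2 * r)) * ψ r

lemma hasDerivAt_backwardODE (T ξ : ℝ) {ψ : ℝ → ℝ} (hψ : Continuous ψ) (t : ℝ) :
    HasDerivAt (backwardODE T ξ ψ) (ξ ^ 2 * backwardODE T ξ ψ t + ψ t) t := by
  have h1 : HasDerivAt (fun t => Real.exp (ξ ^ 2 * t)) (Real.exp (ξ ^ 2 * t) * (ξ ^ 2 * 1)) t :=
    ((hasDerivAt_id t).const_mul (ξ ^ 2)).exp
  have h2 : HasDerivAt (fun t => ∫ r in T..t, Real.exp (-(ξ ^ 2 * r)) * ψ r)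
      (Real.exp (-(ξ ^ 2 * t)) * ψ t) t :=
    (Continuous.integral_hasStrictDerivAt (f := fun r => Real.exp (-(ξ ^ 2 * r)) * ψ r)
      (by fun_prop) T t).hasDerivAt
  refine (h1.mul h2).congr_deriv ?_
  have : Real.exp (ξ ^ 2 * t) * Real.exp (-(ξ ^ 2 * t)) = 1 := by
    rw [← Real.exp_add]; simp
  unfold backwardODE
  linear_combination ψ t * this

lemma backwardODE_eq_zero {T₁ T ξ t : ℝ} {ψ : ℝ → ℝ} (h : ∀ t, T₁ ≤ t → ψ t = 0)
    (ht : t ∈ Ico T₁ T) : backwardODE T ξ ψ t = 0 := by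
  rw [backwardODE, intervalIntegral.integral_zero_ae, mul_zero]
  refine ae_of_all _ fun r hr => ?_
  rw [uIoc_of_ge ht.2.le] at hr
  rw [h r (ht.1.trans hr.1.le), mul_zero]

/-- The bound depends on `ψ` only through its supremum, so it is uniform over the time cutoffs and
provides the domination when they are removed. -/
lemma abs_backwardODE_le {T ξ B t : ℝ} {ψ : ℝ → ℝ} (hB : ∀ t, |ψ t| ≤ B) (ht : t ∈ Ioo 0 T) :
    |backwardODE T ξ ψ t| ≤ Real.exp (ξ ^ 2 * T) * (B * T) := by
  have hB0 : 0 ≤ B := (abs_nonneg _).trans (hB 0)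
  have hT : 0 < T := ht.1.trans ht.2
  rw [backwardODE, abs_mul, abs_of_pos (Real.exp_pos _)]
  refine mul_le_mul (Real.exp_le_exp.2 (mul_le_mul_of_nonneg_left ht.2.le (sq_nonneg _))) ?_
    (abs_nonneg _) (Real.exp_pos _).le
  have h : ‖∫ r in T..t, Real.exp (-(ξ ^ 2 * r)) * ψ r‖ ≤ B * |t - T| := by
    refine intervalIntegral.norm_integral_le_of_norm_le_const fun r hr => ?_
    rw [uIoc_of_ge ht.2.le] at hr
    rw [norm_mul, Real.norm_of_nonneg (Real.exp_pos _).le]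
    have : Real.exp (-(ξ ^ 2 * r)) ≤ 1 := Real.exp_le_one_iff.2 (by
      have : 0 ≤ ξ ^ 2 * r := mul_nonneg (sq_nonneg _) (ht.1.le.trans hr.1.le)
      linarith)
    calc _ ≤ 1 * B := mul_le_mul this (hB r) (abs_nonneg _) zero_le_one
      _ = B := one_mul B
  refine h.trans (mul_le_mul_of_nonneg_left ?_ hB0)
  rw [abs_of_neg (by linarith [ht.2])]; linarith [ht.1]

section uniqueness

variable {T : ℝ} {w : ℝ × ℝ → ℝ}

/-- The spatial profile `cos(ξx)χ(ax)` of the test functions, and its two derivatives. -/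
noncomputable def cosBump (ξ a x : ℝ) : ℝ := Real.cos (ξ * x) * spaceBump (a * x)

noncomputable def cosBumpDx (ξ a x : ℝ) : ℝ :=
  -(ξ * Real.sin (ξ * x)) * spaceBump (a * x) + Real.cos (ξ * x) * (a * deriv spaceBump (a * x))

noncomputable def cosBumpDxx (ξ a x : ℝ) : ℝ :=
  -(ξ ^ 2 * Real.cos (ξ * x)) * spaceBump (a * x)
    + (-(2 * ξ * Real.sin (ξ * x)) * (a * deriv spaceBump (a * x))
    + Real.cos (ξ * x) * (a ^ 2 * deriv (deriv spaceBump) (a * x)))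

lemma hasDerivAt_cosBump (ξ a x : ℝ) : HasDerivAt (cosBump ξ a) (cosBumpDx ξ a x) x := by
  have h1 : HasDerivAt (fun x => Real.cos (ξ * x)) (-Real.sin (ξ * x) * (ξ * 1)) x :=
    ((hasDerivAt_id x).const_mul ξ).cos
  have h2 : HasDerivAt (fun x => spaceBump (a * x)) (deriv spaceBump (a * x) * (a * 1)) x :=
    (hasDerivAt_spaceBump (a * x)).comp x ((hasDerivAt_id x).const_mul a)
  refine (h1.mul h2).congr_deriv ?_
  unfold cosBumpDx; ring

lemma hasDerivAt_cosBumpDx (ξ a x : ℝ) : HasDerivAt (cosBumpDx ξ a) (cosBumpDxx ξ a x) x := by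
  have h1 : HasDerivAt (fun x => Real.cos (ξ * x)) (-Real.sin (ξ * x) * (ξ * 1)) x :=
    ((hasDerivAt_id x).const_mul ξ).cos
  have h1' : HasDerivAt (fun x => -(ξ * Real.sin (ξ * x)))
      (-(ξ * (Real.cos (ξ * x) * (ξ * 1)))) x :=
    (((hasDerivAt_id x).const_mul ξ).sin.const_mul ξ).neg
  have h2 : HasDerivAt (fun x => spaceBump (a * x)) (deriv spaceBump (a * x) * (a * 1)) x :=
    (hasDerivAt_spaceBump (a * x)).comp x ((hasDerivAt_id x).const_mul a)
  have h3 : HasDerivAt (fun x => a * deriv spaceBump (a * x))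
      (a * (deriv (deriv spaceBump) (a * x) * (a * 1))) x :=
    ((hasDerivAt_deriv_spaceBump (a * x)).comp x ((hasDerivAt_id x).const_mul a)).const_mul a
  refine ((h1'.mul h2).add (h1.mul h3)).congr_deriv ?_
  unfold cosBumpDxx; ring

lemma continuous_cosBumpDxx (ξ a : ℝ) : Continuous (cosBumpDxx ξ a) := by
  have h1 : Continuous spaceBump := contDiff_spaceBump.continuous
  have h2 : Continuous (deriv spaceBump) := contDiff_deriv_spaceBump.continuous
  have h3 := continuous_deriv_deriv_spaceBump
  unfold cosBumpDxx
  fun_prop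

lemma cosBumpDx_zero (ξ a : ℝ) : cosBumpDx ξ a 0 = 0 := by
  simp [cosBumpDx, deriv_spaceBump_zero]

/-- Testing against `φ(t) cos(ξx)` is possible, by truncation. -/
lemma integral_mul_cos_eq_zero (hT : 0 < T) (hw : IntegrableOn w (openCylinder T))
    (h : ∀ ζ : NeumannTestFunction T, ∫ p in openCylinder T, (ζ.dt p + ζ.dxx p) * w p = 0)
    {φ : ℝ → ℝ} (hφ : Continuous φ) {B : ℝ} (hB : ∀ t, |φ t| ≤ B) (ξ : ℝ) :
    ∫ p in openCylinder T, φ p.1 * Real.cos (ξ * p.2) * w p = 0 := by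
  have hB0 : 0 ≤ B := (abs_nonneg _).trans (hB 0)
  obtain ⟨D, hD0, hD⟩ := exists_bound_spaceBump
  set ψ : ℕ → ℝ → ℝ := fun n t => φ t * timeCutoff T (n + 1) t with hψdef
  set a : ℕ → ℝ := fun n => 1 / ((n : ℝ) + 1) with hadef
  have ha0 : ∀ n, 0 < a n := fun n => Nat.one_div_pos_of_nat
  have ha1 : ∀ n, a n ≤ 1 := fun n => by
    rw [hadef]; simp only
    rw [div_le_one (by positivity)]; have : (0 : ℝ) ≤ n := n.cast_nonneg; linarith
  have halim : Tendsto a atTop (𝓝 0) := tendsto_one_div_add_atTop_nhds_zero_nat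
  have hψc : ∀ n, Continuous (ψ n) := fun n => hφ.mul (continuous_timeCutoff _ _)
  have hψB : ∀ n t, |ψ n t| ≤ B := fun n t => by
    rw [hψdef]; simp only [abs_mul]
    calc _ ≤ B * 1 := mul_le_mul (hB t) (abs_timeCutoff_le _ _ _) (abs_nonneg _) hB0
      _ = B := mul_one B
  -- `F n` is `ζ_t + ζ_xx` for `ζ = η(t) cos(ξx) χ(a_n x)`. The term `ξ² η` from the ODE cancels the
  -- `-ξ²` from the cosine, and only terms in which `χ` is differentiated remain besides `ψ cos(ξx)
  -- χ`.
  set F : ℕ → ℝ × ℝ → ℝ := fun n p => ψ n p.1 * cosBump ξ (a n) p.2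
    + backwardODE T ξ (ψ n) p.1 * (-(2 * ξ * Real.sin (ξ * p.2)) * (a n * deriv spaceBump (a n * p.2))
    + Real.cos (ξ * p.2) * (a n ^ 2 * deriv (deriv spaceBump) (a n * p.2))) with hFdef
  have hF0 : ∀ n, ∫ p in openCylinder T, F n p * w p = 0 := by
    intro n
    have hz : ∀ t, T - ((n + 1 : ℕ) : ℝ)⁻¹ ≤ t → ψ n t = 0 := fun t ht => by
      rw [hψdef]; simp only; rw [timeCutoff_eq_zero n.succ_pos ht, mul_zero]
    let ζ := NeumannTestFunction.separated T (hasDerivAt_backwardODE T ξ (hψc n))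
      (by
        have : Continuous (backwardODE T ξ (ψ n)) := continuous_iff_continuousAt.2 fun t =>
          (hasDerivAt_backwardODE T ξ (hψc n) t).continuousAt
        have := hψc n
        fun_prop)
      (hasDerivAt_cosBump ξ (a n)) (hasDerivAt_cosBumpDx ξ (a n)) (continuous_cosBumpDxx ξ (a n))
      (cosBumpDx_zero ξ (a n)) (T₁ := T - ((n + 1 : ℕ) : ℝ)⁻¹) (R := 2 * (n + 1))
      (sub_lt_self _ (by positivity)) (fun t ht => backwardODE_eq_zero hz ht)
      (fun x hx => by
        have : 2 ≤ a n * x := by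
          rw [hadef]; simp only
          rw [one_div_mul_eq_div, le_div_iff₀ (by positivity)]; exact hx
        rw [cosBump, spaceBump_eq_zero (this.trans (le_abs_self _)), mul_zero])
    rw [← h ζ]
    congr 1; ext p
    congr 1
    simp only [hFdef, ζ, NeumannTestFunction.separated, cosBump, cosBumpDxx]
    ring
  set E : ℝ := Real.exp (ξ ^ 2 * T) * (B * T) with hE
  have hE0 : 0 ≤ E := by positivity
  set C : ℝ := B + E * (2 * |ξ| * D + D) with hC
  have hlim : Tendsto (fun n => ∫ p in openCylinder T, F n p * w p) atTop
      (𝓝 (∫ p in openCylinder T, φ p.1 * Real.cos (ξ * p.2) * w p)) := by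
    refine tendsto_integral_of_dominated_convergence (fun p => C * ‖w p‖) ?_
      (hw.norm.const_mul C) ?_ ?_
    · intro n
      refine AEStronglyMeasurable.mul (Continuous.aestronglyMeasurable ?_) hw.aestronglyMeasurable
      have h1 : Continuous spaceBump := contDiff_spaceBump.continuous
      have h2 : Continuous (deriv spaceBump) := contDiff_deriv_spaceBump.continuous
      have h3 := continuous_deriv_deriv_spaceBump
      have h4 : Continuous (backwardODE T ξ (ψ n)) := continuous_iff_continuousAt.2 fun t =>
          (hasDerivAt_backwardODE T ξ (hψc n) t).continuousAt
      have h5 := hψc n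
      rw [hFdef]
      unfold cosBump
      fun_prop
    · intro n
      filter_upwards [ae_restrict_mem (measurableSet_openCylinder T)] with p hp
      rw [norm_mul]
      refine mul_le_mul_of_nonneg_right ?_ (norm_nonneg _)
      have e1 : |ψ n p.1 * cosBump ξ (a n) p.2| ≤ B := by
        rw [cosBump, abs_mul (ψ n p.1), abs_mul (Real.cos _)]
        calc _ ≤ B * (1 * 1) := mul_le_mul (hψB n _) (mul_le_mul (Real.abs_cos_le_one _)
              (abs_spaceBump_le _) (abs_nonneg _) zero_le_one) (by positivity) hB0
          _ = B := by ring
      have e2 : |-(2 * ξ * Real.sin (ξ * p.2)) * (a n * deriv spaceBump (a n * p.2))|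
          ≤ 2 * |ξ| * D := by
        rw [abs_mul, abs_neg, abs_mul, abs_mul, abs_mul, abs_of_pos (ha0 n), abs_two]
        calc _ ≤ (2 * |ξ| * 1) * (1 * D) := by
              gcongr
              · exact Real.abs_sin_le_one _
              · exact ha1 n
              · exact (hD _).1
          _ = _ := by ring
      have e3 : |Real.cos (ξ * p.2) * (a n ^ 2 * deriv (deriv spaceBump) (a n * p.2))| ≤ D := by
        rw [abs_mul, abs_mul, abs_of_nonneg (sq_nonneg (a n))]
        calc _ ≤ 1 * (1 * D) := by
              gcongr
              · exact Real.abs_cos_le_one _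
              · exact pow_le_one₀ (ha0 n).le (ha1 n)
              · exact (hD _).2
          _ = _ := by ring
      have e4 := abs_backwardODE_le (ξ := ξ) (hψB n) hp.1
      rw [Real.norm_eq_abs]
      refine (abs_add_le _ _).trans (add_le_add e1 ?_)
      rw [abs_mul]
      exact mul_le_mul e4 ((abs_add_le _ _).trans (add_le_add e2 e3)) (abs_nonneg _) hE0
    · filter_upwards [ae_restrict_mem (measurableSet_openCylinder T)] with p hp
      refine Tendsto.mul_const _ ?_
      have hsmall : ∀ᶠ n in atTop, |a n * p.2| < 1 := by
        have : Tendsto (fun n => |a n * p.2|) atTop (𝓝 |0 * p.2|) := (halim.mul_const _).abs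
        rw [zero_mul, abs_zero] at this
        exact this.eventually (gt_mem_nhds one_pos)
      have hloc : ∀ y : ℝ, |y| < 1 → spaceBump =ᶠ[𝓝 y] fun _ => (1 : ℝ) := fun y hy => by
        filter_upwards [(isOpen_lt continuous_abs continuous_const).mem_nhds hy] with x hx
        exact spaceBump_eq_one (le_of_lt hx)
      have hd1 : ∀ y : ℝ, |y| < 1 → deriv spaceBump y = 0 := fun y hy => by
        rw [(hloc y hy).deriv_eq]; simp
      have hd2 : ∀ y : ℝ, |y| < 1 → deriv (deriv spaceBump) y = 0 := fun y hy => by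
        rw [(hloc y hy).deriv.deriv_eq]; simp
      -- At a fixed point the sequence is eventually constant: once `|a_n x| < 1` the cutoff is `1`
      -- with vanishing derivatives, and the time cutoff has also reached `1`.
      refine tendsto_const_nhds.congr' ?_
      filter_upwards [hsmall, (tendsto_add_atTop_nat 1).eventually
        (eventually_timeCutoff hp.1.2)] with n hn1 hn2
      simp only [hFdef, hψdef, cosBump, hd1 _ hn1, hd2 _ hn1, spaceBump_eq_one hn1.le, hn2]
      ring
  simp only [hF0] at hlim
  exact (tendsto_nhds_unique tendsto_const_nhds hlim).symm

/-- Reflection of the space variable. -/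
def reflectSpace (p : ℝ × ℝ) : ℝ × ℝ := (p.1, -p.2)

lemma measurable_reflectSpace : Measurable reflectSpace := by unfold reflectSpace; fun_prop

/-- Adding the reflected measure replaces `e^{iξx}` by `2 cos(ξx)`. Only cosines satisfy the Neumann
condition at `x = 0`, so these are the frequencies that test functions can detect. -/
lemma charFunDual_add_reflect {m : Measure (ℝ × ℝ)} [IsFiniteMeasure m]
    (L : StrongDual ℝ (ℝ × ℝ)) :
    charFunDual (m + m.map reflectSpace) L = ∫ p, (2 * Complex.cos ((L (0, 1) * p.2 : ℝ))) *
      Complex.exp ((L (1, 0) * p.1 : ℝ) * Complex.I) ∂m := by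
  have hL : ∀ p : ℝ × ℝ, L p = L (1, 0) * p.1 + L (0, 1) * p.2 := fun p => by
    have : p = p.1 • (1, 0) + p.2 • ((0, 1) : ℝ × ℝ) := by ext <;> simp
    conv_lhs => rw [this]
    rw [map_add, map_smul, map_smul, smul_eq_mul, smul_eq_mul]; ring
  have hm : Measurable fun p : ℝ × ℝ => Complex.exp (L p * Complex.I) := by fun_prop
  have hb : ∀ (m : Measure (ℝ × ℝ)) [IsFiniteMeasure m],
      Integrable (fun p : ℝ × ℝ => Complex.exp (L p * Complex.I)) m := fun m _ =>
    Integrable.of_bound hm.aestronglyMeasurable 1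
      (ae_of_all _ fun p => (Complex.norm_exp_ofReal_mul_I _).le)
  have hfin : IsFiniteMeasure (m.map reflectSpace) := inferInstance
  have hi2 : Integrable (fun p => Complex.exp (L (reflectSpace p) * Complex.I)) m :=
    (hb (m.map reflectSpace)).comp_measurable measurable_reflectSpace
  rw [charFunDual_apply, integral_add_measure (hb m) (hb _),
    integral_map measurable_reflectSpace.aemeasurable hm.aestronglyMeasurable,
    ← integral_add (hb m) hi2]
  congr 1; ext p
  rw [hL p, hL (reflectSpace p)]
  simp only [reflectSpace]
  push_cast
  rw [Complex.two_cos, mul_neg, add_mul, add_mul, Complex.exp_add, Complex.exp_add]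
  ring

/-- Uniqueness for the linear problem in `L¹`. -/
theorem ae_eq_zero_of_forall_testFunction (hT : 0 < T) (hw : IntegrableOn w (openCylinder T))
    (h : ∀ ζ : NeumannTestFunction T, ∫ p in openCylinder T, (ζ.dt p + ζ.dxx p) * w p = 0) :
    ∀ᵐ p ∂(volume.restrict (openCylinder T)), w p = 0 := by
  set v := volume.restrict (openCylinder T) with hv
  set m₁ := v.withDensity fun p => ENNReal.ofReal (w p) with hm₁
  set m₂ := v.withDensity fun p => ENNReal.ofReal (-w p) with hm₂
  have hwm : AEMeasurable w v := hw.aestronglyMeasurable.aemeasurable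
  have f1 : IsFiniteMeasure m₁ := isFiniteMeasure_withDensity_ofReal hw.2
  have f2 : IsFiniteMeasure m₂ := isFiniteMeasure_withDensity_ofReal_neg hw
  -- The difference of the two characteristic functions is `∫ 2 cos(ξx) e^{iαt} w`, whose real and
  -- imaginary parts vanish by `integral_mul_cos_eq_zero`.
  have hmeas : m₁ + m₁.map reflectSpace = m₂ + m₂.map reflectSpace := by
    have g1 : IsFiniteMeasure (m₁.map reflectSpace) := inferInstance
    have g2 : IsFiniteMeasure (m₂.map reflectSpace) := inferInstance
    refine Measure.ext_of_charFunDual (funext fun L => ?_)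
    rw [charFunDual_add_reflect, charFunDual_add_reflect, ← sub_eq_zero]
    set α := L (1, 0)
    set ξ := L (0, 1)
    have hFc : Continuous fun p : ℝ × ℝ => (2 * Complex.cos ((ξ * p.2 : ℝ))) *
      Complex.exp ((α * p.1 : ℝ) * Complex.I) := by fun_prop
    have hFb : ∀ p : ℝ × ℝ, ‖(2 * Complex.cos ((ξ * p.2 : ℝ))) *
      Complex.exp ((α * p.1 : ℝ) * Complex.I)‖ ≤ 2 := fun p => by
      rw [norm_mul, Complex.norm_exp_ofReal_mul_I, mul_one, norm_mul, ← Complex.ofReal_cos,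
        Complex.norm_real, Real.norm_eq_abs, Complex.norm_ofNat]
      linarith [Real.abs_cos_le_one (ξ * p.2)]
    have hFi : Integrable (fun p : ℝ × ℝ => w p • ((2 * Complex.cos ((ξ * p.2 : ℝ))) *
      Complex.exp ((α * p.1 : ℝ) * Complex.I))) v :=
      Integrable.smul_bdd hw 2 hFc.aestronglyMeasurable (ae_of_all _ hFb)
    rw [hm₁, hm₂, integral_withDensity_ofReal_sub hwm hFc.aestronglyMeasurable hFi]
    have hc := integral_mul_cos_eq_zero hT hw h (φ := fun t => Real.cos (α * t)) (by fun_prop)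
      (fun t => Real.abs_cos_le_one _) ξ
    have hs := integral_mul_cos_eq_zero hT hw h (φ := fun t => Real.sin (α * t)) (by fun_prop)
      (fun t => Real.abs_sin_le_one _) ξ
    have key : ∀ p : ℝ × ℝ, w p • ((2 * Complex.cos ((ξ * p.2 : ℝ))) *
        Complex.exp ((α * p.1 : ℝ) * Complex.I))
        = ((2 * (Real.cos (α * p.1) * Real.cos (ξ * p.2) * w p) : ℝ) : ℂ)
          + ((2 * (Real.sin (α * p.1) * Real.cos (ξ * p.2) * w p) : ℝ) : ℂ) * Complex.I := by
      intro p
      rw [Complex.exp_mul_I, Complex.real_smul]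
      push_cast
      ring
    have bd : ∀ {f : ℝ × ℝ → ℝ}, Continuous f → (∀ p, |f p| ≤ 1) →
        Integrable (fun p => f p * w p) v := fun hf hb =>
      Integrable.bdd_mul (c := 1) hw hf.aestronglyMeasurable (ae_of_all _ hb)
    have bc : Integrable (fun p : ℝ × ℝ => Real.cos (α * p.1) * Real.cos (ξ * p.2) * w p) v :=
      bd (by fun_prop) fun p => by
        rw [abs_mul]
        exact mul_le_one₀ (Real.abs_cos_le_one _) (abs_nonneg _) (Real.abs_cos_le_one _)
    have bs : Integrable (fun p : ℝ × ℝ => Real.sin (α * p.1) * Real.cos (ξ * p.2) * w p) v :=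
      bd (by fun_prop) fun p => by
        rw [abs_mul]
        exact mul_le_one₀ (Real.abs_sin_le_one _) (abs_nonneg _) (Real.abs_cos_le_one _)
    simp only [key]
    rw [integral_add (bc.const_mul 2).ofReal ((bs.const_mul 2).ofReal.mul_const _),
      integral_mul_const, integral_complex_ofReal, integral_complex_ofReal, integral_const_mul,
      integral_const_mul, hc, hs]
    simp
  -- The reflected measure is carried by `x < 0`. Intersecting with the cylinder therefore recovers
  -- the original measure from the symmetrised one.
  have hzero : ∀ f : ℝ × ℝ → ENNReal, ∀ s : Set (ℝ × ℝ), MeasurableSet s →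
      ((v.withDensity f) + (v.withDensity f).map reflectSpace) (s ∩ openCylinder T)
        = v.withDensity f s := by
    intro f s hs
    have hso := hs.inter (measurableSet_openCylinder T)
    have hc : (v.withDensity f) (openCylinder T)ᶜ = 0 := by
      refine withDensity_absolutelyContinuous v f ?_
      rw [hv, Measure.restrict_apply (measurableSet_openCylinder T).compl]; simp
    rw [Measure.add_apply, Measure.map_apply measurable_reflectSpace hso]
    have e1 : (v.withDensity f) (reflectSpace ⁻¹' (s ∩ openCylinder T)) = 0 := by
      refine measure_mono_null (fun p hp => ?_) hc
      intro hp'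
      have a1 : 0 < -p.2 := hp.2.2
      have a2 : 0 < p.2 := hp'.2
      linarith
    rw [e1, add_zero]
    exact measure_inter_conull hc
  have heq : m₁ = m₂ := by
    ext s hs
    rw [hm₁, hm₂, ← hzero _ s hs, ← hzero _ s hs]
    exact congrArg (fun m => m (s ∩ openCylinder T)) hmeas
  rw [hm₁, hm₂, withDensity_eq_iff_of_sigmaFinite (by fun_prop) (by fun_prop)] at heq
  filter_upwards [heq] with p hp
  have := congrArg ENNReal.toReal hp
  rw [ENNReal.toReal_ofReal', ENNReal.toReal_ofReal'] at this
  have h2 := max_zero_sub_max_neg_zero_eq_self (w p)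
  rw [this, sub_self] at h2
  exact h2.symm

end uniqueness

/-! ### The truncated half derivative -/

/-- The kernel `-∂_t (π(t+ε))^{-1/2}`, `t > 0`, of the truncated half derivative. -/
noncomputable def fracKer (ε t : ℝ) : ℝ := if 0 < t then (2 * (t + ε))⁻¹ * heatKer (t + ε) 0 else 0

/-- The truncated half derivative of the boundary kernel, an approximation of the identity. -/
noncomputable def approxId (ε t : ℝ) : ℝ := Real.pi⁻¹ * √ε * (√t)⁻¹ * (t + ε)⁻¹

lemma fracKer_of_nonpos {t : ℝ} (ε : ℝ) (ht : t ≤ 0) : fracKer ε t = 0 := if_neg (not_lt.2 ht)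

lemma fracKer_nonneg {ε : ℝ} (hε : 0 < ε) (t : ℝ) : 0 ≤ fracKer ε t := by
  unfold fracKer
  split_ifs with h
  · have := heatKer_nonneg (t + ε) 0
    positivity
  · exact le_rfl

lemma measurable_fracKer (ε : ℝ) : Measurable (fracKer ε) := by
  unfold fracKer
  exact Measurable.ite measurableSet_Ioi (by fun_prop) (by fun_prop)

@[fun_prop]
lemma Measurable.fracKer {α : Type*} [MeasurableSpace α] {f : α → ℝ} (hf : Measurable f) (ε : ℝ) :
    Measurable fun a => fracKer ε (f a) := (measurable_fracKer ε).comp hf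

@[fun_prop]
lemma Measurable.approxId {α : Type*} [MeasurableSpace α] {f : α → ℝ} (hf : Measurable f) (ε : ℝ) :
    Measurable fun a => approxId ε (f a) := by
  unfold _root_.approxId; fun_prop

lemma approxId_of_nonpos {t : ℝ} (ε : ℝ) (ht : t ≤ 0) : approxId ε t = 0 := by
  simp [approxId, Real.sqrt_eq_zero_of_nonpos ht]

lemma approxId_nonneg {ε : ℝ} (hε : 0 < ε) (t : ℝ) : 0 ≤ approxId ε t := by
  rcases le_or_gt t 0 with h | h
  · rw [approxId_of_nonpos ε h]
  · unfold approxId; positivity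

lemma hasDerivAt_heatKer_zero {t : ℝ} (ht : 0 < t) :
    HasDerivAt (fun t => heatKer t 0) (-((2 * t)⁻¹ * heatKer t 0)) t := by
  refine (hasDerivAt_heatKer_left ht 0).congr_deriv ?_
  simp

/-- Mass of the truncated half derivative kernel on `(0, a)`. -/
lemma fracKer_mass {ε a : ℝ} (hε : 0 < ε) (ha : 0 ≤ a) :
    IntegrableOn (fracKer ε) (Iic a) ∧
      ∫ t in Iic a, fracKer ε t = heatKer ε 0 - heatKer (a + ε) 0 := by
  have hc : ContinuousOn (fun t => -heatKer (t + ε) 0) (Icc 0 a) := fun t ht =>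
    (((hasDerivAt_heatKer_zero (by linarith [ht.1] : 0 < t + ε)).comp_add_const t ε).neg
      ).continuousAt.continuousWithinAt
  have hd : ∀ t ∈ Ioo 0 a, HasDerivAt (fun t => -heatKer (t + ε) 0) (fracKer ε t) t := fun t ht => by
    have := ((hasDerivAt_heatKer_zero (by linarith [ht.1] : 0 < t + ε)).comp_add_const t ε).neg
    rw [fracKer, if_pos ht.1]
    exact this.congr_deriv (neg_neg _)
  have h0 : IntegrableOn (fracKer ε) (Iic 0) :=
    integrableOn_zero.congr_fun (fun t ht => (fracKer_of_nonpos ε ht).symm) measurableSet_Iic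
  have h1 : IntegrableOn (fracKer ε) (Ioc 0 a) :=
    intervalIntegral.integrableOn_deriv_of_nonneg hc hd fun t _ => fracKer_nonneg hε t
  have hz : ∫ t in Iic 0, fracKer ε t = 0 :=
    setIntegral_eq_zero_of_forall_eq_zero fun t ht => fracKer_of_nonpos ε ht
  rw [← Iic_union_Ioc_eq_Iic ha]
  refine ⟨h0.union h1, ?_⟩
  rw [setIntegral_union (Iic_disjoint_Ioc le_rfl) measurableSet_Ioc h0 h1,
    hz, zero_add,
    ← intervalIntegral.integral_of_le ha, intervalIntegral.integral_eq_sub_of_hasDerivAt_of_le ha hc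
      hd ((intervalIntegrable_iff_integrableOn_Ioc_of_le ha).2 h1)]
  simp; ring

lemma integrable_fracKer {ε : ℝ} (hε : 0 < ε) : Integrable (fracKer ε) := by
  rw [← integrableOn_univ, ← Iic_union_Ioi (a := (0 : ℝ))]
  refine (fracKer_mass hε le_rfl).1.union ?_
  refine integrableOn_Ioi_deriv_of_nonneg (g := fun t => -heatKer (t + ε) 0) (l := -0) ?_ ?_
    (fun t _ => fracKer_nonneg hε t) ?_
  · exact (((hasDerivAt_heatKer_zero (by linarith : 0 < 0 + ε)).comp_add_const 0 ε).neg
      ).continuousAt.continuousWithinAt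
  · intro t ht
    have := ((hasDerivAt_heatKer_zero (by linarith [ht.out] : 0 < t + ε)).comp_add_const t ε).neg
    rw [fracKer, if_pos ht.out]
    exact this.congr_deriv (neg_neg _)
  · refine Tendsto.neg ?_
    simp only [heatKer_zero_right]
    refine (Real.tendsto_sqrt_atTop.comp ?_).inv_tendsto_atTop
    exact (tendsto_atTop_add_const_right _ ε tendsto_id).const_mul_atTop Real.pi_pos

/-- The gap `heatKer (T + ε) 0` below `heatKer ε 0` survives as `ε → 0`. It is the strictly positive
coefficient of `∫ d⁺` on which the comparison principle rests. -/
lemma integral_Ioo_fracKer_sub_le {ε T s : ℝ} (hε : 0 < ε) (hT : 0 ≤ T) (hs : 0 ≤ s) :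
    ∫ t in Ioo 0 T, fracKer ε (t - s) ≤ heatKer ε 0 - heatKer (T + ε) 0 := by
  rw [← (fracKer_mass hε hT).2, ← integral_indicator measurableSet_Ioo,
    ← integral_indicator measurableSet_Iic, ← integral_sub_right_eq_self (indicator (Iic T) _) s]
  have hi := (integrable_fracKer hε)
  refine integral_mono ((hi.comp_sub_right s).indicator measurableSet_Ioo)
    ((hi.indicator measurableSet_Iic).comp_sub_right s) fun t => ?_
  by_cases h : t ∈ Ioo 0 T
  · rw [indicator_of_mem h, indicator_of_mem (by simp; linarith [h.2])]
  · rw [indicator_of_notMem h]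
    exact indicator_nonneg (fun _ _ => fracKer_nonneg hε _) _

lemma inv_sqrt_pi_mul_mul (a b : ℝ) :
    (√Real.pi * a)⁻¹ * (√Real.pi * b)⁻¹ = Real.pi⁻¹ * a⁻¹ * b⁻¹ := by
  rw [mul_inv, mul_inv]
  calc _ = (√Real.pi ^ 2)⁻¹ * a⁻¹ * b⁻¹ := by ring
    _ = _ := by rw [Real.sq_sqrt Real.pi_pos.le]

/-- With `C = √s` and `A = √(t+ε-s)` one has `A² + C² = t + ε`, so the ratio `C/A` has derivative
`(t+ε)/(2CA³)`. This is the integrand up to the constant `π(t+ε)`. -/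
lemma hasDerivAt_fracKer_primitive {ε t s : ℝ} (hε : 0 < ε) (hs : s ∈ Ioo 0 t) :
    HasDerivAt (fun s => Real.pi⁻¹ * (t + ε)⁻¹ * (√s * (√(t + ε - s))⁻¹))
      (fracKer ε (t - s) * heatKer s 0) s := by
  have h1 : 0 < s := hs.1
  have h2 : 0 < t + ε - s := by linarith [hs.2]
  have d1 : HasDerivAt (fun s => √s) (1 / (2 * √s)) s := Real.hasDerivAt_sqrt h1.ne'
  have d2 : HasDerivAt (fun s => √(t + ε - s)) (-1 / (2 * √(t + ε - s))) s :=
    ((hasDerivAt_id s).const_sub (t + ε)).sqrt h2.ne'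
  refine ((d1.mul (d2.fun_inv (Real.sqrt_pos.2 h2).ne')).const_mul
    (Real.pi⁻¹ * (t + ε)⁻¹)).congr_deriv ?_
  rw [fracKer, if_pos (sub_pos.2 hs.2), heatKer_zero_right, heatKer_zero_right,
    show t - s + ε = t + ε - s by ring, Real.sqrt_mul Real.pi_pos.le, Real.sqrt_mul Real.pi_pos.le]
  have q1 : 0 < √s := Real.sqrt_pos.2 h1
  have q2 : 0 < √(t + ε - s) := Real.sqrt_pos.2 h2
  have e1 : √s ^ 2 = s := Real.sq_sqrt h1.le
  have e2 : √(t + ε - s) ^ 2 = t + ε - s := Real.sq_sqrt h2.le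
  rw [mul_assoc (2 * (t + ε - s))⁻¹, inv_sqrt_pi_mul_mul]
  generalize √(t + ε - s) = A at *
  generalize √s = C at *
  have e4 : t + ε = A ^ 2 + C ^ 2 := by rw [e1, e2]; ring
  rw [e4, show A ^ 2 + C ^ 2 - s = A ^ 2 by rw [e1]; ring]
  have : 0 < A ^ 2 + C ^ 2 := by positivity
  field_simp

lemma heatKer_mul_sub_approxId {ε t : ℝ} (hε : 0 < ε) (ht : 0 < t) :
    heatKer ε 0 * heatKer t 0 - approxId ε t = Real.pi⁻¹ * (t + ε)⁻¹ * (√t * (√ε)⁻¹) := by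
  rw [heatKer_zero_right, heatKer_zero_right, Real.sqrt_mul Real.pi_pos.le,
    Real.sqrt_mul Real.pi_pos.le, approxId]
  have q1 : 0 < √ε := Real.sqrt_pos.2 hε
  have q2 : 0 < √t := Real.sqrt_pos.2 ht
  have e1 : √ε ^ 2 = ε := Real.sq_sqrt hε.le
  have e2 : √t ^ 2 = t := Real.sq_sqrt ht.le
  rw [inv_sqrt_pi_mul_mul]
  have e4 : t + ε = √t ^ 2 + √ε ^ 2 := by rw [e1, e2]
  rw [e4]
  field_simp
  ring

lemma integral_fracKer_mul_heatKer_Ioo {ε t : ℝ} (hε : 0 < ε) (ht : 0 < t) :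
    IntegrableOn (fun s => fracKer ε (t - s) * heatKer s 0) (Ioo 0 t) ∧
    ∫ s in Ioo 0 t, fracKer ε (t - s) * heatKer s 0
      = heatKer ε 0 * heatKer t 0 - approxId ε t := by
  have hc : ContinuousOn (fun s => Real.pi⁻¹ * (t + ε)⁻¹ * (√s * (√(t + ε - s))⁻¹)) (Icc 0 t) := by
    refine ContinuousOn.mul (by fun_prop) (ContinuousOn.mul (by fun_prop) ?_)
    refine ContinuousOn.inv₀ (by fun_prop) fun s hs => (Real.sqrt_pos.2 ?_).ne'
    linarith [hs.2]
  have h1 : IntegrableOn (fun s => fracKer ε (t - s) * heatKer s 0) (Ioc 0 t) :=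
    intervalIntegral.integrableOn_deriv_of_nonneg hc
      (fun s hs => hasDerivAt_fracKer_primitive hε hs) fun s _ =>
      mul_nonneg (fracKer_nonneg hε _) (heatKer_nonneg _ _)
  refine ⟨h1.mono_set Ioo_subset_Ioc_self, ?_⟩
  rw [← integral_Ioc_eq_integral_Ioo, ← intervalIntegral.integral_of_le ht.le,
    intervalIntegral.integral_eq_sub_of_hasDerivAt_of_le ht.le hc
      (fun s hs => hasDerivAt_fracKer_primitive hε hs)
      ((intervalIntegrable_iff_integrableOn_Ioc_of_le ht.le).2 h1), heatKer_mul_sub_approxId hε ht]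
  simp

lemma fracKer_mul_heatKer_eq_zero {ε t s : ℝ} (y : ℝ) (hs : s ∉ Ioo 0 t) :
    fracKer ε (t - s) * heatKer s y = 0 := by
  rcases le_or_gt s 0 with h | h
  · rw [heatKer_of_nonpos h, mul_zero]
  · have : t ≤ s := not_lt.1 fun h' => hs ⟨h, h'⟩
    rw [fracKer_of_nonpos ε (sub_nonpos.2 this), zero_mul]

/-- The truncated half derivative of the boundary kernel. -/
lemma integral_fracKer_mul_heatKer {ε : ℝ} (hε : 0 < ε) (t : ℝ) :
    Integrable (fun s => fracKer ε (t - s) * heatKer s 0) ∧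
    ∫ s, fracKer ε (t - s) * heatKer s 0 = heatKer ε 0 * heatKer t 0 - approxId ε t := by
  rcases le_or_gt t 0 with ht | ht
  · have : (fun s => fracKer ε (t - s) * heatKer s 0) = fun _ => 0 := funext fun s =>
      fracKer_mul_heatKer_eq_zero 0 (by simp [ht])
    rw [this]
    simp [heatKer_of_nonpos ht, approxId_of_nonpos ε ht]
  · obtain ⟨h1, h2⟩ := integral_fracKer_mul_heatKer_Ioo hε ht
    refine ⟨(integrableOn_iff_integrable_of_support_subset fun s hs => ?_).1 h1, ?_⟩
    · by_contra hc
      exact hs (fracKer_mul_heatKer_eq_zero 0 hc)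
    · rw [← h2, setIntegral_eq_integral_of_forall_compl_eq_zero]
      exact fun s hs => fracKer_mul_heatKer_eq_zero 0 hs

lemma approxId_le {ε : ℝ} (hε : 0 < ε) (t : ℝ) : approxId ε t ≤ heatKer ε 0 * heatKer t 0 := by
  have h := (integral_fracKer_mul_heatKer hε t).2
  have h2 : 0 ≤ ∫ s, fracKer ε (t - s) * heatKer s 0 := integral_nonneg fun s =>
    mul_nonneg (fracKer_nonneg hε _) (heatKer_nonneg _ _)
  linarith

/-- The truncated half derivative of the boundary values of the heat kernel is nonnegative. -/
lemma integral_fracKer_mul_heatKer_le {ε : ℝ} (hε : 0 < ε) (t y : ℝ) :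
    Integrable (fun s => fracKer ε (t - s) * heatKer s y) ∧
    ∫ s, fracKer ε (t - s) * heatKer s y ≤ heatKer ε 0 * heatKer t y := by
  obtain ⟨h1, h2⟩ := integral_fracKer_mul_heatKer hε t
  have hi : Integrable (fun s => fracKer ε (t - s) * heatKer s y) := by
    refine h1.mono' (Measurable.aestronglyMeasurable (by fun_prop)) (ae_of_all _ fun s => ?_)
    rw [Real.norm_of_nonneg (mul_nonneg (fracKer_nonneg hε _) (heatKer_nonneg _ _))]
    exact mul_le_mul_of_nonneg_left (heatKer_le _ _) (fracKer_nonneg hε _)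
  refine ⟨hi, ?_⟩
  -- The factor `e^{-y²/(4s)}` increases with `s`, so on `(0,t)` it is at most its value `E` at `s =
  -- t`. This reduces the estimate to the exact identity at `y = 0`.
  set E := Real.exp (-y ^ 2 / (4 * t))
  calc _ ≤ ∫ s, fracKer ε (t - s) * heatKer s 0 * E := by
        refine integral_mono hi (h1.mul_const E) fun s => ?_
        by_cases hs : s ∈ Ioo 0 t
        · simp only
          rw [heatKer_eq_mul s y, mul_assoc]
          refine mul_le_mul_of_nonneg_left (mul_le_mul_of_nonneg_left ?_ (heatKer_nonneg _ _))
            (fracKer_nonneg hε _)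
          refine Real.exp_le_exp.2 ?_
          rw [neg_div, neg_div, neg_le_neg_iff]
          have := hs.1
          have := hs.2.le
          gcongr
        · simp only [fracKer_mul_heatKer_eq_zero _ hs, zero_mul, le_refl]
    _ = (heatKer ε 0 * heatKer t 0 - approxId ε t) * E := by rw [integral_mul_const, h2]
    _ ≤ heatKer ε 0 * heatKer t 0 * E := by
        have := approxId_nonneg hε t
        have := (Real.exp_pos (-y ^ 2 / (4 * t))).le
        gcongr; linarith
    _ = heatKer ε 0 * heatKer t y := by rw [heatKer_eq_mul t y, mul_assoc]

/-- The function `(2/π) arctan √t` is a primitive on `(0,∞)` and increases from `0` to `1`. -/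
lemma integral_approxId_one : Integrable (approxId 1) ∧ ∫ t, approxId 1 t = 1 := by
  have hd : ∀ t ∈ Ioi (0 : ℝ), HasDerivAt (fun t => 2 * Real.pi⁻¹ * Real.arctan (√t))
      (approxId 1 t) t := fun t ht => by
    have h0 : 0 < t := ht
    have h := ((Real.hasDerivAt_sqrt h0.ne').arctan).const_mul (2 * Real.pi⁻¹)
    refine h.congr_deriv ?_
    rw [Real.sq_sqrt h0.le, approxId]
    have : 0 < √t := Real.sqrt_pos.2 h0
    simp only [Real.sqrt_one]
    field_simp
    ring
  have hc : ContinuousWithinAt (fun t => 2 * Real.pi⁻¹ * Real.arctan (√t)) (Ici 0) 0 := by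
    have : Continuous fun t => 2 * Real.pi⁻¹ * Real.arctan (√t) := by fun_prop
    exact this.continuousWithinAt
  have hl : Tendsto (fun t => 2 * Real.pi⁻¹ * Real.arctan (√t)) atTop (𝓝 1) := by
    have h1 := (tendsto_nhds_of_tendsto_nhdsWithin Real.tendsto_arctan_atTop).comp
      Real.tendsto_sqrt_atTop
    have h2 := h1.const_mul (2 * Real.pi⁻¹)
    rwa [show 2 * Real.pi⁻¹ * (Real.pi / 2) = 1 by field_simp] at h2
  have hp : ∀ t ∈ Ioi (0 : ℝ), 0 ≤ approxId 1 t := fun t _ => approxId_nonneg one_pos t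
  have hz : ∀ t ∉ Ioi (0 : ℝ), approxId 1 t = 0 := fun t ht => approxId_of_nonpos 1 (not_lt.1 ht)
  constructor
  · refine (integrableOn_iff_integrable_of_support_subset fun s hs => ?_).1
      (integrableOn_Ioi_deriv_of_nonneg hc hd hp hl)
    by_contra hc'
    exact hs (hz s hc')
  · rw [← setIntegral_eq_integral_of_forall_compl_eq_zero hz,
      integral_Ioi_of_hasDerivAt_of_nonneg hc hd hp hl]
    simp

lemma approxId_scale {ε : ℝ} (hε : 0 < ε) (t : ℝ) : ε * approxId ε (ε * t) = approxId 1 t := by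
  rcases le_or_gt t 0 with ht | ht
  · rw [approxId_of_nonpos 1 ht, approxId_of_nonpos ε (mul_nonpos_of_nonneg_of_nonpos hε.le ht),
      mul_zero]
  · unfold approxId
    rw [Real.sqrt_mul hε.le, Real.sqrt_one]
    have q1 : 0 < √ε := Real.sqrt_pos.2 hε
    have q2 : 0 < √t := Real.sqrt_pos.2 ht
    rw [show ε * t + ε = ε * (t + 1) by ring]
    field_simp

lemma integrable_approxId {ε : ℝ} (hε : 0 < ε) : Integrable (approxId ε) := by
  have h := (integral_approxId_one.1.comp_mul_left' (inv_pos.2 hε).ne').const_mul ε⁻¹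
  refine h.congr (ae_of_all _ fun t => ?_)
  simp only
  rw [← approxId_scale hε (ε⁻¹ * t), mul_inv_cancel_left₀ hε.ne', inv_mul_cancel_left₀ hε.ne']

/-- Continuity of translations in `L¹`, tested against a bounded function. -/
lemma tendsto_integral_mul_translate {G χ : ℝ → ℝ} (hG : Integrable G)
    (hχ : Measurable χ) (hχ1 : ∀ t, |χ t| ≤ 1) :
    Tendsto (fun h => ∫ t, χ t * G (t - h)) (𝓝 0) (𝓝 (∫ t, χ t * G t)) := by
  let τ : ℝ → C(ℝ, ℝ) := fun h => ⟨fun t => t - h, by fun_prop⟩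
  have hτ : Continuous τ := ContinuousMap.continuous_of_continuous_uncurry τ (by
    change Continuous fun p : ℝ × ℝ => p.2 - p.1
    fun_prop)
  have hm : ∀ h, MeasurePreserving (τ h) volume volume := fun h => measurePreserving_sub_right _ h
  have hlim := (tendsto_const_nhds (x := hG.toL1 G) (f := 𝓝 (0 : ℝ))).compMeasurePreservingLp
    (hτ.tendsto 0) hm (hm 0) (by norm_num)
  have hdist := tendsto_iff_dist_tendsto_zero.1 hlim
  have hae : ∀ h, (Lp.compMeasurePreserving (τ h) (hm h) (hG.toL1 G) : ℝ → ℝ) =ᵐ[volume]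
      fun t => G (t - h) := fun h => by
    filter_upwards [Lp.coeFn_compMeasurePreserving (hG.toL1 G) (hm h),
      (hm h).quasiMeasurePreserving.ae hG.coeFn_toL1] with t h1 h2
    rw [h1]; exact h2
  have hd : ∀ h, dist (Lp.compMeasurePreserving (τ h) (hm h) (hG.toL1 G))
      (Lp.compMeasurePreserving (τ 0) (hm 0) (hG.toL1 G)) = ∫ t, |G (t - h) - G t| := fun h => by
    rw [L1.dist_eq_integral_dist]
    refine integral_congr_ae ?_
    filter_upwards [hae h, hae 0] with t h1 h2
    rw [h1, h2, sub_zero, Real.dist_eq]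
  simp only [hd] at hdist
  rw [tendsto_iff_dist_tendsto_zero]
  refine squeeze_zero (fun _ => dist_nonneg) (fun h => ?_) hdist
  have i : ∀ h, Integrable fun t => χ t * G (t - h) := fun h =>
    (hG.comp_sub_right h).bdd_mul (c := 1) hχ.aestronglyMeasurable (ae_of_all _ hχ1)
  have i0 : Integrable fun t => χ t * G t := by simpa using i 0
  rw [Real.dist_eq, ← integral_sub (i h) i0]
  refine abs_integral_le_integral_abs.trans (integral_mono ((i h).sub i0).abs
    ((hG.comp_sub_right h).sub hG).abs fun t => ?_)
  simp only
  rw [← mul_sub, abs_mul]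
  exact mul_le_of_le_one_left (abs_nonneg _) (hχ1 t)

/-- By scaling, the left side is an average over `r`, with weight `approxId 1 r`, of the integrals
`∫ χ(t) G(t - εr) dt`. These are bounded by `‖G‖₁` and converge by continuity of translations in
`L¹`. No regularity of `χ` is needed, so an indicator of `{d > 0}` is allowed. -/
lemma tendsto_integral_mul_approxId {G χ : ℝ → ℝ} (hGm : Measurable G) (hG : Integrable G)
    (hχ : Measurable χ) (hχ1 : ∀ t, |χ t| ≤ 1) :
    Tendsto (fun ε => ∫ t, χ t * ∫ r, approxId ε (t - r) * G r) (𝓝[>] 0)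
      (𝓝 (∫ t, χ t * G t)) := by
  have hkey : ∀ ε : ℝ, 0 < ε → ∫ t, χ t * ∫ r, approxId ε (t - r) * G r
      = ∫ r, approxId 1 r * ∫ t, χ t * G (t - ε * r) := by
    intro ε hε
    have e1 : ∀ t, ∫ r, approxId ε (t - r) * G r = ∫ r, approxId 1 r * G (t - ε * r) := fun t => by
      have h1 := integral_sub_left_eq_self (fun r => approxId ε r * G (t - r)) volume t
      simp only [sub_sub_cancel] at h1
      rw [h1]
      have h2 := Measure.integral_comp_mul_left (fun r => approxId ε r * G (t - r)) ε
      rw [abs_of_pos (inv_pos.2 hε), smul_eq_mul, eq_inv_mul_iff_mul_eq₀ hε.ne',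
        ← integral_const_mul] at h2
      rw [← h2]
      congr 1; ext r
      rw [← mul_assoc, approxId_scale hε]
    have hi : Integrable (fun p : ℝ × ℝ => χ p.2 * (approxId 1 p.1 * G (p.2 - ε * p.1)))
        (volume.prod volume) := by
      have hmeas : Measurable fun p : ℝ × ℝ => χ p.2 * (approxId 1 p.1 * G (p.2 - ε * p.1)) := by
        fun_prop
      rw [integrable_prod_iff hmeas.aestronglyMeasurable]
      refine ⟨ae_of_all _ fun r => ((hG.comp_sub_right (ε * r)).const_mul (approxId 1 r)).bdd_mul (c := 1)
        hχ.aestronglyMeasurable (ae_of_all _ hχ1), ?_⟩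
      refine Integrable.mono' (integral_approxId_one.1.mul_const (∫ t, ‖G t‖)) ?_ ?_
      · exact (hmeas.norm.stronglyMeasurable.integral_prod_right').aestronglyMeasurable
      · refine ae_of_all _ fun r => ?_
        rw [Real.norm_of_nonneg (integral_nonneg fun _ => norm_nonneg _),
          ← integral_sub_right_eq_self (fun t => ‖G t‖) (ε * r), ← integral_const_mul]
        refine integral_mono_of_nonneg (ae_of_all _ fun _ => norm_nonneg _)
          ((hG.comp_sub_right (ε * r)).norm.const_mul _) (ae_of_all _ fun t => ?_)
        simp only
        rw [norm_mul, norm_mul, Real.norm_of_nonneg (approxId_nonneg one_pos r)]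
        exact mul_le_of_le_one_left (mul_nonneg (approxId_nonneg one_pos r) (norm_nonneg _)) (hχ1 t)
    simp only [e1, ← integral_const_mul]
    rw [← integral_integral_swap (f := fun r t => χ t * (approxId 1 r * G (t - ε * r))) hi]
    congr 1; ext r; congr 1; ext t; ring
  have hb : ∀ h, |∫ t, χ t * G (t - h)| ≤ ∫ t, |G t| := fun h => by
    rw [← integral_sub_right_eq_self (fun t => |G t|) h]
    refine abs_integral_le_integral_abs.trans (integral_mono_of_nonneg
      (ae_of_all _ fun _ => abs_nonneg _) (hG.comp_sub_right h).abs (ae_of_all _ fun t => ?_))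
    simp only
    rw [abs_mul]
    exact mul_le_of_le_one_left (abs_nonneg _) (hχ1 t)
  have hlim : Tendsto (fun ε => ∫ r, approxId 1 r * ∫ t, χ t * G (t - ε * r)) (𝓝[>] 0)
      (𝓝 (∫ r, approxId 1 r * ∫ t, χ t * G t)) := by
    refine tendsto_integral_filter_of_dominated_convergence
      (fun r => approxId 1 r * ∫ t, |G t|) (Eventually.of_forall fun ε => ?_)
      (Eventually.of_forall fun ε => ae_of_all _ fun r => ?_)
      (integral_approxId_one.1.mul_const _) (ae_of_all _ fun r => ?_)
    · have h1 : Measurable fun p : ℝ × ℝ => χ p.2 * G (p.2 - ε * p.1) := by fun_prop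
      have h2 := h1.stronglyMeasurable.integral_prod_right' (ν := volume)
      exact (Measurable.mul (by fun_prop) h2.measurable).aestronglyMeasurable
    · rw [norm_mul, Real.norm_of_nonneg (approxId_nonneg one_pos r)]
      exact mul_le_mul_of_nonneg_left (hb _) (approxId_nonneg one_pos r)
    · refine Tendsto.const_mul _ ((tendsto_integral_mul_translate hG hχ hχ1).comp ?_)
      have : Tendsto (fun ε : ℝ => ε * r) (𝓝 0) (𝓝 (0 * r)) := tendsto_id.mul_const r
      rw [zero_mul] at this
      exact this.mono_left nhdsWithin_le_nhds
  rw [integral_mul_const, integral_approxId_one.2, one_mul] at hlim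
  refine hlim.congr' ?_
  filter_upwards [self_mem_nhdsWithin] with ε hε
  exact (hkey ε hε).symm

/-! ### Comparison for the Abel equation -/

section comparison

variable {T : ℝ} {M : Measure (ℝ × ℝ)} {d G : ℝ → ℝ}

lemma integrable_fracKer_prod_measure {ε t : ℝ} (hε : 0 < ε) [IsFiniteMeasure M]
    (h : Integrable (fun z => heatKer (t - z.1) z.2) M) :
    Integrable (fun q : ℝ × (ℝ × ℝ) => fracKer ε (t - q.1) * heatKer (q.1 - q.2.1) q.2.2)
      (volume.prod M) := by
  have hmeas : Measurable fun q : ℝ × (ℝ × ℝ) =>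
    fracKer ε (t - q.1) * heatKer (q.1 - q.2.1) q.2.2 := by fun_prop
  rw [integrable_prod_iff' hmeas.aestronglyMeasurable]
  have hk : ∀ z : ℝ × ℝ, Integrable (fun s => fracKer ε (t - s) * heatKer (s - z.1) z.2) ∧
      ∫ s, fracKer ε (t - s) * heatKer (s - z.1) z.2 ≤ heatKer ε 0 * heatKer (t - z.1) z.2 := by
    intro z
    obtain ⟨h1, h2⟩ := integral_fracKer_mul_heatKer_le hε (t - z.1) z.2
    have h3 := h1.comp_sub_right z.1
    simp only [sub_sub_sub_cancel_right] at h3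
    have h4 := integral_sub_right_eq_self
      (fun s => fracKer ε (t - z.1 - s) * heatKer s z.2) (μ := volume) z.1
    simp only [sub_sub_sub_cancel_right] at h4
    exact ⟨h3, h4.trans_le h2⟩
  refine ⟨ae_of_all _ fun z => (hk z).1, ?_⟩
  refine (h.const_mul (heatKer ε 0)).mono'
    (hmeas.norm.stronglyMeasurable.integral_prod_left').aestronglyMeasurable
    (ae_of_all _ fun z => ?_)
  have hn : ∀ s, ‖fracKer ε (t - s) * heatKer (s - z.1) z.2‖
      = fracKer ε (t - s) * heatKer (s - z.1) z.2 := fun s =>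
    Real.norm_of_nonneg (mul_nonneg (fracKer_nonneg hε _) (heatKer_nonneg _ _))
  simp only [hn]
  rw [Real.norm_of_nonneg (integral_nonneg fun s =>
    mul_nonneg (fracKer_nonneg hε _) (heatKer_nonneg _ _))]
  exact (hk z).2

/-- The truncated half derivative is nonnegative on the boundary trace of each heat kernel, hence on
their superposition by Fubini. -/
lemma integral_fracKer_mul_heatPotential_le {ε t : ℝ} (hε : 0 < ε) [IsFiniteMeasure M]
    (h : Integrable (fun z => heatKer (t - z.1) z.2) M) :
    Integrable (fun s => fracKer ε (t - s) * heatPotential M (s, 0)) ∧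
    ∫ s, fracKer ε (t - s) * heatPotential M (s, 0) ≤ heatKer ε 0 * heatPotential M (t, 0) := by
  have hi := integrable_fracKer_prod_measure hε h
  simp only [heatPotential_boundary, ← integral_const_mul]
  refine ⟨hi.integral_prod_left, ?_⟩
  rw [integral_integral_swap hi]
  refine integral_mono hi.integral_prod_right (h.const_mul _) fun z => ?_
  obtain ⟨-, h2⟩ := integral_fracKer_mul_heatKer_le hε (t - z.1) z.2
  have h4 := integral_sub_right_eq_self
    (fun s => fracKer ε (t - z.1 - s) * heatKer s z.2) (μ := volume) z.1
  simp only [sub_sub_sub_cancel_right] at h4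
  exact h4.trans_le h2

/-- The truncated half derivative of `k` is `approxId ε`, and it commutes with convolution by `G`.
In the limit this inverts the Abel operator. -/
lemma integral_fracKer_mul_conv {ε t : ℝ} (hε : 0 < ε) (hGm : Measurable G)
    (h : Integrable (fun r => heatKer (t - r) 0 * G r)) :
    Integrable (fun s => fracKer ε (t - s) * ∫ r, heatKer (s - r) 0 * G r) ∧
    ∫ s, fracKer ε (t - s) * ∫ r, heatKer (s - r) 0 * G r
      = heatKer ε 0 * (∫ r, heatKer (t - r) 0 * G r) - ∫ r, approxId ε (t - r) * G r := by
  have hk : ∀ r, Integrable (fun s => fracKer ε (t - s) * heatKer (s - r) 0) ∧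
      ∫ s, fracKer ε (t - s) * heatKer (s - r) 0
        = heatKer ε 0 * heatKer (t - r) 0 - approxId ε (t - r) := by
    intro r
    obtain ⟨h1, h2⟩ := integral_fracKer_mul_heatKer hε (t - r)
    have h3 := h1.comp_sub_right r
    simp only [sub_sub_sub_cancel_right] at h3
    have h4 := integral_sub_right_eq_self
      (fun s => fracKer ε (t - r - s) * heatKer s 0) (μ := volume) r
    simp only [sub_sub_sub_cancel_right] at h4
    exact ⟨h3, h4.trans h2⟩
  have hmeas : Measurable fun q : ℝ × ℝ =>
    fracKer ε (t - q.1) * (heatKer (q.1 - q.2) 0 * G q.2) := by fun_prop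
  have hi : Integrable (fun q : ℝ × ℝ => fracKer ε (t - q.1) * (heatKer (q.1 - q.2) 0 * G q.2))
      (volume.prod volume) := by
    rw [integrable_prod_iff' hmeas.aestronglyMeasurable]
    refine ⟨ae_of_all _ fun r => by simpa only [mul_assoc] using (hk r).1.mul_const (G r), ?_⟩
    refine (h.norm.const_mul (heatKer ε 0)).mono'
      (hmeas.norm.stronglyMeasurable.integral_prod_left').aestronglyMeasurable
      (ae_of_all _ fun r => ?_)
    have hn : ∀ s, ‖fracKer ε (t - s) * (heatKer (s - r) 0 * G r)‖
        = fracKer ε (t - s) * heatKer (s - r) 0 * ‖G r‖ := fun s => by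
      rw [← mul_assoc, norm_mul, Real.norm_of_nonneg
        (mul_nonneg (fracKer_nonneg hε _) (heatKer_nonneg _ _))]
    simp only [hn]
    rw [integral_mul_const, (hk r).2, norm_mul, norm_mul, norm_norm,
      Real.norm_of_nonneg (heatKer_nonneg _ _), Real.norm_of_nonneg (by
        have := approxId_le hε (t - r)
        linarith), ← mul_assoc]
    refine mul_le_mul_of_nonneg_right ?_ (norm_nonneg _)
    have := approxId_nonneg hε (t - r)
    linarith
  have hδ : Integrable fun r => approxId ε (t - r) * G r := by
    refine (h.norm.const_mul (heatKer ε 0)).mono' (Measurable.aestronglyMeasurable (by fun_prop))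
      (ae_of_all _ fun r => ?_)
    rw [norm_mul, norm_mul, Real.norm_of_nonneg (heatKer_nonneg _ _),
      Real.norm_of_nonneg (approxId_nonneg hε _), ← mul_assoc]
    exact mul_le_mul_of_nonneg_right (approxId_le hε _) (norm_nonneg _)
  simp only [← integral_const_mul]
  refine ⟨hi.integral_prod_left, ?_⟩
  rw [integral_integral_swap hi, ← integral_sub (h.const_mul _) hδ]
  congr 1; ext r
  simp only [← mul_assoc]
  rw [integral_mul_const, (hk r).2]
  ring

end comparison

section comparison

variable {T : ℝ} {M : Measure (ℝ × ℝ)} {d G : ℝ → ℝ}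

lemma integrable_heatKer_mul_prod (hT : 0 ≤ T) (hG : IntegrableOn G (Ioo 0 T)) :
    Integrable (fun q : ℝ × ℝ => heatKer (q.1 - q.2) 0 * G q.2)
      ((volume.restrict (Ioo 0 T)).prod (volume.restrict (Ioo 0 T))) := by
  have hm : AEStronglyMeasurable (fun q : ℝ × ℝ => heatKer (q.1 - q.2) 0 * G q.2)
      ((volume.restrict (Ioo 0 T)).prod (volume.restrict (Ioo 0 T))) :=
    (Measurable.aestronglyMeasurable (by fun_prop)).mul hG.aestronglyMeasurable.comp_snd
  rw [integrable_prod_iff' hm]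
  refine ⟨ae_of_all _ fun r => (integrableOn_heatKer_sub T r).mul_const (G r), ?_⟩
  refine (hG.norm.const_mul (heatKerMass T)).mono' hm.norm.prod_swap.integral_prod_right' ?_
  filter_upwards [ae_restrict_mem measurableSet_Ioo] with r hr
  rw [Real.norm_of_nonneg (integral_nonneg fun _ => norm_nonneg _)]
  simp only [norm_mul, Real.norm_of_nonneg (heatKer_nonneg _ _)]
  rw [integral_mul_const]
  refine mul_le_mul_of_nonneg_right ?_ (norm_nonneg _)
  rw [integral_eq_lintegral_of_nonneg_ae (ae_of_all _ fun _ => heatKer_nonneg _ _)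
    (Measurable.aestronglyMeasurable (by fun_prop))]
  exact ENNReal.toReal_le_of_le_ofReal (by unfold heatKerMass; positivity)
    (setLIntegral_heatKer_sub_le_mass hT hr.1.le 0)

lemma heatPotential_boundary_of_nonpos (hM : ∀ᵐ z ∂M, z ∈ testCylinder T) {t : ℝ} (ht : t ≤ 0) :
    heatPotential M (t, 0) = 0 := by
  rw [heatPotential_boundary]
  refine integral_eq_zero_of_ae ?_
  filter_upwards [hM] with z hz
  exact heatKer_of_nonpos (by linarith [hz.1.1]) _

/-- Tonelli, together with the mass bound for `fracKer ε` seen from each starting time in `(0,T)`.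
-/
lemma integral_Ioo_fracKer_conv_le {ε : ℝ} (hε : 0 < ε) (hT : 0 ≤ T) {f : ℝ → ℝ}
    (hf : Integrable f) (hf0 : ∀ t, 0 ≤ f t) (hf1 : ∀ t ∉ Ioo 0 T, f t = 0) :
    IntegrableOn (fun t => ∫ s, fracKer ε (t - s) * f s) (Ioo 0 T) ∧
    ∫ t in Ioo 0 T, ∫ s, fracKer ε (t - s) * f s
      ≤ (heatKer ε 0 - heatKer (T + ε) 0) * ∫ s, f s := by
  have hi : Integrable (fun q : ℝ × ℝ => fracKer ε (q.1 - q.2) * f q.2)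
      (volume.prod volume) := by
    have := hf.convolution_integrand (ContinuousLinearMap.lsmul ℝ ℝ).flip (integrable_fracKer hε)
    simpa using this
  have hi' : Integrable (fun q : ℝ × ℝ => fracKer ε (q.1 - q.2) * f q.2)
      ((volume.restrict (Ioo 0 T)).prod volume) :=
    hi.mono_measure (Measure.prod_mono Measure.restrict_le_self le_rfl)
  refine ⟨hi'.integral_prod_left, ?_⟩
  rw [integral_integral_swap hi', ← integral_const_mul]
  refine integral_mono hi'.integral_prod_right (hf.const_mul _) fun s => ?_
  simp only [integral_mul_const]
  by_cases hs : s ∈ Ioo 0 T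
  · exact mul_le_mul_of_nonneg_right (integral_Ioo_fracKer_sub_le hε hT hs.1.le) (hf0 s)
  · simp [hf1 s hs]

/-- The truncated half derivative obeys a discrete form of Kato's inequality: at points where `d >
0`, replacing `d` by `d⁺` under the nonnegative kernel `fracKer ε` only increases the nonlocal term.
Integrating over those points and letting `ε → 0` forces `∫ d⁺ ≤ 0`. Functions are extended by zero
outside `(0,T)` so that convolutions live on the line. -/
lemma abel_comparison_aux (hT : 0 < T) [IsFiniteMeasure M] (hM : ∀ᵐ z ∂M, z ∈ testCylinder T)
    (hdm : Measurable d) (hGm : Measurable G) (hd : Integrable d) (hG : Integrable G)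
    (hd0 : ∀ t ∉ Ioo 0 T, d t = 0) (hG0 : ∀ t ∉ Ioo 0 T, G t = 0)
    (heq : ∀ᵐ t, t ∈ Ioo 0 T → d t = -heatPotential M (t, 0) - ∫ r, heatKer (t - r) 0 * G r)
    (hsign : ∀ᵐ t, 0 < d t → 0 ≤ G t) : ∀ᵐ t, d t ≤ 0 := by
  -- For `t ≤ 0` both sides vanish by causality. The convolution with `fracKer ε` involves all times
  -- before `t`, so the equation is needed there too.
  have hlt : ∀ᵐ t, t < T → d t = -heatPotential M (t, 0) - ∫ r, heatKer (t - r) 0 * G r := by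
    filter_upwards [heq] with t ht htT
    rcases le_or_gt t 0 with h | h
    · rw [hd0 t fun h' => absurd h'.1 (not_lt.2 h), heatPotential_boundary_of_nonpos hM h]
      have : ∀ r, heatKer (t - r) 0 * G r = 0 := fun r => by
        by_cases hr : r ∈ Ioo 0 T
        · rw [heatKer_of_nonpos (by linarith [hr.1]), zero_mul]
        · rw [hG0 r hr, mul_zero]
      simp [this]
    · exact ht ⟨h, htT⟩
  have hGi : ∀ᵐ t, t ∈ Ioo 0 T → Integrable fun r => heatKer (t - r) 0 * G r := by
    have h := (integrable_heatKer_mul_prod hT.le hG.integrableOn).prod_right_ae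
    rw [ae_restrict_iff' measurableSet_Ioo] at h
    filter_upwards [h] with t ht htT
    refine (integrableOn_iff_integrable_of_support_subset fun r hr => ?_).1 (ht htT)
    by_contra hc
    exact hr (by simp only [hG0 r hc, mul_zero])
  have hMi := ae_integrable_heatKer_boundary hT.le hM
  rw [ae_restrict_iff' measurableSet_Ioo] at hMi
  -- The half derivative applied to the equation; the contribution of `M` has a sign and is dropped.
  have hpt : ∀ ε : ℝ, 0 < ε → ∀ᵐ t, t ∈ Ioo 0 T → heatKer ε 0 * d t
      ≤ (∫ s, fracKer ε (t - s) * d s) - ∫ r, approxId ε (t - r) * G r := by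
    intro ε hε
    filter_upwards [heq, hGi, hMi] with t h1 h2 h3 ht
    obtain ⟨a1, a2⟩ := integral_fracKer_mul_heatPotential_le hε (h3 ht)
    obtain ⟨b1, b2⟩ := integral_fracKer_mul_conv hε hGm (h2 ht)
    have e : ∫ s, fracKer ε (t - s) * d s
        = ∫ s, -(fracKer ε (t - s) * heatPotential M (s, 0)
          + fracKer ε (t - s) * ∫ r, heatKer (s - r) 0 * G r) := by
      refine integral_congr_ae ?_
      filter_upwards [hlt] with s hs
      rcases lt_or_ge s T with h | h
      · rw [hs h]; ring
      · rw [fracKer_of_nonpos ε (by linarith [ht.2])]; ring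
    rw [e, integral_neg, integral_add a1 b1, b2, h1 ht]
    linarith
  set dp : ℝ → ℝ := fun t => max (d t) 0 with hdp
  set χ : ℝ → ℝ := fun t => if 0 < d t then 1 else 0 with hχ
  have hχm : Measurable χ := Measurable.ite (measurableSet_lt measurable_const hdm)
    measurable_const measurable_const
  have hχ1 : ∀ t, |χ t| ≤ 1 := fun t => by
    rw [hχ]; simp only
    split_ifs <;> simp
  have hdpi : Integrable dp := hd.pos_part
  have hdp0 : ∀ t, 0 ≤ dp t := fun t => le_max_right _ _
  have hdp1 : ∀ t ∉ Ioo 0 T, dp t = 0 := fun t ht => by simp [hdp, hd0 t ht]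
  -- The divergent quantities `heatKer ε 0 * ∫ d⁺` on the two sides cancel, leaving a coefficient
  -- that stays positive as `ε → 0`.
  have hmain : ∀ ε : ℝ, 0 < ε → heatKer (T + ε) 0 * ∫ t, dp t
      ≤ -∫ t, χ t * ∫ r, approxId ε (t - r) * G r := by
    intro ε hε
    obtain ⟨c1, c2⟩ := integral_Ioo_fracKer_conv_le hε hT.le hdpi hdp0 hdp1
    have hδ : Integrable fun t => ∫ r, approxId ε (t - r) * G r := by
      have := (hG.convolution_integrand (ContinuousLinearMap.lsmul ℝ ℝ).flip
        (integrable_approxId hε)).integral_prod_left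
      simpa using this
    have hχδ : Integrable fun t => χ t * ∫ r, approxId ε (t - r) * G r :=
      hδ.bdd_mul (c := 1) hχm.aestronglyMeasurable (ae_of_all _ hχ1)
    have hfi : ∀ t, Integrable fun s => fracKer ε (t - s) := fun t =>
      (integrable_fracKer hε).comp_sub_left t
    have hb : ∀ t, |fracKer ε t| ≤ (2 * ε)⁻¹ * heatKer ε 0 := fun t => by
      rw [abs_of_nonneg (fracKer_nonneg hε t), fracKer]
      split_ifs with h
      · have := heatKer_nonneg (t + ε) 0
        have := heatKer_zero_anti hε (by linarith : ε ≤ t + ε)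
        gcongr
        linarith
      · have := heatKer_nonneg ε 0
        positivity
    have hfd : ∀ {f : ℝ → ℝ}, Integrable f → ∀ t, Integrable fun s => fracKer ε (t - s) * f s :=
      fun hf t => hf.bdd_mul (Measurable.aestronglyMeasurable (by fun_prop))
        (ae_of_all _ fun s => hb (t - s))
    have hle : ∫ t in Ioo 0 T, heatKer ε 0 * dp t ≤ ∫ t in Ioo 0 T,
        ((∫ s, fracKer ε (t - s) * dp s) - χ t * ∫ r, approxId ε (t - r) * G r) := by
      refine integral_mono_ae (hdpi.const_mul _).integrableOn (c1.sub hχδ.integrableOn) ?_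
      have hp := hpt ε hε
      rw [← ae_restrict_iff' measurableSet_Ioo] at hp
      filter_upwards [hp] with t ht
      have hmono : ∫ s, fracKer ε (t - s) * d s ≤ ∫ s, fracKer ε (t - s) * dp s :=
        integral_mono (hfd hd t) (hfd hdpi t) fun s =>
          mul_le_mul_of_nonneg_left (le_max_left _ _) (fracKer_nonneg hε _)
      have hnn : 0 ≤ ∫ s, fracKer ε (t - s) * dp s :=
        integral_nonneg fun s => mul_nonneg (fracKer_nonneg hε _) (hdp0 s)
      by_cases h : 0 < d t
      · simp only [hχ, h, if_true, one_mul]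
        rw [show dp t = d t from max_eq_left h.le]
        linarith
      · simp only [hχ, h, if_false, zero_mul, sub_zero]
        rw [show dp t = 0 from max_eq_right (not_lt.1 h), mul_zero]
        exact hnn
    rw [integral_sub c1 hχδ.integrableOn, integral_const_mul,
      setIntegral_eq_integral_of_forall_compl_eq_zero hdp1,
      setIntegral_eq_integral_of_forall_compl_eq_zero (f := fun t => χ t * _) (fun t ht => by
        simp [hχ, hd0 t ht])] at hle
    linarith
  have hlim := (tendsto_integral_mul_approxId hGm hG hχm hχ1).neg
  -- Taking `ε < T` gives `T + ε ≤ 2T`, hence a lower bound for the coefficient independent of `ε`.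
  have hge : heatKer (2 * T) 0 * ∫ t, dp t ≤ -∫ t, χ t * G t := by
    refine ge_of_tendsto hlim ?_
    filter_upwards [Ioo_mem_nhdsGT hT] with ε hε
    refine le_trans ?_ (hmain ε hε.1)
    exact mul_le_mul_of_nonneg_right (heatKer_zero_anti (by linarith [hε.1]) (by linarith [hε.2]))
      (integral_nonneg hdp0)
  have hnn : 0 ≤ ∫ t, χ t * G t := by
    refine integral_nonneg_of_ae ?_
    filter_upwards [hsign] with t ht
    by_cases h : 0 < d t
    · simpa [hχ, h] using ht h
    · simp [hχ, h]
  have hzero : ∫ t, dp t = 0 := by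
    have h1 : 0 ≤ ∫ t, dp t := integral_nonneg hdp0
    have h2 : 0 < heatKer (2 * T) 0 := heatKer_zero_pos (by positivity)
    nlinarith
  rw [integral_eq_zero_iff_of_nonneg hdp0 hdpi] at hzero
  filter_upwards [hzero] with t ht
  exact max_eq_right_iff.1 ht

/-- Comparison for the Abel equation satisfied by the boundary values. -/
theorem abel_comparison (hT : 0 < T) [IsFiniteMeasure M] (hM : ∀ᵐ z ∂M, z ∈ testCylinder T)
    (hdm : Measurable d) (hGm : Measurable G) (hd : IntegrableOn d (Ioo 0 T))
    (hG : IntegrableOn G (Ioo 0 T))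
    (heq : ∀ᵐ t ∂(volume.restrict (Ioo 0 T)),
      d t = -heatPotential M (t, 0) - ∫ r in Ioo 0 T, heatKer (t - r) 0 * G r)
    (hsign : ∀ t, 0 < d t → 0 ≤ G t) : ∀ᵐ t ∂(volume.restrict (Ioo 0 T)), d t ≤ 0 := by
  rw [ae_restrict_iff' measurableSet_Ioo] at heq ⊢
  have h := abel_comparison_aux (d := indicator (Ioo 0 T) d) (G := indicator (Ioo 0 T) G) hT hM
    (hdm.indicator measurableSet_Ioo) (hGm.indicator measurableSet_Ioo)
    (hd.integrable_indicator measurableSet_Ioo) (hG.integrable_indicator measurableSet_Ioo)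
    (fun t ht => indicator_of_notMem ht _) (fun t ht => indicator_of_notMem ht _)
    (by
      filter_upwards [heq] with t h ht
      rw [indicator_of_mem ht, h ht, ← integral_indicator measurableSet_Ioo]
      simp only [indicator_mul_right])
    (ae_of_all _ fun t ht => by
      by_cases h : t ∈ Ioo 0 T
      · rw [indicator_of_mem h] at ht ⊢
        exact hsign t ht
      · rw [indicator_of_notMem h])
  filter_upwards [h] with t h1 h2
  rwa [indicator_of_mem h2] at h1

end comparison

/-! ### First passage decomposition of the heat kernel -/

/-- The density of the first hitting time of the boundary from `x`. -/
noncomputable def hitKer (x t : ℝ) : ℝ := x / (2 * t) * heatKer t x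

@[fun_prop]
lemma Measurable.hitKer {α : Type*} [MeasurableSpace α] {f : α → ℝ} (x : ℝ) (hf : Measurable f) :
    Measurable fun a => hitKer x (f a) := by
  unfold _root_.hitKer; fun_prop

lemma hitKer_of_nonpos (x : ℝ) {t : ℝ} (ht : t ≤ 0) : hitKer x t = 0 := by
  rw [hitKer, heatKer_of_nonpos ht, mul_zero]

lemma hitKer_nonneg {x : ℝ} (hx : 0 < x) (t : ℝ) : 0 ≤ hitKer x t := by
  rcases le_or_gt t 0 with h | h
  · rw [hitKer_of_nonpos x h]
  · have := heatKer_nonneg t x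
    unfold hitKer; positivity

lemma hitKer_le {x : ℝ} (hx : 0 < x) {t a : ℝ} (ht : t ≤ a) :
    hitKer x t ≤ 16 * (√Real.pi)⁻¹ * √a / x ^ 3 := by
  rcases le_or_gt t 0 with h | h
  · rw [hitKer_of_nonpos x h]; positivity
  · have h1 : Real.exp (-x ^ 2 / (4 * t)) ≤ 32 * t ^ 2 / x ^ 4 := by
      have hz : 0 < x ^ 2 / (4 * t) := by positivity
      have h2 := Real.quadratic_le_exp_of_nonneg hz.le
      rw [neg_div, Real.exp_neg, inv_le_comm₀ (Real.exp_pos _) (by positivity)]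
      refine le_trans ?_ h2
      have : (32 * t ^ 2 / x ^ 4)⁻¹ = (x ^ 2 / (4 * t)) ^ 2 / 2 := by
        field_simp; norm_num
      rw [this]; linarith
    have h3 : 0 < √t := Real.sqrt_pos.2 h
    calc hitKer x t ≤ x / (2 * t) * ((√(Real.pi * t))⁻¹ * (32 * t ^ 2 / x ^ 4)) := by
          unfold hitKer heatKer; gcongr
      _ = 16 * (√Real.pi)⁻¹ * √t / x ^ 3 := by
          rw [Real.sqrt_mul Real.pi_pos.le]
          have e : t = √t ^ 2 := (Real.sq_sqrt h.le).symm
          generalize √t = r at *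
          subst e
          field_simp
          norm_num
      _ ≤ 16 * (√Real.pi)⁻¹ * √a / x ^ 3 := by gcongr

/-- The primitive of `e^{-r²}`. -/
noncomputable def gaussPrim (v : ℝ) : ℝ := ∫ r in (0 : ℝ)..v, Real.exp (-r ^ 2)

lemma hasDerivAt_gaussPrim (v : ℝ) : HasDerivAt gaussPrim (Real.exp (-v ^ 2)) v :=
  (Continuous.integral_hasStrictDerivAt (f := fun r : ℝ => Real.exp (-r ^ 2))
    (by fun_prop) 0 v).hasDerivAt

lemma tendsto_gaussPrim_atTop : Tendsto gaussPrim atTop (𝓝 (√Real.pi / 2)) := by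
  have h := integral_gaussian_Ioi 1
  have hi : Integrable fun x : ℝ => Real.exp (-1 * x ^ 2) := integrable_exp_neg_mul_sq one_pos
  simp only [neg_mul, one_mul, div_one] at h hi
  rw [← h]
  exact intervalIntegral_tendsto_integral_Ioi 0 hi.integrableOn tendsto_id

lemma gaussPrim_neg (v : ℝ) : gaussPrim (-v) = -gaussPrim v := by
  have h := intervalIntegral.integral_comp_neg (a := 0) (b := v)
    (f := fun r : ℝ => Real.exp (-r ^ 2))
  simp only [neg_sq, neg_zero] at h
  rw [gaussPrim, gaussPrim, h, intervalIntegral.integral_symm]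

lemma tendsto_gaussPrim_atBot : Tendsto gaussPrim atBot (𝓝 (-(√Real.pi / 2))) := by
  have := (tendsto_gaussPrim_atTop.comp tendsto_neg_atBot_atTop).neg
  refine this.congr fun v => ?_
  rw [Function.comp_apply, gaussPrim_neg, neg_neg]

lemma gaussPrim_zero : gaussPrim 0 = 0 := by simp [gaussPrim]

/-- The ratio `√s / √(t - s)`. -/
noncomputable def sqrtRatio (t s : ℝ) : ℝ := √s * (√(t - s))⁻¹

lemma hasDerivAt_sqrtRatio {t s : ℝ} (hs : s ∈ Ioo 0 t) :
    HasDerivAt (sqrtRatio t) (t / (2 * √s * (√(t - s)) ^ 3)) s := by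
  have h1 : 0 < s := hs.1
  have h2 : 0 < t - s := by linarith [hs.2]
  have d1 : HasDerivAt (fun s => √s) (1 / (2 * √s)) s := Real.hasDerivAt_sqrt h1.ne'
  have d2 : HasDerivAt (fun s => √(t - s)) (-1 / (2 * √(t - s))) s :=
    ((hasDerivAt_id s).const_sub t).sqrt h2.ne'
  have q1 : 0 < √s := Real.sqrt_pos.2 h1
  have q2 : 0 < √(t - s) := Real.sqrt_pos.2 h2
  refine (d1.mul (d2.fun_inv q2.ne')).congr_deriv ?_
  have e : t = √s ^ 2 + √(t - s) ^ 2 := by rw [Real.sq_sqrt h1.le, Real.sq_sqrt h2.le]; ring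
  generalize √(t - s) = A at *
  generalize √s = C at *
  rw [e]
  field_simp
  ring

lemma sqrtRatio_pos {t s : ℝ} (hs : s ∈ Ioo 0 t) : 0 < sqrtRatio t s :=
  mul_pos (Real.sqrt_pos.2 hs.1) (inv_pos.2 (Real.sqrt_pos.2 (by linarith [hs.2])))

/-- The primitive in `s` of `hitKer x (t - s) * heatKer s y`. -/
noncomputable def hitPrim (x y t s : ℝ) : ℝ :=
  Real.pi⁻¹ * (√t)⁻¹ * Real.exp (-(x + y) ^ 2 / (4 * t)) *
    (gaussPrim ((x * sqrtRatio t s - y * (sqrtRatio t s)⁻¹) * (2 * √t)⁻¹)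
      + Real.exp (x * y / t)
        * gaussPrim ((x * sqrtRatio t s + y * (sqrtRatio t s)⁻¹) * (2 * √t)⁻¹))

/-- With `r = √(s/(t-s))` the exponent `x²/(t-s) + y²/s` equals both `((x+y)² + (xr - y/r)²)/t` and
`((x-y)² + (xr + y/r)²)/t`. Summing the two Gaussian primitives makes the inner derivatives `x +
y/r²` and `x - y/r²` add up to `2x`, which leaves exactly the required integrand. -/
lemma hasDerivAt_hitPrim {x y t s : ℝ} (hs : s ∈ Ioo 0 t) :
    HasDerivAt (hitPrim x y t) (hitKer x (t - s) * heatKer s y) s := by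
  have h1 : 0 < s := hs.1
  have h2 : 0 < t - s := by linarith [hs.2]
  have h3 : 0 < t := h1.trans hs.2
  have hr := hasDerivAt_sqrtRatio hs
  have hr0 := sqrtRatio_pos hs
  have hri := hr.fun_inv hr0.ne'
  have dm := (((hr.const_mul x).fun_sub (hri.const_mul y)).mul_const (2 * √t)⁻¹)
  have dp := (((hr.const_mul x).fun_add (hri.const_mul y)).mul_const (2 * √t)⁻¹)
  have gm := (hasDerivAt_gaussPrim _).comp s dm
  have gp := (hasDerivAt_gaussPrim _).comp s dp
  refine ((gm.add (gp.const_mul (Real.exp (x * y / t)))).const_mul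
    (Real.pi⁻¹ * (√t)⁻¹ * Real.exp (-(x + y) ^ 2 / (4 * t)))).congr_deriv ?_
  have q1 : 0 < √s := Real.sqrt_pos.2 h1
  have q2 : 0 < √(t - s) := Real.sqrt_pos.2 h2
  have q3 : 0 < √t := Real.sqrt_pos.2 h3
  have e1 : √s ^ 2 = s := Real.sq_sqrt h1.le
  have e2 : √(t - s) ^ 2 = t - s := Real.sq_sqrt h2.le
  have e3 : √t ^ 2 = t := Real.sq_sqrt h3.le
  -- The two ways of completing the square differ by `4xy`; the weight `e^{xy/t}` on the second
  -- primitive compensates for this.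
  have hexp : Real.exp (x * y / t) * Real.exp (-((x * sqrtRatio t s + y * (sqrtRatio t s)⁻¹)
      * (2 * √t)⁻¹) ^ 2) = Real.exp (-((x * sqrtRatio t s - y * (sqrtRatio t s)⁻¹)
      * (2 * √t)⁻¹) ^ 2) := by
    rw [← Real.exp_add]
    congr 1
    rw [mul_pow, mul_pow, inv_pow, mul_pow, e3]
    field_simp
    ring
  have hexp2 : Real.exp (-(x + y) ^ 2 / (4 * t)) * Real.exp (-((x * sqrtRatio t s
      - y * (sqrtRatio t s)⁻¹) * (2 * √t)⁻¹) ^ 2)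
      = Real.exp (-x ^ 2 / (4 * (t - s))) * Real.exp (-y ^ 2 / (4 * s)) := by
    rw [← Real.exp_add, ← Real.exp_add]
    congr 1
    rw [mul_pow, inv_pow, mul_pow, e3]
    have e4 : (x * sqrtRatio t s - y * (sqrtRatio t s)⁻¹) ^ 2
        = x ^ 2 * (s / (t - s)) - 2 * x * y + y ^ 2 * ((t - s) / s) := by
      have a1 : sqrtRatio t s ^ 2 = s / (t - s) := by
        rw [sqrtRatio, mul_pow, inv_pow, e1, e2, div_eq_mul_inv]
      have a2 : (sqrtRatio t s)⁻¹ ^ 2 = (t - s) / s := by rw [inv_pow, a1, inv_div]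
      have a3 : sqrtRatio t s * (sqrtRatio t s)⁻¹ = 1 := mul_inv_cancel₀ hr0.ne'
      rw [← a1, ← a2]
      linear_combination (-2 * x * y) * a3
    rw [e4]
    field_simp
    ring
  have hfac : hitKer x (t - s) * heatKer s y = x / (2 * (t - s)) *
      (Real.pi⁻¹ * (√(t - s))⁻¹ * (√s)⁻¹) * (Real.exp (-x ^ 2 / (4 * (t - s)))
        * Real.exp (-y ^ 2 / (4 * s))) := by
    rw [← inv_sqrt_pi_mul_mul, ← Real.sqrt_mul Real.pi_pos.le, ← Real.sqrt_mul Real.pi_pos.le]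
    unfold hitKer heatKer
    ring
  rw [hfac, ← hexp2, mul_add, ← mul_assoc (Real.exp (x * y / t)), hexp]
  generalize Real.exp (-((x * sqrtRatio t s - y * (sqrtRatio t s)⁻¹) * (2 * √t)⁻¹) ^ 2) = E
  generalize Real.exp (-(x + y) ^ 2 / (4 * t)) = F
  generalize sqrtRatio t s = r at *
  generalize √(t - s) = A at *
  generalize √s = C at *
  generalize √t = D at *
  rw [← e2, ← e3]
  field_simp
  ring

lemma tendsto_sqrtRatio_left {t : ℝ} (ht : 0 < t) :
    Tendsto (sqrtRatio t) (𝓝[>] 0) (𝓝[>] 0) := by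
  refine tendsto_nhdsWithin_iff.2 ⟨?_, ?_⟩
  · have hc : ContinuousAt (sqrtRatio t) 0 := by
      unfold sqrtRatio
      refine ContinuousAt.mul (by fun_prop) (ContinuousAt.inv₀ (by fun_prop) ?_)
      simpa using (Real.sqrt_pos.2 ht).ne'
    have := hc.tendsto
    rw [show sqrtRatio t 0 = 0 by simp [sqrtRatio]] at this
    exact this.mono_left nhdsWithin_le_nhds
  · filter_upwards [Ioo_mem_nhdsGT ht] with s hs using sqrtRatio_pos hs

lemma tendsto_sqrtRatio_right {t : ℝ} (ht : 0 < t) :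
    Tendsto (sqrtRatio t) (𝓝[<] t) atTop := by
  unfold sqrtRatio
  have h1 : Tendsto (fun s : ℝ => √s) (𝓝[<] t) (𝓝 (√t)) :=
    (Real.continuous_sqrt.tendsto t).mono_left nhdsWithin_le_nhds
  refine h1.pos_mul_atTop (Real.sqrt_pos.2 ht) (tendsto_inv_nhdsGT_zero.comp ?_)
  refine tendsto_nhdsWithin_iff.2 ⟨?_, ?_⟩
  · have : Continuous fun s => √(t - s) := by fun_prop
    have := this.tendsto t
    simp only [sub_self, Real.sqrt_zero] at this
    exact this.mono_left nhdsWithin_le_nhds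
  · filter_upwards [self_mem_nhdsWithin] with s hs
    exact Real.sqrt_pos.2 (sub_pos.2 hs)

lemma tendsto_hitPrim_right {x y t : ℝ} (hx : 0 < x) (ht : 0 < t) :
    Tendsto (hitPrim x y t) (𝓝[<] t) (𝓝 (Real.pi⁻¹ * (√t)⁻¹ * Real.exp (-(x + y) ^ 2 / (4 * t)) *
      (√Real.pi / 2 + Real.exp (x * y / t) * (√Real.pi / 2)))) := by
  have hc : 0 < (2 * √t)⁻¹ := by positivity
  have h1 : Tendsto (fun s => x * sqrtRatio t s) (𝓝[<] t) atTop :=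
    (tendsto_sqrtRatio_right ht).const_mul_atTop hx
  have h2 : Tendsto (fun s => y * (sqrtRatio t s)⁻¹) (𝓝[<] t) (𝓝 (y * 0)) :=
    (tendsto_inv_atTop_zero.comp (tendsto_sqrtRatio_right ht)).const_mul y
  have h3 := (h1.atTop_add h2.neg).atTop_mul_const hc
  have h4 := (h1.atTop_add h2).atTop_mul_const hc
  exact Tendsto.const_mul _ ((tendsto_gaussPrim_atTop.comp
    (by simpa only [sub_eq_add_neg] using h3)).add
    ((tendsto_gaussPrim_atTop.comp h4).const_mul _))

/-- As `r → 0` the two arguments tend to `-∞` and `+∞` if `y > 0`, but both tend to `0` if `y = 0`.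
The same formula covers the second case, because then its two terms cancel. -/
lemma tendsto_hitPrim_left {x y t : ℝ} (hy : 0 ≤ y) (ht : 0 < t) :
    Tendsto (hitPrim x y t) (𝓝[>] 0) (𝓝 (Real.pi⁻¹ * (√t)⁻¹ * Real.exp (-(x + y) ^ 2 / (4 * t)) *
      (-(√Real.pi / 2) + Real.exp (x * y / t) * (√Real.pi / 2)))) := by
  have hc : 0 < (2 * √t)⁻¹ := by positivity
  have h0 : Tendsto (sqrtRatio t) (𝓝[>] 0) (𝓝 0) :=
    tendsto_nhds_of_tendsto_nhdsWithin (tendsto_sqrtRatio_left ht)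
  have h1 : Tendsto (fun s => x * sqrtRatio t s) (𝓝[>] 0) (𝓝 (x * 0)) := h0.const_mul x
  rcases hy.eq_or_lt with rfl | hy
  · have h2 : Tendsto (fun s => gaussPrim (x * sqrtRatio t s * (2 * √t)⁻¹)) (𝓝[>] 0) (𝓝 0) := by
      have h3 := h1.mul_const (2 * √t)⁻¹
      rw [mul_zero, zero_mul] at h3
      have h4 := (hasDerivAt_gaussPrim 0).continuousAt.tendsto.comp h3
      rwa [gaussPrim_zero] at h4
    have h5 := (h2.add h2).const_mul (Real.pi⁻¹ * (√t)⁻¹ * Real.exp (-(x + 0) ^ 2 / (4 * t)))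
    unfold hitPrim
    simp only [mul_zero, zero_mul, zero_div, Real.exp_zero, one_mul, sub_zero, add_zero,
      neg_add_cancel] at h5 ⊢
    exact h5
  · have h2 : Tendsto (fun s => y * (sqrtRatio t s)⁻¹) (𝓝[>] 0) atTop :=
      (tendsto_inv_nhdsGT_zero.comp (tendsto_sqrtRatio_left ht)).const_mul_atTop hy
    have h2' : Tendsto (fun s => -(y * (sqrtRatio t s)⁻¹)) (𝓝[>] 0) atBot :=
      tendsto_neg_atTop_atBot.comp h2
    have h3 := (h1.add_atBot h2').atBot_mul_const hc
    have h4 := (h1.add_atTop h2).atTop_mul_const hc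
    exact Tendsto.const_mul _ ((tendsto_gaussPrim_atBot.comp
      (by simpa only [sub_eq_add_neg] using h3)).add
      ((tendsto_gaussPrim_atTop.comp h4).const_mul _))

lemma hitKer_mul_heatKer_eq_zero {x t s : ℝ} (y : ℝ) (hs : s ∉ Ioo 0 t) :
    hitKer x (t - s) * heatKer s y = 0 := by
  rcases le_or_gt s 0 with h | h
  · rw [heatKer_of_nonpos h, mul_zero]
  · have : t ≤ s := not_lt.1 fun h' => hs ⟨h, h'⟩
    rw [hitKer_of_nonpos x (sub_nonpos.2 this), zero_mul]

/-- The first passage decomposition of the heat kernel. -/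
lemma integral_hitKer_mul_heatKer {x y : ℝ} (hx : 0 < x) (hy : 0 ≤ y) (t : ℝ) :
    Integrable (fun s => hitKer x (t - s) * heatKer s y) ∧
    ∫ s, hitKer x (t - s) * heatKer s y = heatKer t (x + y) := by
  rcases le_or_gt t 0 with ht | ht
  · have : (fun s => hitKer x (t - s) * heatKer s y) = fun _ => 0 := funext fun s =>
      hitKer_mul_heatKer_eq_zero y (by simp [ht])
    rw [this]
    simp [heatKer_of_nonpos ht]
  have h1 : IntegrableOn (fun s => hitKer x (t - s) * heatKer s y) (Ioc 0 t) := by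
    refine Integrable.mono' (((integrableOn_heatKer_zero t).mono_set Ioc_subset_Iic_self).const_mul
      (16 * (√Real.pi)⁻¹ * √t / x ^ 3)) (Measurable.aestronglyMeasurable (by fun_prop)) ?_
    filter_upwards [ae_restrict_mem measurableSet_Ioc] with s hs
    rw [Real.norm_of_nonneg (mul_nonneg (hitKer_nonneg hx _) (heatKer_nonneg _ _))]
    exact mul_le_mul (hitKer_le hx (by linarith [hs.1])) (heatKer_le _ _) (heatKer_nonneg _ _)
      (by positivity)
  have h2 : ∫ s in Ioo 0 t, hitKer x (t - s) * heatKer s y = heatKer t (x + y) := by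
    rw [← integral_Ioc_eq_integral_Ioo, ← intervalIntegral.integral_of_le ht.le,
      intervalIntegral.integral_eq_sub_of_hasDerivAt_of_tendsto ht
        (fun s hs => hasDerivAt_hitPrim hs)
        ((intervalIntegrable_iff_integrableOn_Ioc_of_le ht.le).2 h1) (tendsto_hitPrim_left hy ht)
        (tendsto_hitPrim_right hx ht)]
    rw [heatKer, Real.sqrt_mul Real.pi_pos.le, mul_inv]
    have e : √Real.pi ^ 2 = Real.pi := Real.sq_sqrt Real.pi_pos.le
    have e2 : Real.pi⁻¹ = (√Real.pi)⁻¹ * (√Real.pi)⁻¹ := by rw [← mul_inv, ← sq, e]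
    have e3 : (√Real.pi)⁻¹ * √Real.pi = 1 := inv_mul_cancel₀ (Real.sqrt_pos.2 Real.pi_pos).ne'
    rw [e2]
    linear_combination ((√Real.pi)⁻¹ * (√t)⁻¹ * Real.exp (-(x + y) ^ 2 / (4 * t))) * e3
  refine ⟨(integrableOn_iff_integrable_of_support_subset fun s hs => ?_).1
    (h1.mono_set Ioo_subset_Ioc_self), ?_⟩
  · by_contra hc
    exact hs (hitKer_mul_heatKer_eq_zero y hc)
  · rw [← h2, setIntegral_eq_integral_of_forall_compl_eq_zero]
    exact fun s hs => hitKer_mul_heatKer_eq_zero y hs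

/-! ### Passing from boundary order to interior order -/

section interior

variable {T : ℝ} {M : Measure (ℝ × ℝ)} {G : ℝ → ℝ}

lemma integral_hitKer_mul_heatKer_sub {x y : ℝ} (hx : 0 < x) (hy : 0 ≤ y) (t r : ℝ) :
    Integrable (fun s => hitKer x (t - s) * heatKer (s - r) y) ∧
    ∫ s, hitKer x (t - s) * heatKer (s - r) y = heatKer (t - r) (x + y) := by
  obtain ⟨h1, h2⟩ := integral_hitKer_mul_heatKer hx hy (t - r)
  have h3 := h1.comp_sub_right r
  simp only [sub_sub_sub_cancel_right] at h3
  have h4 := integral_sub_right_eq_self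
    (fun s => hitKer x (t - r - s) * heatKer s y) (μ := volume) r
  simp only [sub_sub_sub_cancel_right] at h4
  exact ⟨h3, h4.trans h2⟩

/-- Fubini and the first passage identity applied to each pole. The result carries the kernel at `x
+ z.2`, the part of the heat that has touched the boundary before returning to `x`. -/
lemma integral_hitKer_mul_heatPotential {x t : ℝ} (hx : 0 < x) [IsFiniteMeasure M]
    (hM : ∀ᵐ z ∂M, z ∈ testCylinder T) (h : Integrable (fun z => heatKer (t - z.1) z.2) M) :
    Integrable (fun z => heatKer (t - z.1) (x + z.2)) M ∧
    Integrable (fun s => hitKer x (t - s) * heatPotential M (s, 0)) ∧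
    ∫ s, hitKer x (t - s) * heatPotential M (s, 0) = ∫ z, heatKer (t - z.1) (x + z.2) ∂M := by
  have hmeas : Measurable fun q : ℝ × (ℝ × ℝ) =>
    hitKer x (t - q.1) * heatKer (q.1 - q.2.1) q.2.2 := by fun_prop
  have hxi : Integrable (fun z => heatKer (t - z.1) (x + z.2)) M := by
    refine h.mono' (Measurable.aestronglyMeasurable (by fun_prop)) ?_
    filter_upwards [hM] with z hz
    rw [Real.norm_of_nonneg (heatKer_nonneg _ _)]
    have : 0 ≤ z.2 := hz.2
    exact heatKer_anti _ (pow_le_pow_left₀ this (by linarith) 2)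
  have hi : Integrable (fun q : ℝ × (ℝ × ℝ) => hitKer x (t - q.1) * heatKer (q.1 - q.2.1) q.2.2)
      (volume.prod M) := by
    rw [integrable_prod_iff' hmeas.aestronglyMeasurable]
    refine ⟨?_, hxi.congr ?_⟩
    · filter_upwards [hM] with z hz using (integral_hitKer_mul_heatKer_sub hx hz.2 t z.1).1
    · filter_upwards [hM] with z hz
      have hn : ∀ s, ‖hitKer x (t - s) * heatKer (s - z.1) z.2‖
          = hitKer x (t - s) * heatKer (s - z.1) z.2 := fun s =>
        Real.norm_of_nonneg (mul_nonneg (hitKer_nonneg hx _) (heatKer_nonneg _ _))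
      simp only [hn]
      exact (integral_hitKer_mul_heatKer_sub hx hz.2 t z.1).2.symm
  simp only [heatPotential_boundary, ← integral_const_mul]
  refine ⟨hxi, hi.integral_prod_left, ?_⟩
  rw [integral_integral_swap hi]
  refine integral_congr_ae ?_
  filter_upwards [hM] with z hz using (integral_hitKer_mul_heatKer_sub hx hz.2 t z.1).2

lemma integral_hitKer_mul_conv {x t : ℝ} (hx : 0 < x) (hGm : Measurable G)
    (h : Integrable (fun r => heatKer (t - r) 0 * G r)) :
    Integrable (fun s => hitKer x (t - s) * ∫ r, heatKer (s - r) 0 * G r) ∧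
    ∫ s, hitKer x (t - s) * ∫ r, heatKer (s - r) 0 * G r = ∫ r, heatKer (t - r) x * G r := by
  have hk := fun r => integral_hitKer_mul_heatKer_sub hx le_rfl t r
  simp only [add_zero] at hk
  have hmeas : Measurable fun q : ℝ × ℝ =>
    hitKer x (t - q.1) * (heatKer (q.1 - q.2) 0 * G q.2) := by fun_prop
  have hi : Integrable (fun q : ℝ × ℝ => hitKer x (t - q.1) * (heatKer (q.1 - q.2) 0 * G q.2))
      (volume.prod volume) := by
    rw [integrable_prod_iff' hmeas.aestronglyMeasurable]
    refine ⟨ae_of_all _ fun r => by simpa only [mul_assoc] using (hk r).1.mul_const (G r), ?_⟩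
    refine h.norm.mono' (hmeas.norm.stronglyMeasurable.integral_prod_left').aestronglyMeasurable
      (ae_of_all _ fun r => ?_)
    have hn : ∀ s, ‖hitKer x (t - s) * (heatKer (s - r) 0 * G r)‖
        = hitKer x (t - s) * heatKer (s - r) 0 * ‖G r‖ := fun s => by
      rw [← mul_assoc, norm_mul, Real.norm_of_nonneg
        (mul_nonneg (hitKer_nonneg hx _) (heatKer_nonneg _ _))]
    simp only [hn]
    rw [integral_mul_const, (hk r).2, norm_mul, norm_mul, norm_norm,
      Real.norm_of_nonneg (heatKer_nonneg _ _), Real.norm_of_nonneg (heatKer_nonneg _ _)]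
    exact mul_le_mul_of_nonneg_right (heatKer_le _ _) (norm_nonneg _)
  simp only [← integral_const_mul]
  refine ⟨hi.integral_prod_left, ?_⟩
  rw [integral_integral_swap hi]
  congr 1; ext r
  simp only [← mul_assoc]
  rw [integral_mul_const, (hk r).2]

/-- Convolving the nonnegative boundary values with the nonnegative hitting density reproduces the
flux term exactly. It reproduces the potential of `M` only up to a nonnegative remainder, the heat
that reaches `x` without touching the boundary. -/
lemma interior_comparison_aux (hT : 0 < T) [IsFiniteMeasure M] (hM : ∀ᵐ z ∂M, z ∈ testCylinder T)
    (hGm : Measurable G) (hG : Integrable G) (hG0 : ∀ t ∉ Ioo 0 T, G t = 0)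
    (h : ∀ᵐ t, t ∈ Ioo 0 T → 0 ≤ heatPotential M (t, 0) + ∫ r, heatKer (t - r) 0 * G r) :
    ∀ᵐ p ∂(volume.restrict (openCylinder T)),
      0 ≤ heatPotential M p + ∫ r, heatKer (p.1 - r) p.2 * G r := by
  have hlt : ∀ᵐ t, t < T → 0 ≤ heatPotential M (t, 0) + ∫ r, heatKer (t - r) 0 * G r := by
    filter_upwards [h] with t ht htT
    rcases le_or_gt t 0 with h | h
    · rw [heatPotential_boundary_of_nonpos hM h]
      have : ∀ r, heatKer (t - r) 0 * G r = 0 := fun r => by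
        by_cases hr : r ∈ Ioo 0 T
        · rw [heatKer_of_nonpos (by linarith [hr.1]), zero_mul]
        · rw [hG0 r hr, mul_zero]
      simp [this]
    · exact ht ⟨h, htT⟩
  have hGi : ∀ᵐ t ∂(volume.restrict (Ioo 0 T)), Integrable fun r => heatKer (t - r) 0 * G r := by
    filter_upwards [(integrable_heatKer_mul_prod hT.le hG.integrableOn).prod_right_ae] with t ht
    refine (integrableOn_iff_integrable_of_support_subset fun r hr => ?_).1 ht
    by_contra hc
    exact hr (by simp only [hG0 r hc, mul_zero])
  have hboth := (ae_integrable_heatKer_boundary hT.le hM).and hGi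
  have hboth' : ∀ᵐ p ∂(volume.restrict (openCylinder T)),
      Integrable (fun z => heatKer (p.1 - z.1) z.2) M ∧
        Integrable fun r => heatKer (p.1 - r) 0 * G r := by
    rw [openCylinder, Measure.volume_eq_prod, ← Measure.prod_restrict]
    exact Measure.quasiMeasurePreserving_fst.ae hboth
  filter_upwards [hboth', ae_integrable_neumannKer (M := M),
    ae_restrict_mem (measurableSet_openCylinder T)] with p hp hn hpm
  have hx : 0 < p.2 := hpm.2
  obtain ⟨a1, a2, a3⟩ := integral_hitKer_mul_heatPotential hx hM hp.1
  obtain ⟨b1, b2⟩ := integral_hitKer_mul_conv hx hGm hp.2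
  have e1 : 0 ≤ ∫ s, (hitKer p.2 (p.1 - s) * heatPotential M (s, 0)
      + hitKer p.2 (p.1 - s) * ∫ r, heatKer (s - r) 0 * G r) := by
    refine integral_nonneg_of_ae ?_
    filter_upwards [hlt] with s hs
    rw [← mul_add]
    rcases lt_or_ge s T with h | h
    · exact mul_nonneg (hitKer_nonneg hx _) (hs h)
    · rw [hitKer_of_nonpos _ (by linarith [hpm.1.2]), zero_mul]; exact le_rfl
  rw [integral_add a2 b1, a3, b2] at e1
  -- The remainder is half of `H(x - y) - H(x + y)`, nonnegative because `|x - y| ≤ x + y` for `x, y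
  -- ≥ 0`.
  refine e1.trans (add_le_add_left ?_ _)
  refine integral_mono_ae a1 hn ?_
  filter_upwards [hM] with z hz
  have hz2 : 0 ≤ z.2 := hz.2
  have := heatKer_anti (x := p.2 - z.2) (y := p.2 + z.2) (p.1 - z.1) (by nlinarith)
  unfold neumannKer
  linarith

/-- Nonnegative boundary values force a nonnegative solution in the interior. -/
theorem interior_comparison (hT : 0 < T) [IsFiniteMeasure M] (hM : ∀ᵐ z ∂M, z ∈ testCylinder T)
    (hGm : Measurable G) (hG : IntegrableOn G (Ioo 0 T))
    (h : ∀ᵐ t ∂(volume.restrict (Ioo 0 T)),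
      0 ≤ heatPotential M (t, 0) + ∫ r in Ioo 0 T, heatKer (t - r) 0 * G r) :
    ∀ᵐ p ∂(volume.restrict (openCylinder T)),
      0 ≤ heatPotential M p + ∫ r in Ioo 0 T, heatKer (p.1 - r) p.2 * G r := by
  have e : ∀ t x : ℝ, ∫ r in Ioo 0 T, heatKer (t - r) x * G r
      = ∫ r, heatKer (t - r) x * indicator (Ioo 0 T) G r := fun t x => by
    rw [← integral_indicator measurableSet_Ioo]
    simp only [indicator_mul_right]
  simp only [e] at h ⊢
  rw [ae_restrict_iff' measurableSet_Ioo] at h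
  exact interior_comparison_aux hT hM (hGm.indicator measurableSet_Ioo)
    (hG.integrable_indicator measurableSet_Ioo) (fun t ht => indicator_of_notMem ht _) h

end interior

/-! ### The Abel equation: order, Lipschitz existence, limits -/

/-- `h` solves the Abel equation `h = f - k * g(h)` on `(0,T)`, with `k(t) = (πt)^{-1/2}`. -/
structure AbelSolution (T : ℝ) (f g h : ℝ → ℝ) : Prop where
  measurable : Measurable h
  integrableOn : IntegrableOn h (Ioo 0 T)
  integrableOn_flux : IntegrableOn (fun t => g (h t)) (Ioo 0 T)
  eq : ∀ᵐ t ∂(volume.restrict (Ioo 0 T)), h t = f t - ∫ r in Ioo 0 T, heatKer (t - r) 0 * g (h r)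

section abel

variable {T : ℝ}

/-- The difference `d = h - h'` satisfies `d = -P_N - k * (g(h) - g'(h'))`, the form treated by
`abel_comparison`. Allowing two nonlinearities serves both to compare successive approximations of
`g` and to compare with the linear problem. -/
lemma AbelSolution.le (hT : 0 < T) {N : Measure (ℝ × ℝ)} [IsFiniteMeasure N]
    (hN : ∀ᵐ z ∂N, z ∈ testCylinder T) {f f' g g' h h' : ℝ → ℝ} (hg : Measurable g)
    (hg' : Measurable g') (hh : AbelSolution T f g h) (hh' : AbelSolution T f' g' h')
    (hf : ∀ᵐ t ∂(volume.restrict (Ioo 0 T)), f t = f' t - heatPotential N (t, 0))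
    (hs : ∀ t, h' t < h t → g' (h' t) ≤ g (h t)) :
    ∀ᵐ t ∂(volume.restrict (Ioo 0 T)), h t ≤ h' t := by
  have i1 := (integrable_heatKer_mul_prod hT.le hh.integrableOn_flux).prod_right_ae
  have i2 := (integrable_heatKer_mul_prod hT.le hh'.integrableOn_flux).prod_right_ae
  have key := abel_comparison (d := fun t => h t - h' t) (G := fun t => g (h t) - g' (h' t)) hT hN
    (hh.measurable.sub hh'.measurable)
    ((hg.comp hh.measurable).sub (hg'.comp hh'.measurable))
    (hh.integrableOn.sub hh'.integrableOn) (hh.integrableOn_flux.sub hh'.integrableOn_flux) ?_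
    fun t ht => sub_nonneg.2 (hs t (sub_pos.1 ht))
  · filter_upwards [key] with t ht using sub_nonpos.1 ht
  · filter_upwards [hh.eq, hh'.eq, hf, i1, i2] with t e1 e2 e3 j1 j2
    simp only [mul_sub]
    rw [integral_sub j1 j2, e1, e2, e3]
    ring

/-- Young's inequality in `L¹(0,T)` for the weighted kernel `e^{-cτ} k(τ)`, whose mass is at most
`q`. -/
lemma abs_integral_heatKer_mul_le (hT : 0 ≤ T) {c q : ℝ} {φ : ℝ → ℝ}
    (hφ : IntegrableOn φ (Ioo 0 T)) (hc : 0 ≤ c)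
    (hq : ∫ τ in Iic T, Real.exp (-(c * τ)) * heatKer τ 0 ≤ q) :
    Integrable (fun p : ℝ × ℝ => Real.exp (-(c * (p.1 - p.2))) * heatKer (p.1 - p.2) 0 * φ p.2)
      ((volume.restrict (Ioo 0 T)).prod (volume.restrict (Ioo 0 T))) ∧
    ∫ t in Ioo 0 T, |∫ r in Ioo 0 T, Real.exp (-(c * (t - r))) * heatKer (t - r) 0 * φ r|
      ≤ q * ∫ r in Ioo 0 T, |φ r| := by
  have hle : ∀ τ, Real.exp (-(c * τ)) * heatKer τ 0 ≤ heatKer τ 0 := fun τ => by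
    rcases le_or_gt τ 0 with h | h
    · simp [heatKer_of_nonpos h]
    · refine mul_le_of_le_one_left (heatKer_nonneg _ _) (Real.exp_le_one_iff.2 ?_)
      have := mul_nonneg hc h.le
      linarith
  have hnn : ∀ τ, 0 ≤ Real.exp (-(c * τ)) * heatKer τ 0 := fun τ =>
    mul_nonneg (Real.exp_pos _).le (heatKer_nonneg _ _)
  have hi : Integrable
      (fun p : ℝ × ℝ => Real.exp (-(c * (p.1 - p.2))) * heatKer (p.1 - p.2) 0 * φ p.2)
      ((volume.restrict (Ioo 0 T)).prod (volume.restrict (Ioo 0 T))) := by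
    refine (integrable_heatKer_mul_prod hT hφ).mono
      ((Measurable.aestronglyMeasurable (by fun_prop)).mul hφ.aestronglyMeasurable.comp_snd)
      (ae_of_all _ fun p => ?_)
    rw [norm_mul _ (φ p.2), norm_mul _ (φ p.2), Real.norm_of_nonneg (hnn _),
      Real.norm_of_nonneg (heatKer_nonneg _ _)]
    exact mul_le_mul_of_nonneg_right (hle _) (norm_nonneg _)
  refine ⟨hi, ?_⟩
  calc _ ≤ ∫ t in Ioo 0 T, ∫ r in Ioo 0 T,
        |Real.exp (-(c * (t - r))) * heatKer (t - r) 0 * φ r| :=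
        integral_mono hi.integral_prod_left.abs hi.norm.integral_prod_left
          fun t => abs_integral_le_integral_abs
    _ = ∫ r in Ioo 0 T, ∫ t in Ioo 0 T,
        |Real.exp (-(c * (t - r))) * heatKer (t - r) 0 * φ r| := integral_integral_swap hi.norm
    _ ≤ ∫ r in Ioo 0 T, q * |φ r| := by
        refine integral_mono_ae hi.norm.integral_prod_right (hφ.abs.const_mul q) ?_
        filter_upwards [ae_restrict_mem measurableSet_Ioo] with r hr
        simp only [abs_mul _ (φ r), abs_of_nonneg (hnn _)]
        rw [integral_mul_const]
        refine mul_le_mul_of_nonneg_right (le_trans ?_ hq) (abs_nonneg _)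
        have hi0 : IntegrableOn (fun τ => Real.exp (-(c * τ)) * heatKer τ 0) (Iic T) :=
          (integrableOn_heatKer_zero T).mono' (Measurable.aestronglyMeasurable (by fun_prop))
            (ae_of_all _ fun τ => by rw [Real.norm_of_nonneg (hnn τ)]; exact hle τ)
        rw [← integral_indicator measurableSet_Ioo, ← integral_indicator measurableSet_Iic,
          ← integral_sub_right_eq_self (indicator (Iic T) _) r]
        refine integral_mono_of_nonneg (ae_of_all _ fun t => indicator_nonneg (fun _ _ => hnn _) _)
          ((hi0.integrable_indicator measurableSet_Iic).comp_sub_right r) (ae_of_all _ fun t => ?_)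
        by_cases h : t ∈ Ioo 0 T
        · simp only
          rw [indicator_of_mem h, indicator_of_mem (by simp; linarith [h.2, hr.1])]
        · simp only
          rw [indicator_of_notMem h]
          exact indicator_nonneg (fun _ _ => hnn _) _
    _ = _ := integral_const_mul _ _

lemma exists_exp_weight (T : ℝ) {η : ℝ} (hη : 0 < η) : ∃ c : ℝ, 0 ≤ c ∧
    ∫ τ in Iic T, Real.exp (-(c * τ)) * heatKer τ 0 ≤ η := by
  have h : Tendsto (fun n : ℕ => ∫ τ in Iic T, Real.exp (-(n * τ)) * heatKer τ 0) atTop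
      (𝓝 (∫ τ in Iic T, (0 : ℝ))) := by
    refine tendsto_integral_of_dominated_convergence (fun τ => heatKer τ 0)
      (fun n => Measurable.aestronglyMeasurable (by fun_prop)) (integrableOn_heatKer_zero T)
      (fun n => ae_of_all _ fun τ => ?_) (ae_of_all _ fun τ => ?_)
    · rw [Real.norm_of_nonneg (mul_nonneg (Real.exp_pos _).le (heatKer_nonneg _ _))]
      rcases le_or_gt τ 0 with h | h
      · simp [heatKer_of_nonpos h]
      · refine mul_le_of_le_one_left (heatKer_nonneg _ _) (Real.exp_le_one_iff.2 ?_)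
        have : (0 : ℝ) ≤ n * τ := by positivity
        linarith
    · rcases le_or_gt τ 0 with h | h
      · simp [heatKer_of_nonpos h]
      · have h1 : Tendsto (fun n : ℕ => -((n : ℝ) * τ)) atTop atBot :=
          tendsto_neg_atTop_atBot.comp (tendsto_natCast_atTop_atTop.atTop_mul_const h)
        simpa using (Real.tendsto_exp_atBot.comp h1).mul_const (heatKer τ 0)
  rw [integral_zero] at h
  obtain ⟨n, hn⟩ := (h.eventually (gt_mem_nhds hη)).exists
  exact ⟨n, n.cast_nonneg, hn.le⟩

/-- Existence for the Abel equation with a Lipschitz nonlinearity. -/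
lemma exists_abelSolution_of_lipschitz (hT : 0 < T) {f g : ℝ → ℝ}
    (hf : IntegrableOn f (Ioo 0 T)) {L : ℝ} (hL : 0 ≤ L)
    (hg : ∀ a b, |g a - g b| ≤ L * |a - b|) (hgm : Measurable g) (hg0 : g 0 = 0) :
    ∃ h, AbelSolution T f g h := by
  -- With this mass the contraction factor is `L/(2(L+1)) ≤ 1/2`. Adding `1` to `L` avoids dividing
  -- by zero.
  obtain ⟨c, hc, hq⟩ := exists_exp_weight T (η := (2 * (L + 1))⁻¹) (by positivity)
  set V := volume.restrict (Ioo 0 T) with hV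
  -- The unknown is `z = e^{-ct} h`. Conjugating `g` by the weight keeps its Lipschitz constant,
  -- while the kernel acquires the damping `e^{-c(t-r)}`.
  set F : ℝ → ℝ → ℝ := fun r z => Real.exp (-(c * r)) * g (Real.exp (c * r) * z) with hF
  have hFl : ∀ r a b, |F r a - F r b| ≤ L * |a - b| := fun r a b => by
    rw [hF]; simp only
    rw [← mul_sub, abs_mul, abs_of_pos (Real.exp_pos _)]
    have h1 := hg (Real.exp (c * r) * a) (Real.exp (c * r) * b)
    rw [← mul_sub, abs_mul, abs_of_pos (Real.exp_pos _)] at h1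
    have h2 : Real.exp (-(c * r)) * Real.exp (c * r) = 1 := by rw [← Real.exp_add]; simp
    calc _ ≤ Real.exp (-(c * r)) * (L * (Real.exp (c * r) * |a - b|)) := by gcongr
      _ = L * |a - b| := by linear_combination (L * |a - b|) * h2
  have hF0 : ∀ r, F r 0 = 0 := fun r => by simp [hF, hg0]
  have hFi : ∀ z : ℝ → ℝ, Integrable z V → Integrable (fun r => F r (z r)) V := fun z hz => by
    refine (hz.norm.const_mul L).mono' ?_ (ae_of_all _ fun r => ?_)
    · refine AEMeasurable.aestronglyMeasurable ?_
      have := hz.aestronglyMeasurable.aemeasurable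
      have h1 : AEMeasurable (fun r => Real.exp (c * r) * z r) V := by fun_prop
      exact (AEMeasurable.mul (by fun_prop) (hgm.comp_aemeasurable h1))
    · have := hFl r (z r) 0
      rwa [hF0, sub_zero, sub_zero] at this
  have hfi : Integrable (fun t => Real.exp (-(c * t)) * f t) V := by
    refine hf.bdd_mul (c := 1) (Measurable.aestronglyMeasurable (by fun_prop)) ?_
    filter_upwards [ae_restrict_mem measurableSet_Ioo] with t ht
    rw [Real.norm_of_nonneg (Real.exp_pos _).le, Real.exp_le_one_iff]
    have := mul_nonneg hc ht.1.le
    linarith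
  set Φ : (ℝ → ℝ) → ℝ → ℝ := fun z t => Real.exp (-(c * t)) * f t
    - ∫ r in Ioo 0 T, Real.exp (-(c * (t - r))) * heatKer (t - r) 0 * F r (z r) with hΦ
  have hΦi : ∀ z : ℝ → ℝ, Integrable z V → Integrable (Φ z) V := fun z hz =>
    hfi.sub (abs_integral_heatKer_mul_le hT.le (hFi z hz) hc hq).1.integral_prod_left
  let Ψ : (ℝ →₁[V] ℝ) → (ℝ →₁[V] ℝ) := fun z => (hΦi z (L1.integrable_coeFn z)).toL1 (Φ z)
  have hcontr : ContractingWith (1 / 2) Ψ := by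
    refine ⟨by norm_num, LipschitzWith.of_dist_le_mul fun z z' => ?_⟩
    have hz := L1.integrable_coeFn z
    have hz' := L1.integrable_coeFn z'
    rw [L1.dist_eq_integral_dist, L1.dist_eq_integral_dist]
    have hsub := (hFi z hz).sub (hFi z' hz')
    obtain ⟨-, h2⟩ := abs_integral_heatKer_mul_le hT.le (φ := fun r => F r (z r) - F r (z' r))
      hsub hc hq
    have j1 := (abs_integral_heatKer_mul_le hT.le (hFi z hz) hc hq).1.prod_right_ae
    have j2 := (abs_integral_heatKer_mul_le hT.le (hFi z' hz') hc hq).1.prod_right_ae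
    have e : ∫ t, dist (Ψ z t) (Ψ z' t) ∂V = ∫ t in Ioo 0 T, |∫ r in Ioo 0 T,
        Real.exp (-(c * (t - r))) * heatKer (t - r) 0 * (F r (z r) - F r (z' r))| := by
      refine integral_congr_ae ?_
      filter_upwards [(hΦi z hz).coeFn_toL1, (hΦi z' hz').coeFn_toL1, j1, j2] with t a1 a2 b1 b2
      rw [a1, a2, Real.dist_eq]
      simp only [mul_sub (Real.exp _ * heatKer _ _)]
      rw [integral_sub b1 b2, abs_sub_comm]
      congr 1
      simp only [hΦ]
      ring
    rw [e]
    refine h2.trans ?_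
    have h3 : ∫ r in Ioo 0 T, |F r (z r) - F r (z' r)| ≤ L * ∫ r, dist (z r) (z' r) ∂V := by
      rw [← integral_const_mul]
      exact integral_mono hsub.abs ((hz.sub hz').norm.const_mul L) fun r => hFl r _ _
    have h4 : 0 ≤ ∫ r, dist (z r) (z' r) ∂V := integral_nonneg fun _ => dist_nonneg
    calc _ ≤ (2 * (L + 1))⁻¹ * (L * ∫ r, dist (z r) (z' r) ∂V) := by gcongr
      _ = ((2 * (L + 1))⁻¹ * L) * ∫ r, dist (z r) (z' r) ∂V := by ring
      _ ≤ (1 / 2) * ∫ r, dist (z r) (z' r) ∂V := by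
          refine mul_le_mul_of_nonneg_right ?_ h4
          rw [inv_mul_le_iff₀ (by positivity)]; linarith
      _ = _ := by norm_num
  have hfix := hcontr.fixedPoint_isFixedPt
  set z := ContractingWith.fixedPoint Ψ hcontr with hzdef
  have hz := L1.integrable_coeFn z
  have hzeq : ∀ᵐ t ∂V, z t = Φ z t := by
    have := (hΦi z hz).coeFn_toL1
    have h2 : (Ψ z : ℝ → ℝ) =ᵐ[V] Φ z := this
    rw [hfix.eq] at h2
    exact h2
  have hzm : Measurable z := (Lp.stronglyMeasurable z).measurable
  refine ⟨fun t => Real.exp (c * t) * z t, by fun_prop, ?_, ?_, ?_⟩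
  · refine hz.bdd_mul (c := Real.exp (c * T)) (Measurable.aestronglyMeasurable (by fun_prop)) ?_
    filter_upwards [ae_restrict_mem measurableSet_Ioo] with t ht
    rw [Real.norm_of_nonneg (Real.exp_pos _).le, Real.exp_le_exp]
    exact mul_le_mul_of_nonneg_left ht.2.le hc
  · have h1 : Integrable (fun t => Real.exp (c * t) * F t (z t)) V := by
      refine (hFi z hz).bdd_mul (c := Real.exp (c * T))
        (Measurable.aestronglyMeasurable (by fun_prop)) ?_
      filter_upwards [ae_restrict_mem measurableSet_Ioo] with t ht
      rw [Real.norm_of_nonneg (Real.exp_pos _).le, Real.exp_le_exp]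
      exact mul_le_mul_of_nonneg_left ht.2.le hc
    refine h1.congr (ae_of_all _ fun t => ?_)
    simp only [hF]
    rw [← mul_assoc, ← Real.exp_add, add_neg_cancel, Real.exp_zero, one_mul]
  · filter_upwards [hzeq] with t ht
    have e1 : Real.exp (c * t) * Real.exp (-(c * t)) = 1 := by rw [← Real.exp_add]; simp
    rw [ht, hΦ]
    simp only
    rw [mul_sub, ← mul_assoc, e1, one_mul, ← integral_const_mul]
    congr 2
    ext r
    have e2 : Real.exp (c * t) * Real.exp (-(c * (t - r))) * Real.exp (-(c * r)) = 1 := by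
      rw [← Real.exp_add, ← Real.exp_add, Real.exp_eq_one_iff]; ring
    simp only [hF]
    linear_combination (heatKer (t - r) 0 * g (Real.exp (c * r) * z r)) * e2

/-- Passage to the limit in the Abel equation. -/
lemma AbelSolution.limit (hT : 0 < T) {f g : ℝ → ℝ} {gs hs : ℕ → ℝ → ℝ} (hgc : Continuous g)
    (hgm : ∀ n, Monotone (gs n)) (hg : ∀ s, Tendsto (fun n => gs n s) atTop (𝓝 (g s)))
    (hsol : ∀ n, AbelSolution T f (gs n) (hs n)) {F B : ℝ → ℝ} (hF : IntegrableOn F (Ioo 0 T))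
    (hB : IntegrableOn B (Ioo 0 T))
    (hhF : ∀ n, ∀ᵐ t ∂(volume.restrict (Ioo 0 T)), |hs n t| ≤ F t)
    (hhB : ∀ n, ∀ᵐ t ∂(volume.restrict (Ioo 0 T)), |gs n (hs n t)| ≤ B t)
    (hlim : ∀ᵐ t ∂(volume.restrict (Ioo 0 T)), ∃ l, Tendsto (fun n => hs n t) atTop (𝓝 l)) :
    ∃ h, AbelSolution T f g h ∧
      ∀ᵐ t ∂(volume.restrict (Ioo 0 T)), Tendsto (fun n => hs n t) atTop (𝓝 (h t)) := by
  obtain ⟨h, hm, hh⟩ := measurable_limit_of_tendsto_metrizable_ae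
    (fun n => (hsol n).measurable.aemeasurable) hlim
  have hF' := ae_all_iff.2 hhF
  have hB' := ae_all_iff.2 hhB
  -- Pointwise convergence of monotone functions to a continuous limit is enough: `gs n (hs n t)` is
  -- squeezed by the values of `gs n` at `h t ± δ/2`, so uniform convergence is not needed.
  have hcomp : ∀ᵐ t ∂(volume.restrict (Ioo 0 T)),
      Tendsto (fun n => gs n (hs n t)) atTop (𝓝 (g (h t))) := by
    filter_upwards [hh] with t ht
    refine tendsto_order.2 ⟨fun a ha => ?_, fun a ha => ?_⟩
    · obtain ⟨δ, hδ, hδ'⟩ := Metric.eventually_nhds_iff.1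
        (hgc.continuousAt.eventually (lt_mem_nhds ha) : ∀ᶠ s in 𝓝 (h t), a < g s)
      have h1 : a < g (h t - δ / 2) := hδ' (by
        rw [Real.dist_eq, sub_sub_cancel_left, abs_neg, abs_of_pos (half_pos hδ)]
        exact half_lt_self hδ)
      filter_upwards [(hg (h t - δ / 2)).eventually (lt_mem_nhds h1),
        ht.eventually (lt_mem_nhds (sub_lt_self _ (half_pos hδ)))] with n a1 a2
      exact a1.trans_le (hgm n a2.le)
    · obtain ⟨δ, hδ, hδ'⟩ := Metric.eventually_nhds_iff.1
        (hgc.continuousAt.eventually (gt_mem_nhds ha) : ∀ᶠ s in 𝓝 (h t), g s < a)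
      have h1 : g (h t + δ / 2) < a := hδ' (by
        rw [Real.dist_eq, add_sub_cancel_left, abs_of_pos (half_pos hδ)]
        exact half_lt_self hδ)
      filter_upwards [(hg (h t + δ / 2)).eventually (gt_mem_nhds h1),
        ht.eventually (gt_mem_nhds (lt_add_of_pos_right _ (half_pos hδ)))] with n a1 a2
      exact (hgm n a2.le).trans_lt a1
  have hgB : ∀ᵐ t ∂(volume.restrict (Ioo 0 T)), |g (h t)| ≤ B t := by
    filter_upwards [hcomp, hB'] with t h1 h2
    exact le_of_tendsto h1.abs (Eventually.of_forall h2)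
  refine ⟨h, ⟨hm, ?_, ?_, ?_⟩, hh⟩
  · refine Integrable.mono' hF hm.aestronglyMeasurable ?_
    filter_upwards [hh, hF'] with t h1 h2
    exact le_of_tendsto h1.abs (Eventually.of_forall h2)
  · exact Integrable.mono' hB (hgc.measurable.comp hm).aestronglyMeasurable hgB
  · filter_upwards [hh, ae_all_iff.2 fun n => (hsol n).eq,
      (integrable_heatKer_mul_prod hT.le hB).prod_right_ae] with t h1 h2 h3
    refine tendsto_nhds_unique h1 ?_
    simp only [h2]
    refine Tendsto.const_sub _ ?_
    refine tendsto_integral_of_dominated_convergence (fun r => heatKer (t - r) 0 * B r)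
      (fun n => ((Measurable.aestronglyMeasurable (by fun_prop)).mul
        (hsol n).integrableOn_flux.aestronglyMeasurable)) h3 (fun n => ?_) ?_
    · filter_upwards [hB'] with r hr
      rw [norm_mul, Real.norm_of_nonneg (heatKer_nonneg _ _)]
      exact mul_le_mul_of_nonneg_left (hr n) (heatKer_nonneg _ _)
    · filter_upwards [hcomp] with r hr using hr.const_mul _

end abel

/-! ### Weak L² bound and subcritical growth -/

section weak

variable {T : ℝ}

lemma lintegral_indicator_heatKer {a : ℝ} (ha : 0 ≤ a) (s : ℝ) :
    ∫⁻ t, (Iic a).indicator (fun τ => ENNReal.ofReal (heatKer τ 0)) (t - s)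
      = ENNReal.ofReal (heatKerMass a) := by
  rw [lintegral_sub_right_eq_self (fun t => (Iic a).indicator _ t) s,
    lintegral_indicator measurableSet_Iic, lintegral_heatKer_zero ha]

/-- The kernel is split at age `a`: recent poles contribute an integrable part, and older ones at
most `k(a)` times the total mass. -/
lemma ofReal_heatPotential_boundary_le {M : Measure (ℝ × ℝ)} {a : ℝ} (ha : 0 < a) (t : ℝ) :
    ENNReal.ofReal (heatPotential M (t, 0))
      ≤ ∫⁻ z, (Iic a).indicator (fun τ => ENNReal.ofReal (heatKer τ 0)) (t - z.1) ∂M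
        + ENNReal.ofReal (heatKer a 0) * M univ := by
  rw [heatPotential_boundary, integral_eq_lintegral_of_nonneg_ae
    (ae_of_all _ fun z => heatKer_nonneg _ _) (Measurable.aestronglyMeasurable (by fun_prop))]
  refine ENNReal.ofReal_toReal_le.trans ?_
  rw [← lintegral_const, ← lintegral_add_right _ measurable_const]
  refine lintegral_mono fun z => ?_
  by_cases h : t - z.1 ∈ Iic a
  · rw [indicator_of_mem h]
    exact (ENNReal.ofReal_le_ofReal (heatKer_le _ _)).trans le_self_add
  · rw [indicator_of_notMem h, zero_add]
    exact ENNReal.ofReal_le_ofReal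
      ((heatKer_le _ _).trans (heatKer_zero_anti ha (not_le.1 h).le))

/-- The boundary values of a heat potential belong to weak `L²`. -/
lemma exists_measure_le_heatPotential_le (M : Measure (ℝ × ℝ)) [IsFiniteMeasure M] :
    ∃ C : ℝ, 0 ≤ C ∧ ∀ l : ℝ, 0 < l →
      volume {t | l ≤ heatPotential M (t, 0)} ≤ ENNReal.ofReal (C * (l ^ 2)⁻¹) := by
  -- The added `1` keeps `m` positive when `M = 0`.
  set m : ℝ := M.real univ + 1 with hm
  have hm0 : 0 < m := by positivity
  have hMm : M univ ≤ ENNReal.ofReal m := by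
    rw [← ENNReal.ofReal_toReal (measure_ne_top M univ)]
    exact ENNReal.ofReal_le_ofReal (by rw [hm, Measure.real]; linarith)
  refine ⟨8 * m ^ 2 * Real.pi⁻¹, by positivity, fun l hl => ?_⟩
  -- Chosen so that the old part is at most `k(a) m = l/2`. Where the potential exceeds `l`, the
  -- recent part is then at least `l/2`. Markov's inequality gives `8m²/(π l²)`, as `∫ k` over
  -- `(0,a)` is `4m/(πl)`.
  set a : ℝ := (2 * m / l) ^ 2 / Real.pi with ha
  have ha0 : 0 < a := by positivity
  have hk : heatKer a 0 * m = l / 2 := by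
    rw [heatKer_zero_right, ha, mul_div_cancel₀ _ Real.pi_pos.ne', Real.sqrt_sq (by positivity)]
    field_simp
  have hmass : heatKerMass a = 4 * m / (Real.pi * l) := by
    rw [heatKerMass, ha, Real.sqrt_div (by positivity), Real.sqrt_sq (by positivity)]
    field_simp
    rw [Real.sq_sqrt Real.pi_pos.le]
    ring
  set A : ℝ → ENNReal := fun t =>
    ∫⁻ z, (Iic a).indicator (fun τ => ENNReal.ofReal (heatKer τ 0)) (t - z.1) ∂M with hA
  have hmeas : Measurable fun q : ℝ × (ℝ × ℝ) =>
      (Iic a).indicator (fun τ => ENNReal.ofReal (heatKer τ 0)) (q.1 - q.2.1) :=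
    (Measurable.indicator (by fun_prop) measurableSet_Iic).comp (by fun_prop)
  have hAm : Measurable A := hmeas.lintegral_prod_right'
  have hsub : {t | l ≤ heatPotential M (t, 0)} ⊆ {t | ENNReal.ofReal (l / 2) ≤ A t} := by
    intro t ht
    have h1 := (ENNReal.ofReal_le_ofReal (mem_ofPred.1 ht)).trans
      (ofReal_heatPotential_boundary_le (M := M) ha0 t)
    have h2 : ENNReal.ofReal (heatKer a 0) * M univ ≤ ENNReal.ofReal (l / 2) := by
      rw [← hk, ENNReal.ofReal_mul (heatKer_nonneg _ _)]
      gcongr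
    have h3 : ENNReal.ofReal (l / 2) + ENNReal.ofReal (l / 2)
        ≤ A t + ENNReal.ofReal (l / 2) := by
      rw [← ENNReal.ofReal_add (by positivity) (by positivity), add_halves]
      exact h1.trans (by gcongr)
    exact (ENNReal.add_le_add_iff_right ENNReal.ofReal_ne_top).1 h3
  have hint : ∫⁻ t, A t ≤ ENNReal.ofReal (heatKerMass a * m) := by
    rw [hA, lintegral_lintegral_swap (f := fun t z => _) hmeas.aemeasurable]
    simp only [lintegral_indicator_heatKer ha0.le, lintegral_const]
    rw [ENNReal.ofReal_mul (by rw [hmass]; positivity)]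
    gcongr
  have hpos : ENNReal.ofReal (l / 2) ≠ 0 := by simpa using hl
  calc volume {t | l ≤ heatPotential M (t, 0)}
      ≤ volume {t | ENNReal.ofReal (l / 2) ≤ A t} := measure_mono hsub
    _ ≤ (∫⁻ t, A t) / ENNReal.ofReal (l / 2) :=
        meas_ge_le_lintegral_div hAm.aemeasurable hpos ENNReal.ofReal_ne_top
    _ ≤ ENNReal.ofReal (heatKerMass a * m) / ENNReal.ofReal (l / 2) := by gcongr
    _ = _ := by
        rw [← ENNReal.ofReal_div_of_pos (by positivity), hmass]
        congr 1
        field_simp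
        ring

/-- For `x > 1`, averaging over `(x, 2x]`, where `G x ≤ G s` and `1/x ≤ 2/s`, bounds `G x` by an
integral in `s` of `G s / s`. This replaces a layer-cake formula and avoids the Stieltjes measure of
`G`. -/
lemma ofReal_comp_le_of_monotone {G : ℝ → ℝ} (hG : Monotone G) (hG0 : 0 ≤ G 1) (x : ℝ) :
    ENNReal.ofReal (G x) ≤ ENNReal.ofReal (G 1)
      + ∫⁻ s in Ioi 1, ENNReal.ofReal (2 * G s * s⁻¹) * (Iic x).indicator 1 (s / 2) := by
  rcases le_or_gt x 1 with h | h
  · exact (ENNReal.ofReal_le_ofReal (hG h)).trans le_self_add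
  refine le_trans ?_ le_add_self
  have hx : 0 < x := by linarith
  have hGx : 0 ≤ G x := hG0.trans (hG h.le)
  calc ENNReal.ofReal (G x) = ∫⁻ s in Ioc x (2 * x), ENNReal.ofReal (G x * x⁻¹) := by
        rw [setLIntegral_const, Real.volume_Ioc, ← ENNReal.ofReal_mul (by positivity)]
        congr 1
        field_simp
        ring
    _ ≤ ∫⁻ s in Ioc x (2 * x),
          ENNReal.ofReal (2 * G s * s⁻¹) * (Iic x).indicator 1 (s / 2) := by
        refine setLIntegral_mono' measurableSet_Ioc fun s hs => ?_
        have hs0 : 0 < s := hx.trans hs.1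
        rw [indicator_of_mem (by simp only [mem_Iic]; linarith [hs.2]), Pi.one_apply, mul_one]
        refine ENNReal.ofReal_le_ofReal ?_
        have h1 : x⁻¹ ≤ 2 * s⁻¹ := by
          rw [← div_eq_mul_inv, inv_eq_one_div, div_le_div_iff₀ hx hs0, one_mul]
          exact hs.2
        calc G x * x⁻¹ ≤ G s * (2 * s⁻¹) := by
              have := hG hs.1.le
              have := hGx.trans this
              gcongr
          _ = 2 * G s * s⁻¹ := by ring
    _ ≤ _ := lintegral_mono_set fun s hs => h.trans hs.1

/-- A monotone function of subcritical growth maps weak `L²` into `L¹`. -/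
lemma integrable_comp_of_weak {V : Measure ℝ} [IsFiniteMeasure V] {F G : ℝ → ℝ} (hF : Measurable F)
    (hG : Monotone G) (hG0 : 0 ≤ G 0) (hF0 : ∀ t, 0 ≤ F t)
    (hGi : IntegrableOn (fun s : ℝ => G s * s ^ (-3 : ℤ)) (Ioi 1)) {C : ℝ} (hC : 0 ≤ C)
    (hw : ∀ l : ℝ, 0 < l → V {t | l ≤ F t} ≤ ENNReal.ofReal (C * (l ^ 2)⁻¹)) :
    Integrable (fun t => G (F t)) V := by
  have hG1 : 0 ≤ G 1 := hG0.trans (hG zero_le_one)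
  have hGF : Measurable fun t => G (F t) := hG.measurable.comp hF
  refine ⟨hGF.aestronglyMeasurable, ?_⟩
  rw [hasFiniteIntegral_iff_ofReal (ae_of_all _ fun t => hG0.trans (hG (hF0 t)))]
  have hm : Measurable fun q : ℝ × ℝ =>
      ENNReal.ofReal (2 * G q.2 * q.2⁻¹) * (Iic (F q.1)).indicator 1 (q.2 / 2) := by
    have h1 : Measurable fun q : ℝ × ℝ => G q.2 := hG.measurable.comp measurable_snd
    have h2 : Measurable fun q : ℝ × ℝ => ((Iic (F q.1)).indicator 1 (q.2 / 2) : ENNReal) := by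
      have h3 : MeasurableSet {q : ℝ × ℝ | q.2 / 2 ≤ F q.1} :=
        measurableSet_le (by fun_prop) (by fun_prop)
      have h4 : Measurable ({q : ℝ × ℝ | q.2 / 2 ≤ F q.1}.indicator (1 : ℝ × ℝ → ENNReal)) :=
        measurable_one.indicator h3
      exact h4
    exact ((h1.const_mul 2).mul measurable_snd.inv).ennreal_ofReal.mul h2
  calc ∫⁻ t, ENNReal.ofReal (G (F t)) ∂V
      ≤ ∫⁻ t, (ENNReal.ofReal (G 1) + ∫⁻ s in Ioi 1,
          ENNReal.ofReal (2 * G s * s⁻¹) * (Iic (F t)).indicator 1 (s / 2)) ∂V :=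
        lintegral_mono fun t => ofReal_comp_le_of_monotone hG hG1 (F t)
    _ = ENNReal.ofReal (G 1) * V univ + ∫⁻ s in Ioi 1, ∫⁻ t,
          ENNReal.ofReal (2 * G s * s⁻¹) * (Iic (F t)).indicator 1 (s / 2) ∂V := by
        rw [lintegral_add_left measurable_const, lintegral_const, lintegral_lintegral_swap]
        exact hm.aemeasurable
    -- The weak bound at level `s/2` is `4C/s²`. Multiplied by `2 G(s)/s`, it gives the weight `s⁻³`
    -- of the growth condition.
    _ ≤ ENNReal.ofReal (G 1) * V univ
          + ∫⁻ s in Ioi 1, ENNReal.ofReal (8 * C * (G s * s ^ (-3 : ℤ))) := by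
        gcongr ENNReal.ofReal (G 1) * V univ + ?_
        refine setLIntegral_mono' measurableSet_Ioi fun s hs => ?_
        have hs0 : (0 : ℝ) < s := zero_lt_one.trans hs
        have hGs : 0 ≤ G s := hG0.trans (hG hs0.le)
        have e : ∀ t, ((Iic (F t)).indicator 1 (s / 2) : ENNReal)
            = {t | s / 2 ≤ F t}.indicator 1 t := fun t => rfl
        simp only [e]
        rw [lintegral_const_mul _ (measurable_one.indicator (measurableSet_le measurable_const hF)),
          lintegral_indicator_one (measurableSet_le measurable_const hF)]
        calc _ ≤ ENNReal.ofReal (2 * G s * s⁻¹) * ENNReal.ofReal (C * ((s / 2) ^ 2)⁻¹) := by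
              gcongr
              exact hw _ (half_pos hs0)
          _ = _ := by
              rw [← ENNReal.ofReal_mul (by positivity)]
              congr 1
              rw [zpow_neg]
              norm_cast
              field_simp
              ring
    _ < ⊤ := by
        refine ENNReal.add_lt_top.2 ⟨ENNReal.mul_lt_top ENNReal.ofReal_lt_top (measure_lt_top _ _),
          ?_⟩
        have := (hGi.const_mul (8 * C)).2
        rwa [hasFiniteIntegral_iff_ofReal] at this
        filter_upwards [ae_restrict_mem measurableSet_Ioi] with s hs
        have hs0 : (0 : ℝ) < s := zero_lt_one.trans hs
        have hGs : 0 ≤ G s := hG0.trans (hG hs0.le)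
        positivity

end weak

/-! ### Monotone Lipschitz regularisation -/

/-- The inf-convolution of `p` with `n|·|`. -/
noncomputable def infConv (p : ℝ → ℝ) (n : ℕ) (s : ℝ) : ℝ := ⨅ r, (p r + n * |s - r|)

section infConv

variable {p : ℝ → ℝ}

lemma le_infConv {n : ℕ} {s a : ℝ} (h : ∀ r, a ≤ p r + n * |s - r|) : a ≤ infConv p n s :=
  le_ciInf h

lemma infConv_le_add (hp : ∀ r, 0 ≤ p r) (n : ℕ) (s r : ℝ) : infConv p n s ≤ p r + n * |s - r| :=
  ciInf_le ⟨0, by rintro _ ⟨r, rfl⟩; have := hp r; positivity⟩ r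

lemma infConv_nonneg (hp : ∀ r, 0 ≤ p r) (n : ℕ) (s : ℝ) : 0 ≤ infConv p n s :=
  le_infConv fun r => add_nonneg (hp r) (by positivity)

lemma infConv_le (hp : ∀ r, 0 ≤ p r) (n : ℕ) (s : ℝ) : infConv p n s ≤ p s := by
  simpa using infConv_le_add hp n s s

/-- Translating the competitor `r` by `s' - s` leaves the penalty unchanged and can only lower `p`.
-/
lemma monotone_infConv (hp : ∀ r, 0 ≤ p r) (hm : Monotone p) (n : ℕ) : Monotone (infConv p n) := by
  intro s s' hs
  refine le_infConv fun r => (infConv_le_add hp n s (r - (s' - s))).trans ?_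
  rw [show s - (r - (s' - s)) = s' - r by ring]
  have := hm (show r - (s' - s) ≤ r by linarith)
  linarith

lemma infConv_mono (hp : ∀ r, 0 ≤ p r) (s : ℝ) : Monotone fun n => infConv p n s := by
  intro n n' hn
  refine le_infConv fun r => (infConv_le_add hp n s r).trans ?_
  gcongr

lemma abs_infConv_sub_le (hp : ∀ r, 0 ≤ p r) (n : ℕ) (a b : ℝ) :
    |infConv p n a - infConv p n b| ≤ n * |a - b| := by
  have key : ∀ a b, infConv p n a - n * |a - b| ≤ infConv p n b := fun a b =>
    le_infConv fun r => by
      have h1 := infConv_le_add hp n a r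
      have h2 : (n : ℝ) * |a - r| ≤ n * (|a - b| + |b - r|) :=
        mul_le_mul_of_nonneg_left (abs_sub_le a b r) n.cast_nonneg
      linarith
  have h1 := key a b
  have h2 := key b a
  rw [abs_sub_comm b a] at h2
  rw [abs_le]
  constructor <;> linarith

lemma tendsto_infConv (hp : ∀ r, 0 ≤ p r) (hc : Continuous p) (s : ℝ) :
    Tendsto (fun n => infConv p n s) atTop (𝓝 (p s)) := by
  refine tendsto_order.2 ⟨fun a ha => ?_, fun a ha =>
    Eventually.of_forall fun n => (infConv_le hp n s).trans_lt ha⟩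
  obtain ⟨b, hab, hb⟩ := exists_between ha
  obtain ⟨δ, hδ, hδ'⟩ := Metric.eventually_nhds_iff.1
    (hc.continuousAt.eventually (lt_mem_nhds hb) : ∀ᶠ r in 𝓝 s, b < p r)
  -- Competitors within `δ` of `s` have `p r > b`; for the others the penalty alone is at least `nδ
  -- ≥ p s`.
  filter_upwards [eventually_ge_atTop ⌈p s / δ⌉₊] with n hn
  refine hab.trans_le (le_infConv fun r => ?_)
  rcases lt_or_ge (dist r s) δ with h | h
  · have := hδ' h
    have : (0 : ℝ) ≤ n * |s - r| := by positivity
    linarith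
  · have h1 : p s / δ ≤ n := Nat.ceil_le.1 hn
    rw [div_le_iff₀ hδ] at h1
    rw [Real.dist_eq, abs_sub_comm] at h
    have h2 : (n : ℝ) * δ ≤ n * |s - r| := by gcongr
    have := hp r
    linarith

end infConv

/-- Lipschitz regularisation of the positive part of a nondecreasing function. -/
noncomputable def posApprox (g : ℝ → ℝ) (n : ℕ) (s : ℝ) : ℝ :=
  infConv (fun r => g (max r 0)) n s + g (min s 0)

section posApprox

variable {g : ℝ → ℝ}

lemma comp_max_nonneg (hg : Monotone g) (hg0 : g 0 = 0) (r : ℝ) : 0 ≤ g (max r 0) :=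
  hg0.symm.le.trans (hg (le_max_right _ _))

lemma monotone_posApprox (hg : Monotone g) (hg0 : g 0 = 0) (n : ℕ) : Monotone (posApprox g n) :=
  (monotone_infConv (comp_max_nonneg hg hg0)
    (fun _ _ h => hg (max_le_max_right _ h)) n).add fun _ _ h => hg (min_le_min_right _ h)

lemma posApprox_mono (hg : Monotone g) (hg0 : g 0 = 0) (s : ℝ) : Monotone fun n => posApprox g n s :=
  (infConv_mono (comp_max_nonneg hg hg0) s).add_const _

lemma comp_max_add_comp_min (hg0 : g 0 = 0) (s : ℝ) : g (max s 0) + g (min s 0) = g s := by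
  rcases le_total s 0 with h | h <;> simp [h, hg0]

lemma tendsto_posApprox (hg : Monotone g) (hg0 : g 0 = 0) (hc : Continuous g) (s : ℝ) :
    Tendsto (fun n => posApprox g n s) atTop (𝓝 (g s)) := by
  rw [← comp_max_add_comp_min hg0 s]
  exact (tendsto_infConv (comp_max_nonneg hg hg0) (by fun_prop) s).add_const _

/-- On `s ≤ 0` the inf-convolution is squeezed between `0` and `g 0 = 0`, so `posApprox` agrees with
`g` there; on `s ≥ 0` it lies between `0` and `g`. Bounds for `g` thus pass to all approximations.
-/
lemma abs_posApprox_le (hg : Monotone g) (hg0 : g 0 = 0) (n : ℕ) (s : ℝ) :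
    |posApprox g n s| ≤ |g s| := by
  have h1 := infConv_nonneg (comp_max_nonneg hg hg0) n s
  have h2 := infConv_le (comp_max_nonneg hg hg0) n s
  simp only [posApprox]
  rcases le_total s 0 with h | h
  · simp only [max_eq_right h, hg0] at h2
    rw [le_antisymm h2 h1, min_eq_left h, zero_add]
  · rw [min_eq_right h, hg0, add_zero, abs_of_nonneg h1]
    simp only [max_eq_left h] at h2
    exact h2.trans (le_abs_self _)

lemma posApprox_zero (hg : Monotone g) (hg0 : g 0 = 0) (n : ℕ) : posApprox g n 0 = 0 := by
  have := abs_posApprox_le hg hg0 n 0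
  rwa [hg0, abs_zero, abs_nonpos_iff] at this

lemma continuous_infConv {p : ℝ → ℝ} (hp : ∀ r, 0 ≤ p r) (n : ℕ) : Continuous (infConv p n) :=
  (LipschitzWith.of_dist_le_mul (K := n) fun a b => by
    simpa [Real.dist_eq] using abs_infConv_sub_le hp n a b).continuous

lemma continuous_posApprox (hg : Monotone g) (hg0 : g 0 = 0) (hc : Continuous g) (n : ℕ) :
    Continuous (posApprox g n) :=
  (continuous_infConv (comp_max_nonneg hg hg0) n).add (by fun_prop)

lemma abs_posApprox_sub_le (hg : Monotone g) (hg0 : g 0 = 0) {L : ℝ}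
    (hL : ∀ a b, |g (min a 0) - g (min b 0)| ≤ L * |a - b|) (n : ℕ) (a b : ℝ) :
    |posApprox g n a - posApprox g n b| ≤ (n + L) * |a - b| := by
  have h1 := abs_infConv_sub_le (comp_max_nonneg hg hg0) n a b
  have h2 := hL a b
  simp only [posApprox]
  rw [add_sub_add_comm, add_mul]
  exact (abs_add_le _ _).trans (add_le_add h1 h2)

end posApprox

/-! ### Existence for the Abel equation -/

section existence

variable {T : ℝ} {M₁ M₂ : Measure (ℝ × ℝ)}

lemma AbelSolution.neg {f g h : ℝ → ℝ} (hh : AbelSolution T f g h) :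
    AbelSolution T (fun t => -f t) (fun s => -g (-s)) (fun t => -h t) where
  measurable := hh.measurable.neg
  integrableOn := hh.integrableOn.neg
  integrableOn_flux := by
    simp only [neg_neg]
    exact hh.integrableOn_flux.neg
  eq := by
    filter_upwards [hh.eq] with t ht
    simp only [neg_neg, mul_neg, MeasureTheory.integral_neg]
    rw [ht]; ring

lemma abelSolution_zero [IsFiniteMeasure M₁] (hT : 0 < T) (hM : ∀ᵐ z ∂M₁, z ∈ testCylinder T) :
    AbelSolution T (fun t => heatPotential M₁ (t, 0)) (fun _ => 0)
      (fun t => heatPotential M₁ (t, 0)) where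
  measurable := by fun_prop
  integrableOn := integrableOn_heatPotential_boundary hT.le hM
  integrableOn_flux := integrableOn_zero
  eq := by simp

/-- Compare with the linear equation with datum `M₁`: where `h` exceeds its nonnegative solution,
`g(h) ≥ g 0 = 0`. The negative datum `M₂` is the nonnegative difference required by
`AbelSolution.le`. -/
lemma AbelSolution.le_heatPotential [IsFiniteMeasure M₁] [IsFiniteMeasure M₂] (hT : 0 < T)
    (hM₁ : ∀ᵐ z ∂M₁, z ∈ testCylinder T) (hM₂ : ∀ᵐ z ∂M₂, z ∈ testCylinder T) {g h : ℝ → ℝ}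
    (hg : Monotone g) (hg0 : g 0 = 0)
    (hh : AbelSolution T (fun t => heatPotential M₁ (t, 0) - heatPotential M₂ (t, 0)) g h) :
    ∀ᵐ t ∂(volume.restrict (Ioo 0 T)), h t ≤ heatPotential M₁ (t, 0) :=
  hh.le hT hM₂ hg.measurable measurable_const (abelSolution_zero hT hM₁) (ae_of_all _ fun _ => rfl)
    fun t ht => by
      rw [← hg0]
      exact hg ((heatPotential_nonneg _ _).trans ht.le)

lemma AbelSolution.abs_le [IsFiniteMeasure M₁] [IsFiniteMeasure M₂] (hT : 0 < T)
    (hM₁ : ∀ᵐ z ∂M₁, z ∈ testCylinder T) (hM₂ : ∀ᵐ z ∂M₂, z ∈ testCylinder T) {g h : ℝ → ℝ}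
    (hg : Monotone g) (hg0 : g 0 = 0)
    (hh : AbelSolution T (fun t => heatPotential M₁ (t, 0) - heatPotential M₂ (t, 0)) g h) :
    ∀ᵐ t ∂(volume.restrict (Ioo 0 T)), |h t| ≤ heatPotential (M₁ + M₂) (t, 0) := by
  have hn := hh.neg
  simp only [neg_sub] at hn
  have h2 := hn.le_heatPotential hT hM₂ hM₁ (fun a b hab => neg_le_neg (hg (neg_le_neg hab)))
    (by simp [hg0])
  filter_upwards [hh.le_heatPotential hT hM₁ hM₂ hg hg0, h2,
    ae_integrable_heatKer_boundary hT.le hM₁, ae_integrable_heatKer_boundary hT.le hM₂]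
    with t a1 a2 i1 i2
  rw [heatPotential_boundary, integral_add_measure i1 i2, ← heatPotential_boundary,
    ← heatPotential_boundary]
  have p1 := heatPotential_nonneg M₁ (t, 0)
  have p2 := heatPotential_nonneg M₂ (t, 0)
  rw [_root_.abs_le]
  constructor <;> linarith

lemma heatPotential_zero_measure (p : ℝ × ℝ) : heatPotential 0 p = 0 := by simp [heatPotential]

/-- The approximations of `g` increase with `n`, so by comparison their solutions decrease. The
potential of `M₁ + M₂` bounds them, and `B` dominates the nonlinear terms, so the limit exists and
solves the equation. -/
lemma exists_abelSolution_of_posApprox [IsFiniteMeasure M₁] [IsFiniteMeasure M₂] (hT : 0 < T)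
    (hM₁ : ∀ᵐ z ∂M₁, z ∈ testCylinder T) (hM₂ : ∀ᵐ z ∂M₂, z ∈ testCylinder T) {g B : ℝ → ℝ}
    (hgc : Continuous g) (hg : Monotone g) (hg0 : g 0 = 0) (hB : IntegrableOn B (Ioo 0 T))
    (hgB : ∀ s t, |s| ≤ heatPotential (M₁ + M₂) (t, 0) → |g s| ≤ B t)
    (hsol : ∀ n, ∃ h, AbelSolution T
      (fun t => heatPotential M₁ (t, 0) - heatPotential M₂ (t, 0)) (posApprox g n) h) :
    ∃ h, AbelSolution T (fun t => heatPotential M₁ (t, 0) - heatPotential M₂ (t, 0)) g h := by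
  choose hs hhs using hsol
  have hM : ∀ᵐ z ∂(M₁ + M₂), z ∈ testCylinder T := ae_add_measure_iff.2 ⟨hM₁, hM₂⟩
  have hF : ∀ n, ∀ᵐ t ∂(volume.restrict (Ioo 0 T)), |hs n t| ≤ heatPotential (M₁ + M₂) (t, 0) :=
    fun n => (hhs n).abs_le hT hM₁ hM₂ (monotone_posApprox hg hg0 n) (posApprox_zero hg hg0 n)
  have hanti : ∀ n, ∀ᵐ t ∂(volume.restrict (Ioo 0 T)), hs (n + 1) t ≤ hs n t := fun n =>
    (hhs (n + 1)).le (N := 0) hT (by simp) (monotone_posApprox hg hg0 _).measurable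
      (monotone_posApprox hg hg0 _).measurable (hhs n)
      (ae_of_all _ fun t => by rw [heatPotential_zero_measure, sub_zero])
      fun t ht => (monotone_posApprox hg hg0 n ht.le).trans
        (posApprox_mono hg hg0 _ n.le_succ)
  obtain ⟨h, hh, -⟩ := AbelSolution.limit hT hgc (monotone_posApprox hg hg0)
    (tendsto_posApprox hg hg0 hgc) hhs (integrableOn_heatPotential_boundary hT.le hM) hB hF
    (fun n => by
      filter_upwards [hF n] with t ht
      exact (abs_posApprox_le hg hg0 _ _).trans (hgB _ _ ht)) (by
      filter_upwards [ae_all_iff.2 hanti, ae_all_iff.2 hF] with t h1 h2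
      exact ⟨_, tendsto_atTop_ciInf (antitone_nat_of_succ_le h1)
        ⟨-heatPotential (M₁ + M₂) (t, 0), by
          rintro _ ⟨n, rfl⟩; exact (_root_.abs_le.1 (h2 n)).1⟩⟩)
  exact ⟨h, hh⟩

/-- Existence for the Abel equation with a continuous nondecreasing nonlinearity. -/
theorem exists_abelSolution [IsFiniteMeasure M₁] [IsFiniteMeasure M₂] (hT : 0 < T)
    (hM₁ : ∀ᵐ z ∂M₁, z ∈ testCylinder T) (hM₂ : ∀ᵐ z ∂M₂, z ∈ testCylinder T) {g : ℝ → ℝ}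
    (hgc : Continuous g) (hg : Monotone g) (hg0 : g 0 = 0)
    (hgi : IntegrableOn (fun s : ℝ => (g s - g (-s)) * s ^ (-3 : ℤ)) (Ioi 1) volume) :
    ∃ h, AbelSolution T (fun t => heatPotential M₁ (t, 0) - heatPotential M₂ (t, 0)) g h := by
  set F : ℝ → ℝ := fun t => heatPotential (M₁ + M₂) (t, 0) with hFdef
  -- This dominates `|g s|` for every `|s| ≤ F t`. Its integrability is where the growth hypothesis
  -- and the weak `L²` estimate meet.
  set B : ℝ → ℝ := fun t => g (F t) - g (-F t) with hBdef
  have hB : IntegrableOn B (Ioo 0 T) := by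
    obtain ⟨C, hC, hw⟩ := exists_measure_le_heatPotential_le (M₁ + M₂)
    exact integrable_comp_of_weak (F := F) (G := fun s => g s - g (-s)) (by fun_prop)
      (fun a b h => sub_le_sub (hg h) (hg (neg_le_neg h))) (by simp)
      (fun t => heatPotential_nonneg _ _) hgi hC
      fun l hl => (Measure.restrict_apply_le _ _).trans (hw l hl)
  have hgB : ∀ s t, |s| ≤ F t → |g s| ≤ B t := fun s t h => by
    have h1 := _root_.abs_le.1 h
    have h2 := hg h1.1
    have h3 := hg h1.2
    have hF0 : 0 ≤ F t := heatPotential_nonneg _ _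
    have h4 := hg hF0
    have h5 := hg (neg_nonpos.2 hF0)
    rw [hg0] at h4 h5
    rw [_root_.abs_le]
    constructor <;> simp only [hBdef] <;> linarith
  have hf : IntegrableOn (fun t => heatPotential M₁ (t, 0) - heatPotential M₂ (t, 0)) (Ioo 0 T) :=
    (integrableOn_heatPotential_boundary hT.le hM₁).sub
      (integrableOn_heatPotential_boundary hT.le hM₂)
  -- Inner limit: the negative side is already Lipschitz, so regularising the positive side yields a
  -- globally Lipschitz nonlinearity.
  have stage : ∀ {g : ℝ → ℝ}, Continuous g → Monotone g → g 0 = 0 →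
      (∀ s t, |s| ≤ F t → |g s| ≤ B t) →
      (∃ L, 0 ≤ L ∧ ∀ a b, |g (min a 0) - g (min b 0)| ≤ L * |a - b|) →
      ∃ h, AbelSolution T (fun t => heatPotential M₁ (t, 0) - heatPotential M₂ (t, 0)) g h := by
    rintro g hgc hg hg0 hgB ⟨L, hL0, hL⟩
    exact exists_abelSolution_of_posApprox hT hM₁ hM₂ hgc hg hg0 hB hgB fun n =>
      exists_abelSolution_of_lipschitz hT hf (by positivity) (abs_posApprox_sub_le hg hg0 hL n)
        (monotone_posApprox hg hg0 n).measurable (posApprox_zero hg hg0 n)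
  -- Outer limit: after reflection, which exchanges `M₁` and `M₂`, the same regularisation acts on
  -- the negative side of `g`. Doing one side at a time keeps each family of solutions monotone.
  set g' : ℝ → ℝ := fun s => -g (-s) with hg'
  have hg'm : Monotone g' := fun a b h => neg_le_neg (hg (neg_le_neg h))
  have hg'0 : g' 0 = 0 := by simp [hg', hg0]
  have hg'c : Continuous g' := by fun_prop
  have hg'B : ∀ s t, |s| ≤ F t → |g' s| ≤ B t := fun s t h => by
    rw [hg', abs_neg]
    exact hgB _ _ (by rwa [abs_neg])
  obtain ⟨h, hh⟩ := exists_abelSolution_of_posApprox (B := B) hT hM₂ hM₁ hg'c hg'm hg'0 hB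
    (by rwa [add_comm]) fun n => by
      obtain ⟨h, hh⟩ := stage (g := fun s => -posApprox g' n (-s))
        ((continuous_posApprox hg'm hg'0 hg'c n).comp continuous_neg).neg
        (fun a b h => neg_le_neg (monotone_posApprox hg'm hg'0 n (neg_le_neg h)))
        (by simp [posApprox_zero hg'm hg'0])
        (fun s t h => by
          rw [abs_neg]
          exact (abs_posApprox_le hg'm hg'0 _ _).trans (hg'B _ _ (by rwa [abs_neg])))
        -- Reflected back, the regularised side is the negative one, which is `n`-Lipschitz; hence
        -- `stage` applies with `L = n`.
        ⟨n, n.cast_nonneg, fun a b => by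
          have e : ∀ a, posApprox g' n (-min a 0)
              = infConv (fun r => g' (max r 0)) n (-min a 0) := fun a => by
            rw [posApprox, min_eq_right (neg_nonneg.2 (min_le_right a 0)), hg'0, add_zero]
          rw [e, e, neg_sub_neg, abs_sub_comm]
          refine (abs_infConv_sub_le (comp_max_nonneg hg'm hg'0) n _ _).trans ?_
          refine mul_le_mul_of_nonneg_left ?_ n.cast_nonneg
          rw [neg_sub_neg, abs_sub_comm]
          simpa using abs_min_sub_min_le_max a 0 b 0⟩
      have := hh.neg
      simp only [neg_neg, neg_sub] at this
      exact ⟨_, this⟩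
  have := hh.neg
  simp only [hg', neg_neg, neg_sub] at this
  exact ⟨_, this⟩

end existence

/-! ### Signed data as measures on the parabolic boundary -/

section data

variable {T : ℝ}

/-- The measure on the parabolic boundary with initial part `a` and lateral part `b`. -/
noncomputable def boundaryMeasure (a : Measure (Ioi (0 : ℝ))) (b : Measure (Ico (0 : ℝ) T)) :
    Measure (ℝ × ℝ) :=
  a.map (fun y : Ioi (0 : ℝ) => (0, (y : ℝ))) + b.map (fun t : Ico (0 : ℝ) T => ((t : ℝ), 0))

instance (a : Measure (Ioi (0 : ℝ))) (b : Measure (Ico (0 : ℝ) T)) [IsFiniteMeasure a]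
    [IsFiniteMeasure b] : IsFiniteMeasure (boundaryMeasure a b) := by
  unfold boundaryMeasure; infer_instance

lemma boundaryMeasure_mono {a a' : Measure (Ioi (0 : ℝ))} {b b' : Measure (Ico (0 : ℝ) T)}
    (ha : a ≤ a') (hb : b ≤ b') : boundaryMeasure a b ≤ boundaryMeasure a' b' :=
  add_le_add (Measure.map_mono ha (by fun_prop)) (Measure.map_mono hb (by fun_prop))

lemma boundaryMeasure_add (a a' : Measure (Ioi (0 : ℝ))) (b b' : Measure (Ico (0 : ℝ) T)) :
    boundaryMeasure (a + a') (b + b') = boundaryMeasure a b + boundaryMeasure a' b' := by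
  rw [boundaryMeasure, Measure.map_add _ _ (by fun_prop), Measure.map_add _ _ (by fun_prop),
    boundaryMeasure, boundaryMeasure, add_add_add_comm]

lemma ae_boundaryMeasure (hT : 0 < T) (a : Measure (Ioi (0 : ℝ))) (b : Measure (Ico (0 : ℝ) T)) :
    ∀ᵐ z ∂(boundaryMeasure a b), z ∈ testCylinder T := by
  have hm : MeasurableSet {z | z ∈ testCylinder T} := measurableSet_testCylinder T
  rw [boundaryMeasure, ae_add_measure_iff,
    ae_map_iff (by fun_prop) hm, ae_map_iff (by fun_prop) hm]
  exact ⟨ae_of_all _ fun y => ⟨⟨le_rfl, hT⟩, mem_Ici.2 (le_of_lt (mem_Ioi.1 y.2))⟩, ae_of_all _ fun t => ⟨t.2, self_mem_Ici⟩⟩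

lemma NeumannTestFunction.integrable_data (ζ : NeumannTestFunction T) (hT : 0 < T)
    (a : Measure (Ioi (0 : ℝ))) (b : Measure (Ico (0 : ℝ) T)) [IsFiniteMeasure a]
    [IsFiniteMeasure b] :
    Integrable (fun x : Ioi (0 : ℝ) => ζ.val (0, (x : ℝ))) a ∧
    Integrable (fun t : Ico (0 : ℝ) T => ζ.val ((t : ℝ), 0)) b ∧
    ∫ z, ζ.val z ∂(boundaryMeasure a b) = ∫ x, ζ.val (0, (x : ℝ)) ∂a + ∫ t, ζ.val ((t : ℝ), 0) ∂b := by
  have hi := ζ.integrable_val hT (ae_boundaryMeasure hT a b)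
  rw [boundaryMeasure] at hi ⊢
  have h1 := hi.left_of_add_measure
  have h2 := hi.right_of_add_measure
  refine ⟨h1.comp_measurable (by fun_prop), h2.comp_measurable (by fun_prop), ?_⟩
  rw [integral_add_measure h1 h2, integral_map (by fun_prop) h1.aestronglyMeasurable,
    integral_map (by fun_prop) h2.aestronglyMeasurable]

/-- Positive part of the data `(ν, μ)`. -/
noncomputable def posData (ν : SignedMeasure (Ioi (0 : ℝ))) (μ : SignedMeasure (Ico (0 : ℝ) T)) :
    Measure (ℝ × ℝ) :=
  boundaryMeasure ν.toJordanDecomposition.posPart μ.toJordanDecomposition.posPart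

/-- Negative part of the data `(ν, μ)`. -/
noncomputable def negData (ν : SignedMeasure (Ioi (0 : ℝ))) (μ : SignedMeasure (Ico (0 : ℝ) T)) :
    Measure (ℝ × ℝ) :=
  boundaryMeasure ν.toJordanDecomposition.negPart μ.toJordanDecomposition.negPart

variable (ν ν' : SignedMeasure (Ioi (0 : ℝ))) (μ μ' : SignedMeasure (Ico (0 : ℝ) T))

instance : IsFiniteMeasure (posData ν μ) := by unfold posData; infer_instance

instance : IsFiniteMeasure (negData ν μ) := by unfold negData; infer_instance

lemma integral_signedMeasure {α : Type*} [MeasurableSpace α] (ν : SignedMeasure α) {f : α → ℝ}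
    (h1 : Integrable f ν.toJordanDecomposition.posPart)
    (h2 : Integrable f ν.toJordanDecomposition.negPart) :
    ∫ᵛ x, f x ∂<•ν = ∫ x, f x ∂ν.toJordanDecomposition.posPart
      - ∫ x, f x ∂ν.toJordanDecomposition.negPart := by
  conv_lhs => rw [← ν.toSignedMeasure_toJordanDecomposition]
  rw [JordanDecomposition.toSignedMeasure, VectorMeasure.integral_sub_vectorMeasure
    (by simpa [VectorMeasure.Integrable] using h1) (by simpa [VectorMeasure.Integrable] using h2),
    VectorMeasure.integral_toSignedMeasure, VectorMeasure.integral_toSignedMeasure]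

lemma NeumannTestFunction.integral_data (ζ : NeumannTestFunction T) (hT : 0 < T) :
    (∫ᵛ x, ζ.val (0, (x : ℝ)) ∂<•ν) + ∫ᵛ t, ζ.val ((t : ℝ), 0) ∂<•μ
      = ∫ z, ζ.val z ∂(posData ν μ) - ∫ z, ζ.val z ∂(negData ν μ) := by
  obtain ⟨a1, b1, c1⟩ := ζ.integrable_data hT ν.toJordanDecomposition.posPart
    μ.toJordanDecomposition.posPart
  obtain ⟨a2, b2, c2⟩ := ζ.integrable_data hT ν.toJordanDecomposition.negPart
    μ.toJordanDecomposition.negPart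
  rw [posData, negData, c1, c2, integral_signedMeasure ν a1 a2, integral_signedMeasure μ b1 b2]
  ring

/-- This is `ν⁺ - ν⁻ ≤ ν'⁺ - ν'⁻` with the negative parts moved across. In this form the order
concerns positive measures, and potentials can be applied to it. -/
lemma jordan_add_le_add {α : Type*} [MeasurableSpace α] {ν ν' : SignedMeasure α} (h : ν ≤ ν') :
    ν.toJordanDecomposition.posPart + ν'.toJordanDecomposition.negPart
      ≤ ν'.toJordanDecomposition.posPart + ν.toJordanDecomposition.negPart := by
  rw [← Measure.toSignedMeasure_le_toSignedMeasure_iff, Measure.toSignedMeasure_add,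
    Measure.toSignedMeasure_add]
  rw [← ν.toSignedMeasure_toJordanDecomposition, ← ν'.toSignedMeasure_toJordanDecomposition] at h
  simp only [JordanDecomposition.toSignedMeasure] at h
  intro s hs
  have := h s hs
  simp only [sub_apply, add_apply] at this ⊢
  linarith

variable {ν ν' μ μ'}

lemma posData_add_negData_le (hν : ν ≤ ν') (hμ : μ ≤ μ') :
    posData ν μ + negData ν' μ' ≤ posData ν' μ' + negData ν μ := by
  simp only [posData, negData, ← boundaryMeasure_add]
  exact boundaryMeasure_mono (jordan_add_le_add hν) (jordan_add_le_add hμ)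

end data

/-! ### Absolutely continuous lateral data -/

section flux

variable {T : ℝ} {G : ℝ → ℝ}

/-- The measure `G⁺ dt` on the lateral boundary. -/
noncomputable def fluxMeasure (T : ℝ) (G : ℝ → ℝ) : Measure (ℝ × ℝ) :=
  ((volume.restrict (Ioo 0 T)).withDensity fun t => ENNReal.ofReal (G t)).map fun t => (t, 0)

lemma isFiniteMeasure_fluxMeasure (hG : IntegrableOn G (Ioo 0 T)) :
    IsFiniteMeasure (fluxMeasure T G) := by
  have := isFiniteMeasure_withDensity_ofReal hG.2
  unfold fluxMeasure; infer_instance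

lemma ae_fluxMeasure (T : ℝ) (G : ℝ → ℝ) : ∀ᵐ z ∂(fluxMeasure T G), z ∈ testCylinder T := by
  have hm : MeasurableSet {z | z ∈ testCylinder T} := measurableSet_testCylinder T
  rw [fluxMeasure, ae_map_iff (by fun_prop) hm]
  refine (withDensity_absolutelyContinuous _ _).ae_le ?_
  filter_upwards [ae_restrict_mem measurableSet_Ioo] with t ht
  exact ⟨⟨ht.1.le, ht.2⟩, self_mem_Ici⟩

lemma integral_fluxMeasure_sub (hG : IntegrableOn G (Ioo 0 T)) {F : ℝ × ℝ → ℝ}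
    (h1 : AEStronglyMeasurable F (fluxMeasure T G))
    (h2 : AEStronglyMeasurable F (fluxMeasure T fun t => -G t))
    (hFm : AEStronglyMeasurable (fun t => F (t, 0)) (volume.restrict (Ioo 0 T)))
    (hF : IntegrableOn (fun t => G t * F (t, 0)) (Ioo 0 T)) :
    ∫ z, F z ∂(fluxMeasure T G) - ∫ z, F z ∂(fluxMeasure T fun t => -G t)
      = ∫ t in Ioo 0 T, G t * F (t, 0) := by
  rw [fluxMeasure, fluxMeasure] at *
  rw [integral_map (by fun_prop) h1, integral_map (by fun_prop) h2]
  exact integral_withDensity_ofReal_sub hG.aestronglyMeasurable.aemeasurable hFm hF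

lemma neumannKer_boundary_pole (p : ℝ × ℝ) (r : ℝ) : neumannKer p (r, 0) = heatKer (p.1 - r) p.2 := by
  simp [neumannKer]

lemma heatPotential_fluxMeasure_sub (hG : IntegrableOn G (Ioo 0 T)) {p : ℝ × ℝ}
    (h : IntegrableOn (fun r => heatKer (p.1 - r) p.2 * G r) (Ioo 0 T)) :
    heatPotential (fluxMeasure T G) p - heatPotential (fluxMeasure T fun t => -G t) p
      = ∫ r in Ioo 0 T, heatKer (p.1 - r) p.2 * G r := by
  rw [heatPotential, heatPotential, integral_fluxMeasure_sub hG
    (Measurable.aestronglyMeasurable (by fun_prop)) (Measurable.aestronglyMeasurable (by fun_prop))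
    (Measurable.aestronglyMeasurable (by fun_prop))]
  · simp only [neumannKer_boundary_pole, mul_comm]
  · simpa only [neumannKer_boundary_pole, mul_comm] using h

lemma ae_integrableOn_heatKer_mul (hT : 0 ≤ T) (hG : IntegrableOn G (Ioo 0 T)) :
    ∀ᵐ p ∂(volume.restrict (openCylinder T)),
      IntegrableOn (fun r => heatKer (p.1 - r) p.2 * G r) (Ioo 0 T) := by
  have hm : AEStronglyMeasurable (fun q : (ℝ × ℝ) × ℝ => neumannKer q.1 (q.2, 0) * G q.2)
      ((volume.restrict (openCylinder T)).prod (volume.restrict (Ioo 0 T))) :=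
    (Measurable.aestronglyMeasurable (by fun_prop)).mul hG.aestronglyMeasurable.comp_snd
  have hi : Integrable (fun q : (ℝ × ℝ) × ℝ => neumannKer q.1 (q.2, 0) * G q.2)
      ((volume.restrict (openCylinder T)).prod (volume.restrict (Ioo 0 T))) := by
    rw [integrable_prod_iff' hm]
    refine ⟨ae_of_all _ fun r => (integrableOn_neumannKer T (r, 0)).mul_const (G r), ?_⟩
    refine (hG.norm.const_mul (2 * T)).mono' hm.norm.prod_swap.integral_prod_right'
      (ae_of_all _ fun r => ?_)
    rw [Real.norm_of_nonneg (integral_nonneg fun _ => norm_nonneg _)]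
    simp only [norm_mul, Real.norm_of_nonneg (neumannKer_nonneg _ _)]
    rw [integral_mul_const]
    refine mul_le_mul_of_nonneg_right ?_ (norm_nonneg _)
    rw [integral_eq_lintegral_of_nonneg_ae (ae_of_all _ fun _ => neumannKer_nonneg _ _)
      (Measurable.aestronglyMeasurable (by fun_prop))]
    exact ENNReal.toReal_le_of_le_ofReal (by positivity) (lintegral_neumannKer_le T (r, 0))
  filter_upwards [hi.prod_right_ae] with p hp
  simp only [neumannKer_boundary_pole] at hp
  exact hp

lemma NeumannTestFunction.integral_fluxMeasure_sub (ζ : NeumannTestFunction T) (hT : 0 < T)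
    (hG : IntegrableOn G (Ioo 0 T)) :
    ∫ z, ζ.val z ∂(fluxMeasure T G) - ∫ z, ζ.val z ∂(fluxMeasure T fun t => -G t)
      = ∫ t in Ioo 0 T, G t * ζ.val (t, 0) := by
  have f1 := isFiniteMeasure_fluxMeasure hG
  have f2 := isFiniteMeasure_fluxMeasure hG.neg
  have hm : AEStronglyMeasurable (fun t => ζ.val (t, 0)) (volume.restrict (Ioo 0 T)) :=
    (ζ.continuousOn_val.comp (by fun_prop) fun t ht =>
      ⟨⟨ht.1.le, ht.2⟩, self_mem_Ici⟩).aestronglyMeasurable measurableSet_Ioo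
  obtain ⟨C, hC0, hC⟩ := ζ.exists_bound hT
  refine _root_.integral_fluxMeasure_sub hG
    (ζ.integrable_val hT (ae_fluxMeasure T _)).aestronglyMeasurable
    (ζ.integrable_val hT (ae_fluxMeasure T _)).aestronglyMeasurable hm
    (hG.mul_bdd (c := C) hm ?_)
  filter_upwards [ae_restrict_mem measurableSet_Ioo] with t ht
  exact (hC (t, 0) ⟨⟨ht.1.le, ht.2⟩, self_mem_Ici⟩).1

end flux

/-! ### Lateral traces -/

section trace

variable {T : ℝ} {u v : ℝ × ℝ → ℝ}

lemma closedCylinder_ae_eq (T : ℝ) : closedCylinder T =ᵐ[volume] openCylinder T :=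
  (Measure.set_prod_ae_eq Ioo_ae_eq_Icc Ioi_ae_eq_Ici).symm

lemma Ioo_prod_Ioo_subset (T ε : ℝ) : Ioo 0 T ×ˢ Ioo 0 ε ⊆ openCylinder T :=
  prod_mono le_rfl fun _ h => h.1

lemma integrableOn_sub_boundary (hu : IntegrableOn u (openCylinder T))
    (hu0 : IntegrableOn (fun t => u (t, 0)) (Ioo 0 T)) (ε : ℝ) :
    IntegrableOn (fun p => u p - u (p.1, 0)) (Ioo 0 T ×ˢ Ioo 0 ε) := by
  refine (hu.mono_set (Ioo_prod_Ioo_subset T ε)).sub ?_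
  rw [IntegrableOn, Measure.volume_eq_prod, ← Measure.prod_restrict]
  exact Integrable.comp_fst hu0 _

lemma HasLateralTrace.sub (hu : IntegrableOn u (openCylinder T))
    (hu0 : IntegrableOn (fun t => u (t, 0)) (Ioo 0 T)) (hv : IntegrableOn v (openCylinder T))
    (hv0 : IntegrableOn (fun t => v (t, 0)) (Ioo 0 T)) (htu : HasLateralTrace T u)
    (htv : HasLateralTrace T v) : HasLateralTrace T (fun p => u p - v p) := by
  have h := Tendsto.add htu htv
  rw [add_zero] at h
  refine tendsto_of_tendsto_of_tendsto_of_le_of_le' tendsto_const_nhds h ?_ ?_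
  · filter_upwards [self_mem_nhdsWithin] with ε hε
    exact mul_nonneg (inv_pos.2 hε).le (integral_nonneg fun _ => abs_nonneg _)
  · filter_upwards [self_mem_nhdsWithin] with ε hε
    have i1 := integrableOn_sub_boundary hu hu0 ε
    have i2 := integrableOn_sub_boundary hv hv0 ε
    rw [← mul_add, ← integral_add i1.abs i2.abs]
    refine mul_le_mul_of_nonneg_left (integral_mono_of_nonneg (ae_of_all _ fun _ => abs_nonneg _)
      (i1.abs.add i2.abs) (ae_of_all _ fun p => ?_)) (inv_pos.2 hε).le
    calc |u p - v p - (u (p.1, 0) - v (p.1, 0))|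
        = |(u p - u (p.1, 0)) - (v p - v (p.1, 0))| := by congr 1; ring
      _ ≤ _ := abs_sub _ _

/-- A function that vanishes in the cylinder has zero trace. -/
lemma HasLateralTrace.ae_eq_zero (hu : ∀ᵐ p ∂(volume.restrict (openCylinder T)), u p = 0)
    (hu0 : IntegrableOn (fun t => u (t, 0)) (Ioo 0 T)) (htu : HasLateralTrace T u) :
    ∀ᵐ t ∂(volume.restrict (Ioo 0 T)), u (t, 0) = 0 := by
  -- With `u = 0` inside, the averaged quantity does not depend on `ε`, so its limit `0` is the `L¹`
  -- norm of the boundary values.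
  have h : ∀ᶠ ε : ℝ in 𝓝[>] 0, ε⁻¹ * ∫ p in Ioo 0 T ×ˢ Ioo 0 ε, |u p - u (p.1, 0)|
      = ∫ t in Ioo 0 T, |u (t, 0)| := by
    filter_upwards [self_mem_nhdsWithin] with ε hε
    have e : ∫ p in Ioo 0 T ×ˢ Ioo 0 ε, |u p - u (p.1, 0)|
        = ∫ p in Ioo 0 T ×ˢ Ioo 0 ε, |u (p.1, 0)| * 1 := by
      refine integral_congr_ae ?_
      filter_upwards [ae_mono (Measure.restrict_mono (Ioo_prod_Ioo_subset T ε) le_rfl) hu]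
        with p hp
      rw [hp, zero_sub, abs_neg, mul_one]
    have hε' : (0 : ℝ) < ε := hε
    rw [e, Measure.volume_eq_prod, setIntegral_prod_mul (fun t => |u (t, 0)|) (fun _ => (1 : ℝ))]
    simp [hε'.le]
    field_simp
  have h0 : ∫ t in Ioo 0 T, |u (t, 0)| = 0 :=
    tendsto_nhds_unique (tendsto_const_nhds.congr' (h.mono fun _ h => h.symm)) htu
  rw [integral_eq_zero_iff_of_nonneg (fun _ => abs_nonneg _) hu0.abs] at h0
  filter_upwards [h0] with t ht using abs_eq_zero.1 ht

end trace

/-! ### Weak solutions and the Abel equation -/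

section solutions

variable {T : ℝ} {g h : ℝ → ℝ} {ν ν' : SignedMeasure (Ioi (0 : ℝ))}
  {μ μ' : SignedMeasure (Ico (0 : ℝ) T)} {u u' : ℝ × ℝ → ℝ}

lemma ae_posData (hT : 0 < T) (ν : SignedMeasure (Ioi (0 : ℝ))) (μ : SignedMeasure (Ico (0 : ℝ) T)) :
    ∀ᵐ z ∂(posData ν μ), z ∈ testCylinder T := ae_boundaryMeasure hT _ _

lemma ae_negData (hT : 0 < T) (ν : SignedMeasure (Ioi (0 : ℝ))) (μ : SignedMeasure (Ico (0 : ℝ) T)) :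
    ∀ᵐ z ∂(negData ν μ), z ∈ testCylinder T := ae_boundaryMeasure hT _ _

/-- The solution of the linear problem with data `(ν, μ)` and additional lateral flux `G`. -/
noncomputable def linearSolution (ν : SignedMeasure (Ioi (0 : ℝ)))
    (μ : SignedMeasure (Ico (0 : ℝ) T)) (G : ℝ → ℝ) (p : ℝ × ℝ) : ℝ :=
  heatPotential (posData ν μ + fluxMeasure T fun t => -G t) p
    - heatPotential (negData ν μ + fluxMeasure T G) p

section linear

variable {G : ℝ → ℝ}

lemma heatPotential_add {M N : Measure (ℝ × ℝ)} {p : ℝ × ℝ}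
    (hM : Integrable (fun z => neumannKer p z) M) (hN : Integrable (fun z => neumannKer p z) N) :
    heatPotential (M + N) p = heatPotential M p + heatPotential N p :=
  integral_add_measure hM hN

lemma ae_integrable_neumannKer_boundary {M : Measure (ℝ × ℝ)} [IsFiniteMeasure M] (hT : 0 ≤ T)
    (hM : ∀ᵐ z ∂M, z ∈ testCylinder T) :
    ∀ᵐ t ∂(volume.restrict (Ioo 0 T)), Integrable (fun z => neumannKer (t, 0) z) M := by
  simpa only [neumannKer_zero] using ae_integrable_heatKer_boundary hT hM

lemma linearSolution_eq {p : ℝ × ℝ} (hG : IntegrableOn G (Ioo 0 T))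
    (h1 : Integrable (fun z => neumannKer p z) (posData ν μ))
    (h2 : Integrable (fun z => neumannKer p z) (negData ν μ))
    (h3 : Integrable (fun z => neumannKer p z) (fluxMeasure T G))
    (h4 : Integrable (fun z => neumannKer p z) (fluxMeasure T fun t => -G t))
    (h : IntegrableOn (fun r => heatKer (p.1 - r) p.2 * G r) (Ioo 0 T)) :
    linearSolution ν μ G p = heatPotential (posData ν μ) p - heatPotential (negData ν μ) p
      - ∫ r in Ioo 0 T, heatKer (p.1 - r) p.2 * G r := by
  rw [← heatPotential_fluxMeasure_sub hG h, linearSolution, heatPotential_add h1 h4,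
    heatPotential_add h2 h3]
  ring

lemma linearSolution_ae_eq (hT : 0 < T) (hG : IntegrableOn G (Ioo 0 T)) :
    ∀ᵐ p ∂(volume.restrict (openCylinder T)), linearSolution ν μ G p
      = heatPotential (posData ν μ) p - heatPotential (negData ν μ) p
        - ∫ r in Ioo 0 T, heatKer (p.1 - r) p.2 * G r := by
  have f1 := isFiniteMeasure_fluxMeasure hG
  have f2 : IsFiniteMeasure (fluxMeasure T fun t => -G t) := isFiniteMeasure_fluxMeasure hG.neg
  filter_upwards [ae_integrable_neumannKer (T := T) (M := posData ν μ),
    ae_integrable_neumannKer (T := T) (M := negData ν μ),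
    ae_integrable_neumannKer (T := T) (M := fluxMeasure T G),
    ae_integrable_neumannKer (T := T) (M := fluxMeasure T fun t => -G t),
    ae_integrableOn_heatKer_mul hT.le hG] with p h1 h2 h3 h4 h5
  exact linearSolution_eq hG h1 h2 h3 h4 h5

lemma linearSolution_boundary_ae_eq (hT : 0 < T) (hG : IntegrableOn G (Ioo 0 T)) :
    ∀ᵐ t ∂(volume.restrict (Ioo 0 T)), linearSolution ν μ G (t, 0)
      = heatPotential (posData ν μ) (t, 0) - heatPotential (negData ν μ) (t, 0)
        - ∫ r in Ioo 0 T, heatKer (t - r) 0 * G r := by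
  have f1 := isFiniteMeasure_fluxMeasure hG
  have f2 : IsFiniteMeasure (fluxMeasure T fun t => -G t) := isFiniteMeasure_fluxMeasure hG.neg
  filter_upwards [ae_integrable_neumannKer_boundary hT.le (ae_posData hT ν μ),
    ae_integrable_neumannKer_boundary hT.le (ae_negData hT ν μ),
    ae_integrable_neumannKer_boundary hT.le (ae_fluxMeasure T G),
    ae_integrable_neumannKer_boundary hT.le (ae_fluxMeasure T fun t => -G t),
    (integrable_heatKer_mul_prod hT.le hG).prod_right_ae] with t h1 h2 h3 h4 h5
  exact linearSolution_eq hG h1 h2 h3 h4 h5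

/-- Both potentials have finite data on the parabolic boundary, so integrability, trace and weak
formulation come by subtraction. The lateral datum is `μ - G`, and `G` reappears on the left of the
weak identity. -/
lemma linearSolution_spec (hT : 0 < T) (hG : IntegrableOn G (Ioo 0 T))
    (ν : SignedMeasure (Ioi (0 : ℝ))) (μ : SignedMeasure (Ico (0 : ℝ) T)) :
    IntegrableOn (linearSolution ν μ G) (openCylinder T) ∧
    IntegrableOn (fun t => linearSolution ν μ G (t, 0)) (Ioo 0 T) ∧
    HasLateralTrace T (linearSolution ν μ G) ∧
    ∀ ζ : NeumannTestFunction T,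
      -(∫ p in openCylinder T, (ζ.dt p + ζ.dxx p) * linearSolution ν μ G p)
        + ∫ t in Ioo 0 T, G t * ζ.val (t, 0)
      = (∫ᵛ x, ζ.val (0, (x : ℝ)) ∂<•ν) + ∫ᵛ t, ζ.val ((t : ℝ), 0) ∂<•μ := by
  have f1 := isFiniteMeasure_fluxMeasure hG
  have f2 : IsFiniteMeasure (fluxMeasure T fun t => -G t) := isFiniteMeasure_fluxMeasure hG.neg
  have c1 : ∀ᵐ z ∂(posData ν μ + fluxMeasure T fun t => -G t), z ∈ testCylinder T :=
    ae_add_measure_iff.2 ⟨ae_posData hT ν μ, ae_fluxMeasure T _⟩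
  have c2 : ∀ᵐ z ∂(negData ν μ + fluxMeasure T G), z ∈ testCylinder T :=
    ae_add_measure_iff.2 ⟨ae_negData hT ν μ, ae_fluxMeasure T _⟩
  have i1 := integrableOn_heatPotential (T := T) (M := posData ν μ + fluxMeasure T fun t => -G t)
  have i2 := integrableOn_heatPotential (T := T) (M := negData ν μ + fluxMeasure T G)
  have b1 := integrableOn_heatPotential_boundary hT.le c1
  have b2 := integrableOn_heatPotential_boundary hT.le c2
  refine ⟨i1.sub i2, b1.sub b2, HasLateralTrace.sub i1 b1 i2 b2
    (hasLateralTrace_heatPotential hT.le c1) (hasLateralTrace_heatPotential hT.le c2), fun ζ => ?_⟩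
  rw [ζ.integral_data ν μ hT, ← ζ.integral_fluxMeasure_sub hT hG]
  have e1 := ζ.integral_heat_mul_heatPotential hT c1
  have e2 := ζ.integral_heat_mul_heatPotential hT c2
  simp only [linearSolution, mul_sub]
  rw [integral_sub (ζ.integrableOn_heat_mul hT i1) (ζ.integrableOn_heat_mul hT i2), e1, e2,
    integral_add_measure (ζ.integrable_val hT (ae_posData hT ν μ))
      (ζ.integrable_val hT (ae_fluxMeasure T _)),
    integral_add_measure (ζ.integrable_val hT (ae_negData hT ν μ))
      (ζ.integrable_val hT (ae_fluxMeasure T _))]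
  ring

end linear

/-- Every `L¹` weak solution is given by its boundary values. -/
lemma IsL1WeakSolution.exists_abelSolution (hT : 0 < T) (hu : IsL1WeakSolution T g ν μ u) :
    ∃ h, AbelSolution T
        (fun t => heatPotential (posData ν μ) (t, 0) - heatPotential (negData ν μ) (t, 0)) g h ∧
      (∀ᵐ t ∂(volume.restrict (Ioo 0 T)), u (t, 0) = h t) ∧
      ∀ᵐ p ∂(volume.restrict (openCylinder T)), u p
        = heatPotential (posData ν μ) p - heatPotential (negData ν μ) p
          - ∫ r in Ioo 0 T, heatKer (p.1 - r) p.2 * g (h r) := by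
  obtain ⟨hw, hu1⟩ := hu
  obtain ⟨i1, b1, t1, w1⟩ := linearSolution_spec hT hw.integrable_flux ν μ
  -- With the flux `g(u(·,0))` frozen, `u` and the linear solution satisfy the same linear identity,
  -- so they coincide in the cylinder. Their traces then coincide as well, and the trace identity is
  -- the Abel equation.
  have hzero := ae_eq_zero_of_forall_testFunction hT (hu1.sub i1) fun ζ => by
    have e1 := w1 ζ
    have e2 := hw.weak_eq ζ
    simp only [Pi.sub_apply, mul_sub]
    rw [integral_sub (ζ.integrableOn_heat_mul hT hu1) (ζ.integrableOn_heat_mul hT i1)]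
    linarith
  have htr := HasLateralTrace.ae_eq_zero hzero (hw.integrable_boundary.sub b1)
    (HasLateralTrace.sub hu1 hw.integrable_boundary i1 b1 hw.trace t1)
  have hbm := hw.integrable_boundary.aestronglyMeasurable
  -- The boundary values of `u` are only a.e. measurable, while `AbelSolution` asks for a measurable
  -- function.
  set h := hbm.mk _ with hh
  have hae : ∀ᵐ t ∂(volume.restrict (Ioo 0 T)), u (t, 0) = h t := hbm.ae_eq_mk
  have hflux : ∀ᵐ t ∂(volume.restrict (Ioo 0 T)), g (u (t, 0)) = g (h t) := by
    filter_upwards [hae] with t ht using by rw [ht]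
  have hint : ∀ t x, ∫ r in Ioo 0 T, heatKer (t - r) x * g (u (r, 0))
      = ∫ r in Ioo 0 T, heatKer (t - r) x * g (h r) := fun t x => by
    refine integral_congr_ae ?_
    filter_upwards [hflux] with r hr using by rw [hr]
  refine ⟨h, ⟨hbm.stronglyMeasurable_mk.measurable, hw.integrable_boundary.congr hae,
    hw.integrable_flux.congr hflux, ?_⟩, hae, ?_⟩
  · filter_upwards [hae, htr, linearSolution_boundary_ae_eq (ν := ν) (μ := μ) hT hw.integrable_flux]
      with t a1 a2 a3
    rw [← hint, ← a1, ← a3]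
    exact sub_eq_zero.1 a2
  · filter_upwards [hzero, linearSolution_ae_eq (ν := ν) (μ := μ) hT hw.integrable_flux]
      with p a1 a2
    rw [← hint, ← a2]
    exact sub_eq_zero.1 a1

/-- Take the linear solution with flux `g(h)`. The Abel equation says that its boundary values are
`h` a.e., so the prescribed flux is the nonlinear one. -/
lemma AbelSolution.exists_isL1WeakSolution (hT : 0 < T) (hh : AbelSolution T
      (fun t => heatPotential (posData ν μ) (t, 0) - heatPotential (negData ν μ) (t, 0)) g h) :
    ∃ u, IsL1WeakSolution T g ν μ u := by
  obtain ⟨i1, b1, t1, w1⟩ := linearSolution_spec hT hh.integrableOn_flux ν μ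
  have hae : ∀ᵐ t ∂(volume.restrict (Ioo 0 T)),
      g (h t) = g (linearSolution ν μ (fun t => g (h t)) (t, 0)) := by
    filter_upwards [linearSolution_boundary_ae_eq (ν := ν) (μ := μ) hT hh.integrableOn_flux, hh.eq]
      with t a1 a2
    rw [a1, ← a2]
  refine ⟨linearSolution ν μ fun t => g (h t), ⟨?_, b1, hh.integrableOn_flux.congr hae, t1,
    fun ζ => ?_⟩, i1⟩
  · exact (i1.congr_set_ae (closedCylinder_ae_eq T)).locallyIntegrableOn
  · rw [← w1 ζ]
    congr 1
    refine integral_congr_ae ?_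
    filter_upwards [hae] with t ht using by rw [ht]

theorem IsL1WeakSolution.le (hT : 0 < T) (hgm : Monotone g) (hν : ν ≤ ν') (hμ : μ ≤ μ')
    (hu : IsL1WeakSolution T g ν μ u) (hu' : IsL1WeakSolution T g ν' μ' u') :
    (∀ᵐ p ∂(volume.restrict (openCylinder T)), u p ≤ u' p) ∧
    (∀ᵐ t ∂(volume.restrict (Ioo (0 : ℝ) T)), u (t, 0) ≤ u' (t, 0)) := by
  obtain ⟨h, hh, hb, hp⟩ := hu.exists_abelSolution hT
  obtain ⟨h', hh', hb', hp'⟩ := hu'.exists_abelSolution hT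
  set A := posData ν μ + negData ν' μ' with hA
  set B := posData ν' μ' + negData ν μ with hB
  have hAB : A ≤ B := posData_add_negData_le hν hμ
  -- `D` is the increment of the data as a positive measure. The two linear solutions differ by its
  -- potential, so both the boundary and the interior comparison are applied with `D`.
  set D := B - A with hD
  have hDB : D + A = B := Measure.sub_add_cancel_of_le hAB
  have hDle : D ≤ B := Measure.sub_le
  have fD : IsFiniteMeasure D := isFiniteMeasure_of_le B hDle
  have cB : ∀ᵐ z ∂B, z ∈ testCylinder T :=
    ae_add_measure_iff.2 ⟨ae_posData hT ν' μ', ae_negData hT ν μ⟩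
  have cD : ∀ᵐ z ∂D, z ∈ testCylinder T := ae_mono hDle cB
  have key : ∀ p, Integrable (fun z => neumannKer p z) B →
      heatPotential (posData ν' μ') p - heatPotential (negData ν' μ') p
        = heatPotential (posData ν μ) p - heatPotential (negData ν μ) p + heatPotential D p := by
    intro p hi
    have hiA := hi.mono_measure hAB
    have e1 := heatPotential_add (hi.mono_measure hDle) hiA
    rw [hDB, hB, hA, heatPotential_add hi.left_of_add_measure hi.right_of_add_measure,
      heatPotential_add hiA.left_of_add_measure hiA.right_of_add_measure] at e1
    linarith
  have keyb : ∀ᵐ t ∂(volume.restrict (Ioo 0 T)),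
      Integrable (fun z => neumannKer (t, 0) z) B := ae_integrable_neumannKer_boundary hT.le cB
  have hle := hh.le hT cD hgm.measurable hgm.measurable hh'
    (by filter_upwards [keyb] with t ht; rw [key _ ht]; ring) fun t ht => hgm ht.le
  refine ⟨?_, by filter_upwards [hle, hb, hb'] with t a1 a2 a3; rwa [a2, a3]⟩
  have hint := interior_comparison (G := fun t => g (h t) - g (h' t)) hT cD
    ((hgm.measurable.comp hh.measurable).sub (hgm.measurable.comp hh'.measurable))
    (hh.integrableOn_flux.sub hh'.integrableOn_flux) (by
      filter_upwards [hle, keyb, hh.eq, hh'.eq,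
        (integrable_heatKer_mul_prod hT.le hh.integrableOn_flux).prod_right_ae,
        (integrable_heatKer_mul_prod hT.le hh'.integrableOn_flux).prod_right_ae]
        with t a1 a2 a3 a4 j1 j2
      simp only [mul_sub]
      rw [integral_sub j1 j2]
      have := key _ a2
      linarith)
  filter_upwards [hint, hp, hp', ae_integrable_neumannKer (T := T) (M := B),
    ae_integrableOn_heatKer_mul hT.le hh.integrableOn_flux,
    ae_integrableOn_heatKer_mul hT.le hh'.integrableOn_flux] with p a1 a2 a3 a4 j1 j2
  simp only [mul_sub] at a1
  rw [integral_sub j1 j2] at a1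
  rw [a2, a3, key p a4]
  linarith

end solutions

theorem mainTheorem2 (T : ℝ) (hT : 0 < T) (g : ℝ → ℝ) (hgc : Continuous g) (hgm : Monotone g)
    (hg0 : g 0 = 0)
    (hgi : IntegrableOn (fun s : ℝ => (g s - g (-s)) * s ^ (-3 : ℤ)) (Ioi 1) volume) :
    (∀ (ν : SignedMeasure (Ioi (0 : ℝ))) (μ : SignedMeasure (Ico (0 : ℝ) T)),
      ∃ u : ℝ × ℝ → ℝ, IsL1WeakSolution T g ν μ u ∧
        ∀ v : ℝ × ℝ → ℝ, IsL1WeakSolution T g ν μ v →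
          (∀ᵐ p ∂(volume.restrict (openCylinder T)), v p = u p) ∧
          (∀ᵐ t ∂(volume.restrict (Ioo (0 : ℝ) T)), v (t, 0) = u (t, 0))) ∧
    (∀ (ν ν' : SignedMeasure (Ioi (0 : ℝ))) (μ μ' : SignedMeasure (Ico (0 : ℝ) T))
      (u u' : ℝ × ℝ → ℝ), ν ≤ ν' → μ ≤ μ' →
      IsL1WeakSolution T g ν μ u → IsL1WeakSolution T g ν' μ' u' →
        (∀ᵐ p ∂(volume.restrict (openCylinder T)), u p ≤ u' p) ∧
        (∀ᵐ t ∂(volume.restrict (Ioo (0 : ℝ) T)), u (t, 0) ≤ u' (t, 0))) := by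
  refine ⟨fun ν μ => ?_, fun ν ν' μ μ' u u' hν hμ hu hu' => hu.le hT hgm hν hμ hu'⟩
  obtain ⟨h, hh⟩ := exists_abelSolution hT (ae_posData hT ν μ) (ae_negData hT ν μ) hgc hgm hg0 hgi
  obtain ⟨u, hu⟩ := hh.exists_isL1WeakSolution hT
  refine ⟨u, hu, fun v hv => ?_⟩
  -- Uniqueness is comparison with equal data, used in both directions.
  obtain ⟨a1, a2⟩ := hu.le hT hgm le_rfl le_rfl hv
  obtain ⟨b1, b2⟩ := hv.le hT hgm le_rfl le_rfl hu
  constructor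
  · filter_upwards [a1, b1] with p h1 h2 using le_antisymm h2 h1
  · filter_upwards [a2, b2] with t h1 h2 using le_antisymm h2 h1
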